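/- Let $M$ be a smooth manifold and let $A\to M$ be a Lie algebroid: a smooth vector bundle of finite rank with a smooth bundle map $\rho:A\to TM$ (the anchor) and an $\mathbb R$-bilinear Lie bracket on $\Gamma(A)$ such that $[s,ft]=f[s,t]+(\rho(s)f)\,t$ for all $s,t\in\Gamma(A)$, $f\in C^\infty(M)$. Let $d_A:\Gamma(\Lambda^kA^*)\to\Gamma(\Lambda^{k+1}A^*)$ be its differential, $$(d_A\eta)(\xi_1,\dots,\xi_{k+1})=\sum_i(-1)^{i+1}\rho(\xi_i)\bigl(\eta(\dots,\hat\xi_i,\dots)\bigr)+\sum_{i<j}(-1)^{i+j}\eta([\xi_i,\xi_j],\dots,\hat\xi_i,\dots,\hat\xi_j,\dots).$$ A form $\eta\in\Gamma(\Lambda^kA^*)$ is called pointwise horizontal, $\eta\in\Gamma((\Lambda^kA^*)^{hor})$, if $\iota_v\eta_m=0$ for all $m\in M$ and all $v\in\ker\rho_m$. The horizontal complex is $\Gamma(\Lambda^kA^*)^{hor}=\{\eta : \eta \text{ and } d_A\eta \text{ are pointwise horizontal}\}$, and $$\mathcal H^k_{hor}(A)=\frac{\ker\bigl(d_A:\Gamma(\Lambda^kA^*)^{hor}\to\Gamma(\Lambda^{k+1}A^*)^{hor}\bigr)}{d_A\,\Gamma(\Lambda^{k-1}A^*)^{hor}}$$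 (the denominator is $0$ for $k=0$). A leaf $L$ of $A$ is a maximal connected immersed submanifold $L\subset M$ with $T_xL=\rho(A_x)$ for all $x\in L$. Let $k\ge 0$. Then the following hold. 1. If $\eta\in\Gamma((\Lambda^kA^*)^{hor})$ and $L$ is a leaf of $A$, then $\eta|_L$ is a smooth section of $\Lambda^k(A|_L)^*$ that is horizontal with respect to the anchor $\rho_L:A|_L\to TL$ of the restriction of $A$ to $L$, and there is a unique $k$-form $\eta_L\in\Omega^k(L)$ with $\eta_L(\rho_L a_1,\dots,\rho_L a_k)=\eta(a_1,\dots,a_k)$ for all $x\in L$ and $a_1,\dots,a_k\in A_x$. 2. $\eta$ is completely determined by the forms $\eta_L$: if $\eta,\theta\in\Gamma((\Lambda^kA^*)^{hor})$ and $\eta_L=\theta_L$ for every leaf $L$ of $A$, then $\eta=\theta$. 3. If $\eta\in\Gamma(\Lambda^kA^*)^{hor}$ lies in the horizontal complex, then $(d_A\eta)_L=d\eta_L$ for every leaf $L$, where $d$ is the de Rham differential of $L$. 4. If $\eta$ is a cocycle of the horizontal complex and $[\eta]=0$ in $\mathcal H^k_{hor}(A)$, then, for every leaf $L$, $\eta_L$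 is closed and $[\eta_L]=0$ in $H^k_{dR}(L)$. -/

import Mathlib

open Bundle
open scoped Manifold ContDiff Topology Bundle

universe u

noncomputable section

section Basic

variable {E : Type*} [NormedAddCommGroup E] [NormedSpace ℝ E]
  {M : Type*} [TopologicalSpace M] [ChartedSpace E M]
  {F : Type*} [NormedAddCommGroup F] [NormedSpace ℝ F]
  {V : M → Type*} [TopologicalSpace (TotalSpace F V)]
  [∀ x, AddCommGroup (V x)] [∀ x, Module ℝ (V x)] [∀ x, TopologicalSpace (V x)]
  [FiberBundle F V] [VectorBundle ℝ F V]

/-- The product of a smooth function and a smooth section. -/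
def funSMul (f : M → ℝ) (hf : ContMDiff 𝓘(ℝ, E) 𝓘(ℝ, ℝ) ∞ f)
    (s : Cₛ^∞⟮𝓘(ℝ, E); F, V⟯) : Cₛ^∞⟮𝓘(ℝ, E); F, V⟯ where
  toFun := fun x => f x • s x
  contMDiff_toFun := hf.smul_section s.contMDiff

variable (E F V) in
/-- The families of alternating `k`-forms on the fibres of `V` that are smooth, i.e. whose value on
any smooth sections of `V` is a smooth function. -/
def smoothFormSubmodule (k : ℕ) : Submodule ℝ (∀ x, (V x) [⋀^Fin k]→ₗ[ℝ] ℝ) where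
  carrier := {η | ∀ s : Fin k → Cₛ^∞⟮𝓘(ℝ, E); F, V⟯,
    ContMDiff 𝓘(ℝ, E) 𝓘(ℝ, ℝ) ∞ (fun x => η x (fun i => s i x))}
  add_mem' := fun ha hb s => (ha s).add (hb s)
  zero_mem' := fun _ => contMDiff_const
  smul_mem' := fun _ _ ha s => contMDiff_const.mul (ha s)

variable (E F V) in
/-- The space `Γ(Λᵏ V*)` of smooth `k`-forms on the vector bundle `V`. -/
def SmoothForm (k : ℕ) : Type _ := ↥(smoothFormSubmodule E F V k)

instance SmoothForm.instAddCommGroup (k : ℕ) : AddCommGroup (SmoothForm E F V k) :=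
  inferInstanceAs (AddCommGroup ↥(smoothFormSubmodule E F V k))

instance SmoothForm.instModule (k : ℕ) : Module ℝ (SmoothForm E F V k) :=
  inferInstanceAs (Module ℝ ↥(smoothFormSubmodule E F V k))

variable (E F V) in
/-- A Lie algebroid structure on the smooth vector bundle `V` over `M`: an anchor, which is a
smooth bundle map `ρ : V → TM`, and a Lie bracket on the smooth sections satisfying
`[s, f t] = f [s, t] + ρ(s)(f) t`. -/
structure LieAlgebroid [IsManifold 𝓘(ℝ, E) ∞ M] [ContMDiffVectorBundle ∞ F V 𝓘(ℝ, E)] where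
  anchor : ∀ x, V x →ₗ[ℝ] TangentSpace 𝓘(ℝ, E) x
  contMDiff_anchor : ContMDiff (𝓘(ℝ, E).prod 𝓘(ℝ, F)) 𝓘(ℝ, E).tangent ∞
    (fun p : TotalSpace F V => (⟨p.1, anchor p.1 p.2⟩ : TangentBundle 𝓘(ℝ, E) M))
  bracket : Cₛ^∞⟮𝓘(ℝ, E); F, V⟯ →ₗ[ℝ] Cₛ^∞⟮𝓘(ℝ, E); F, V⟯ →ₗ[ℝ] Cₛ^∞⟮𝓘(ℝ, E); F, V⟯
  bracket_self : ∀ s, bracket s s = 0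
  jacobi : ∀ s t u, bracket s (bracket t u) = bracket (bracket s t) u + bracket t (bracket s u)
  leibniz : ∀ (f : M → ℝ) (hf : ContMDiff 𝓘(ℝ, E) 𝓘(ℝ, ℝ) ∞ f) (s t) (x : M),
    bracket s (funSMul f hf t) x = f x • bracket s t x + mvfderiv 𝓘(ℝ, E) f x (anchor x (s x)) • t x

end Basic

/-! ### Auxiliary facts on sections -/

section Sections

variable {E : Type*} [NormedAddCommGroup E] [NormedSpace ℝ E] [FiniteDimensional ℝ E]
  {M : Type*} [TopologicalSpace M] [ChartedSpace E M] [IsManifold 𝓘(ℝ, E) ∞ M] [T2Space M]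
  {F : Type*} [NormedAddCommGroup F] [NormedSpace ℝ F] [FiniteDimensional ℝ F]
  {V : M → Type*} [TopologicalSpace (TotalSpace F V)]
  [∀ x, AddCommGroup (V x)] [∀ x, Module ℝ (V x)] [∀ x, TopologicalSpace (V x)]
  [FiberBundle F V] [VectorBundle ℝ F V] [ContMDiffVectorBundle ∞ F V 𝓘(ℝ, E)]

variable (E F V) in
/-- Evaluation of sections at a point, as a linear map. -/
def evalSection (x : M) : Cₛ^∞⟮𝓘(ℝ, E); F, V⟯ →ₗ[ℝ] V x where
  toFun := fun s => s x
  map_add' := fun _ _ => rfl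
  map_smul' := fun _ _ => rfl

/-- Near `x` there is a global frame after cutting off by a bump function `ψ`, and any smooth
section `s` satisfies `ψ² s = ∑ i, (ψ cᵢ) (ψ eᵢ)`, where `cᵢ` vanishes wherever `s` does. -/
theorem exists_cutoff_frame (x : M) :
    ∃ (ψ : M → ℝ) (_ : ContMDiff 𝓘(ℝ, E) 𝓘(ℝ, ℝ) ∞ ψ)
      (e : Module.Free.ChooseBasisIndex ℝ F → Cₛ^∞⟮𝓘(ℝ, E); F, V⟯), ψ x = 1 ∧
      ∀ s : Cₛ^∞⟮𝓘(ℝ, E); F, V⟯, ∃ c : Module.Free.ChooseBasisIndex ℝ F → M → ℝ,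
        (∀ i, ContMDiff 𝓘(ℝ, E) 𝓘(ℝ, ℝ) ∞ (c i)) ∧
        (∀ y, (ψ y * ψ y) • s y = ∑ i, c i y • e i y) ∧ (s x = 0 → ∀ i, c i x = 0) := by
  have : ContMDiffVectorBundle 1 F V 𝓘(ℝ, E) := ContMDiffVectorBundle.of_le (n := ∞) (by simp)
  let t := trivializationAt F V x
  have hx : x ∈ t.baseSet := FiberBundle.mem_baseSet_trivializationAt F V x
  obtain ⟨ψ, hψ, -⟩ := ((SmoothBumpFunction.nhds_basis_support (I := 𝓘(ℝ, E))
    (t.open_baseSet.mem_nhds hx)).mem_iff.1 (t.open_baseSet.mem_nhds hx))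
  let b := Module.Free.chooseBasis ℝ F
  have hψs : ContMDiff 𝓘(ℝ, E) 𝓘(ℝ, ℝ) ∞ ψ := ψ.contMDiff
  have hts : ∀ y, y ∉ t.baseSet → ψ y = 0 := fun y hy =>
    image_eq_zero_of_notMem_tsupport (fun h => hy (hψ h))
  refine ⟨ψ, hψs, fun i => ⟨(ψ : M → ℝ) • t.localFrame b i,
    hψs.contMDiffOn.smul_section_of_tsupport t.open_baseSet hψ
      (t.contMDiffOn_localFrame_baseSet _ b i)⟩, ψ.eq_one, fun s => ?_⟩
  refine ⟨fun i y => ψ y • t.localFrameCoeff 𝓘(ℝ, E) b i y (s y), fun i => ?_, fun y => ?_,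
    fun hs i => ?_⟩
  · refine contMDiff_of_tsupport fun y hy => ?_
    have hy' : y ∈ t.baseSet := hψ (tsupport_smul_subset_left _ _ hy)
    exact (hψs y).smul (contMDiffAt_localFrameCoeff b hy' (s.contMDiff y) i)
  · by_cases hy : y ∈ t.baseSet
    · conv_lhs => rw [t.eq_sum_localFrameCoeff_smul (I := 𝓘(ℝ, E)) (b := b) (s := s) hy]
      rw [Finset.smul_sum]
      refine Finset.sum_congr rfl fun i _ => ?_
      simp only [ContMDiffSection.coeFn_mk, Pi.smul_apply', smul_eq_mul]
      rw [smul_smul, smul_smul]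
      congr 1
      ring
    · simp [hts y hy]
  · simp [hs]

theorem evalSection_surjective (x : M) : Function.Surjective (evalSection E F V x) := by
  have : ContMDiffVectorBundle 1 F V 𝓘(ℝ, E) := ContMDiffVectorBundle.of_le (n := ∞) (by simp)
  intro v
  let t := trivializationAt F V x
  have hx : x ∈ t.baseSet := FiberBundle.mem_baseSet_trivializationAt F V x
  obtain ⟨ψ, hψ, -⟩ := ((SmoothBumpFunction.nhds_basis_support (I := 𝓘(ℝ, E))
    (t.open_baseSet.mem_nhds hx)).mem_iff.1 (t.open_baseSet.mem_nhds hx))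
  let b := Module.Free.chooseBasis ℝ F
  refine ⟨∑ i, (t.basisAt b hx).repr v i • ⟨(ψ : M → ℝ) • t.localFrame b i,
    ψ.contMDiff.contMDiffOn.smul_section_of_tsupport t.open_baseSet hψ
      (t.contMDiffOn_localFrame_baseSet _ b i)⟩, ?_⟩
  rw [map_sum]
  conv_rhs => rw [← (t.basisAt b hx).sum_repr v]
  refine Finset.sum_congr rfl fun i _ => ?_
  rw [map_smul]
  congr 1
  change (ψ x) • t.localFrame b i x = _
  rw [ψ.eq_one, one_smul, t.localFrame_apply_of_mem_baseSet b hx]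

variable (E F V) in
/-- A linear choice, for each vector `v` in the fibre at `x`, of a smooth section through `v`. -/
def extendSection (x : M) : V x →ₗ[ℝ] Cₛ^∞⟮𝓘(ℝ, E); F, V⟯ :=
  ((evalSection E F V x).exists_rightInverse_of_surjective
    (LinearMap.range_eq_top.2 (evalSection_surjective x))).choose

theorem extendSection_apply (x : M) (v : V x) : extendSection E F V x v x = v :=
  LinearMap.congr_fun ((evalSection E F V x).exists_rightInverse_of_surjective
    (LinearMap.range_eq_top.2 (evalSection_surjective x))).choose_spec v

end Sections

/-! ### The Lie algebroid differential -/

namespace LieAlgebroid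

theorem map_smul_entry {k : ℕ} {W : Type*} [AddCommGroup W] [Module ℝ W]
    (η : W [⋀^Fin k]→ₗ[ℝ] ℝ) (u u' : Fin k → W)
    (i : Fin k) (c : ℝ) (h : ∀ l, u' l = if l = i then c • u l else u l) : η u' = c * η u := by
  have h' : u' = Function.update u i (c • u i) := by
    funext l
    rw [h]
    by_cases hl : l = i
    · subst hl; simp
    · simp [hl]
  rw [h', AlternatingMap.map_update_smul, Function.update_eq_self, smul_eq_mul]

theorem removeNth_succ_cons {X : Type*} {n : ℕ} (a : X) (ξ : Fin (n + 1) → X) (m : Fin (n + 1)) :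
    m.succ.removeNth (Fin.cons a ξ : Fin (n + 2) → X) = Fin.cons a (m.removeNth ξ) := by
  funext l
  refine Fin.cases ?_ (fun l => ?_) l
  · simp [Fin.removeNth]
  · simp [Fin.removeNth]

variable {E : Type*} [NormedAddCommGroup E] [NormedSpace ℝ E] 
  {M : Type*} [TopologicalSpace M] [ChartedSpace E M] [IsManifold 𝓘(ℝ, E) ∞ M]
  {F : Type*} [NormedAddCommGroup F] [NormedSpace ℝ F]
  {V : M → Type*} [TopologicalSpace (TotalSpace F V)]
  [∀ x, AddCommGroup (V x)] [∀ x, Module ℝ (V x)] [∀ x, TopologicalSpace (V x)]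
  [FiberBundle F V] [VectorBundle ℝ F V] [ContMDiffVectorBundle ∞ F V 𝓘(ℝ, E)]
  (A : LieAlgebroid E F V)

/-- The second sum of the Koszul formula,
`∑_{p<q} (-1)^{p+q} η([ξ_p, ξ_q], ξ_0, …, ξ̂_p, …, ξ̂_q, …)`. The pairs `p < q` are written as
`p = i`, `q = j + 1` with `i ≤ j`, whence the sign in front of the sum. -/
def koszulBracket : ∀ {k : ℕ} (_ : ∀ x, (V x) [⋀^Fin k]→ₗ[ℝ] ℝ)
    (_ : Fin (k + 1) → Cₛ^∞⟮𝓘(ℝ, E); F, V⟯), M → ℝ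
  | 0, _, _ => fun _ => 0
  | n + 1, η, ξ => fun x => - ∑ i : Fin (n + 1), ∑ j ≥ i, (-1 : ℝ) ^ (i + j : ℕ) *
      η x (Matrix.vecCons (A.bracket (ξ i.castSucc) (ξ j.succ) x)
        (fun l => j.removeNth (i.castSucc.removeNth ξ) l x))

/-- The Koszul formula
`∑_i (-1)^i ρ(ξ_i)(η(ξ_0, …, ξ̂_i, …)) + ∑_{i<j} (-1)^{i+j} η([ξ_i, ξ_j], …, ξ̂_i, …, ξ̂_j, …)`,
with indices starting at `0`. -/
def koszul {k : ℕ} (η : ∀ x, (V x) [⋀^Fin k]→ₗ[ℝ] ℝ)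
    (ξ : Fin (k + 1) → Cₛ^∞⟮𝓘(ℝ, E); F, V⟯) (x : M) : ℝ :=
  ∑ i : Fin (k + 1), (-1 : ℝ) ^ (i : ℕ) *
      mvfderiv 𝓘(ℝ, E) (fun y => η y (fun l => i.removeNth ξ l y)) x (A.anchor x (ξ i x))
    + A.koszulBracket η ξ x

theorem smooth_anchor_apply (s : Cₛ^∞⟮𝓘(ℝ, E); F, V⟯) :
    ContMDiff 𝓘(ℝ, E) 𝓘(ℝ, E).tangent ∞
      (fun x => (⟨x, A.anchor x (s x)⟩ : TangentBundle 𝓘(ℝ, E) M)) :=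
  A.contMDiff_anchor.comp s.contMDiff

theorem smooth_derivative (s : Cₛ^∞⟮𝓘(ℝ, E); F, V⟯) {f : M → ℝ}
    (hf : ContMDiff 𝓘(ℝ, E) 𝓘(ℝ, ℝ) ∞ f) :
    ContMDiff 𝓘(ℝ, E) 𝓘(ℝ, ℝ) ∞ (fun x => mvfderiv 𝓘(ℝ, E) f x (A.anchor x (s x))) :=
  (contMDiff_snd_tangentBundle_modelSpace ℝ 𝓘(ℝ, ℝ)).comp
    ((hf.contMDiff_tangentMap (m := ∞) (by simp)).comp (A.smooth_anchor_apply s))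

/-- The form `η` at `x`, evaluated on global sections. -/
def formOnSections {k : ℕ} (η : ∀ x, (V x) [⋀^Fin k]→ₗ[ℝ] ℝ) (x : M) :
    Cₛ^∞⟮𝓘(ℝ, E); F, V⟯ [⋀^Fin k]→ₗ[ℝ] ℝ :=
  (η x).compLinearMap (evalSection E F V x)

/-- `s ↦ (ξ ↦ ρ(s)(η(ξ)))` at `x`. -/
def derivOnSections {k : ℕ} (η : SmoothForm E F V k) (x : M) :
    Cₛ^∞⟮𝓘(ℝ, E); F, V⟯ →ₗ[ℝ] Cₛ^∞⟮𝓘(ℝ, E); F, V⟯ [⋀^Fin k]→ₗ[ℝ] ℝ where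
  toFun s :=
    { toFun := fun ξ => mvfderiv 𝓘(ℝ, E) (fun y => formOnSections η.1 y ξ) x (A.anchor x (s x))
      map_update_add' := by
        intro _ ξ i a b
        have h (c) := ((η.2 (Function.update ξ i c)) x).mdifferentiableAt (by simp)
        simp only [AlternatingMap.map_update_add]
        exact DFunLike.congr_fun (mvfderiv_fun_add (h a) (h b)) _
      map_update_smul' := by
        intro _ ξ i r a
        have h (c) := ((η.2 (Function.update ξ i c)) x).mdifferentiableAt (by simp)
        simp only [AlternatingMap.map_update_smul, smul_eq_mul]
        refine (DFunLike.congr_fun (mvfderiv_fun_mul (mdifferentiableAt_const (c := r)) (h a))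
          _).trans ?_
        rw [mvfderiv_const]
        simp
        exact Or.inl rfl
      map_eq_zero_of_eq' := by
        intro ξ i j h hij
        simp only [AlternatingMap.map_eq_zero_of_eq _ ξ h hij]
        rw [mvfderiv_const]
        rfl }
  map_add' s t := by
    ext ξ
    change mvfderiv 𝓘(ℝ, E) _ x (A.anchor x (s x + t x)) = _
    rw [map_add, map_add]
    rfl
  map_smul' r s := by
    ext ξ
    change mvfderiv 𝓘(ℝ, E) _ x (A.anchor x (r • s x)) = _
    rw [map_smul, map_smul]
    rfl

/-- `s, t ↦ η([s, t], …)` at `x`. -/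
def bracketOnSections {n : ℕ} (η : ∀ x, (V x) [⋀^Fin (n + 1)]→ₗ[ℝ] ℝ) (x : M) :
    Cₛ^∞⟮𝓘(ℝ, E); F, V⟯ →ₗ[ℝ] Cₛ^∞⟮𝓘(ℝ, E); F, V⟯ →ₗ[ℝ]
      Cₛ^∞⟮𝓘(ℝ, E); F, V⟯ [⋀^Fin n]→ₗ[ℝ] ℝ :=
  A.bracket.compr₂ (AlternatingMap.curryLeft (formOnSections η x))

theorem bracket_swap (s t : Cₛ^∞⟮𝓘(ℝ, E); F, V⟯) : A.bracket s t = - A.bracket t s := by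
  have h := A.bracket_self (s + t)
  simp only [map_add, LinearMap.add_apply, A.bracket_self, zero_add, add_zero] at h
  exact eq_neg_of_add_eq_zero_right h

/-- The Koszul formula as an alternating map on sections. -/
def koszulAlt : ∀ {k : ℕ} (_ : SmoothForm E F V k) (_ : M),
    Cₛ^∞⟮𝓘(ℝ, E); F, V⟯ [⋀^Fin (k + 1)]→ₗ[ℝ] ℝ
  | 0, η, x => AlternatingMap.alternatizeUncurryFin (A.derivOnSections η x)
  | _ + 1, η, x => AlternatingMap.alternatizeUncurryFin (A.derivOnSections η x) -
      (2⁻¹ : ℝ) • AlternatingMap.alternatizeUncurryFin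
        (AlternatingMap.alternatizeUncurryFinLM ∘ₗ A.bracketOnSections η.1 x)

theorem koszulAlt_apply {k : ℕ} (η : SmoothForm E F V k)
    (ξ : Fin (k + 1) → Cₛ^∞⟮𝓘(ℝ, E); F, V⟯) (x : M) :
    A.koszulAlt η x ξ = A.koszul η.1 ξ x := by
  have h1 : AlternatingMap.alternatizeUncurryFin (A.derivOnSections η x) ξ =
      ∑ i : Fin (k + 1), (-1 : ℝ) ^ (i : ℕ) *
      mvfderiv 𝓘(ℝ, E) (fun y => η.1 y (fun l => i.removeNth ξ l y)) x (A.anchor x (ξ i x)) := by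
    rw [AlternatingMap.alternatizeUncurryFin_apply]
    refine Finset.sum_congr rfl fun i _ => ?_
    rw [zsmul_eq_mul]
    push_cast
    rfl
  cases k with
  | zero => simp only [koszulAlt, koszul, koszulBracket, h1, add_zero]
  | succ n =>
    simp only [koszulAlt, koszul, koszulBracket, AlternatingMap.sub_apply,
      AlternatingMap.smul_apply, h1]
    rw [sub_eq_add_neg]
    congr 2
    rw [AlternatingMap.alternatizeUncurryFin_alternatizeUncurryFinLM_comp_apply, Finset.smul_sum]
    refine Finset.sum_congr rfl fun i _ => ?_
    rw [Finset.smul_sum]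
    refine Finset.sum_congr rfl fun j _ => ?_
    have h2 : ∀ a b : Cₛ^∞⟮𝓘(ℝ, E); F, V⟯, A.bracketOnSections η.1 x b a =
        - A.bracketOnSections η.1 x a b := by
      intro a b
      simp only [bracketOnSections, LinearMap.compr₂_apply]
      rw [A.bracket_swap, map_neg]
    have h3 : ∀ (a b : Cₛ^∞⟮𝓘(ℝ, E); F, V⟯) (w : Fin n → Cₛ^∞⟮𝓘(ℝ, E); F, V⟯),
        A.bracketOnSections η.1 x a b w =
          η.1 x (Matrix.vecCons (A.bracket a b x) (fun l => w l x)) := by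
      intro a b w
      change η.1 x _ = _
      congr 1
      funext l
      refine Fin.cases ?_ (fun l => ?_) l <;> rfl
    rw [h2 (ξ i.castSucc), AlternatingMap.neg_apply, h3, zsmul_eq_mul, smul_eq_mul]
    push_cast
    ring

theorem smooth_koszul {k : ℕ} (η : SmoothForm E F V k)
    (ξ : Fin (k + 1) → Cₛ^∞⟮𝓘(ℝ, E); F, V⟯) :
    ContMDiff 𝓘(ℝ, E) 𝓘(ℝ, ℝ) ∞ (A.koszul η.1 ξ) := by
  change ContMDiff 𝓘(ℝ, E) 𝓘(ℝ, ℝ) ∞ (fun x => _ + _)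
  refine ContMDiff.add ?_ ?_
  · refine contMDiff_finsetSum fun i _ => contMDiff_const.mul ?_
    exact A.smooth_derivative (ξ i) (η.2 (i.removeNth ξ))
  · cases k with
    | zero => exact contMDiff_const
    | succ n =>
      refine ContMDiff.neg (contMDiff_finsetSum fun i _ => contMDiff_finsetSum fun j _ =>
        contMDiff_const.mul ?_)
      convert η.2 (Matrix.vecCons (A.bracket (ξ i.castSucc) (ξ j.succ))
        (j.removeNth (i.castSucc.removeNth ξ))) using 2 with x
      congr 1
      funext l
      refine Fin.cases ?_ (fun l => ?_) l <;> rfl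

/-- The Koszul formula is linear over smooth functions in the first section. -/
theorem koszul_funSMul {k : ℕ} (η : SmoothForm E F V k) (f : M → ℝ)
    (hf : ContMDiff 𝓘(ℝ, E) 𝓘(ℝ, ℝ) ∞ f) (s : Cₛ^∞⟮𝓘(ℝ, E); F, V⟯)
    (ξ : Fin k → Cₛ^∞⟮𝓘(ℝ, E); F, V⟯) (x : M) :
    A.koszul η.1 (Fin.cons (funSMul f hf s) ξ) x = f x * A.koszul η.1 (Fin.cons s ξ) x := by
  cases k with
  | zero =>
    have h : A.anchor x (funSMul f hf s x) = f x • A.anchor x (s x) := map_smul _ _ _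
    have h0 (a : Cₛ^∞⟮𝓘(ℝ, E); F, V⟯) : A.koszul η.1 (Fin.cons a ξ) x =
        mvfderiv 𝓘(ℝ, E) (fun y => η.1 y (fun l => ξ l y)) x (A.anchor x (a x)) := by
      simp only [koszul, koszulBracket, add_zero]
      have : Subsingleton (Fin (0 + 1)) := inferInstanceAs (Subsingleton (Fin 1))
      rw [Fintype.sum_subsingleton _ (0 : Fin (0 + 1))]
      simp
    rw [h0, h0, h, map_smul, smul_eq_mul]
  | succ n =>
    have hfs (y : M) : funSMul f hf s y = f y • s y := rfl
    have e1 (w : Fin n → Cₛ^∞⟮𝓘(ℝ, E); F, V⟯) (y : M) :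
        η.1 y (fun l => (Fin.cons (funSMul f hf s) w : Fin (n + 1) → _) l y) =
          f y * η.1 y (fun l => (Fin.cons s w : Fin (n + 1) → _) l y) := by
      refine map_smul_entry _ _ _ 0 _ fun l => ?_
      refine Fin.cases ?_ (fun l => ?_) l
      · simp [hfs]
      · simp
    have hm (w : Fin n → Cₛ^∞⟮𝓘(ℝ, E); F, V⟯) : MDifferentiableAt 𝓘(ℝ, E) 𝓘(ℝ, ℝ)
        (fun y => η.1 y (fun l => (Fin.cons s w : Fin (n + 1) → _) l y)) x :=
      (η.2 _ x).mdifferentiableAt (by simp)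
    have T1 : ∀ i : Fin (n + 1), mvfderiv 𝓘(ℝ, E) (fun y => η.1 y (fun l =>
          i.succ.removeNth (Fin.cons (funSMul f hf s) ξ : Fin (n + 2) → _) l y)) x
            (A.anchor x (ξ i x)) =
        f x * mvfderiv 𝓘(ℝ, E) (fun y => η.1 y (fun l =>
          i.succ.removeNth (Fin.cons s ξ : Fin (n + 2) → _) l y)) x (A.anchor x (ξ i x)) +
        mvfderiv 𝓘(ℝ, E) f x (A.anchor x (ξ i x)) *
          η.1 x (fun l => (Fin.cons s (i.removeNth ξ) : Fin (n + 1) → _) l x) := by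
      intro i
      simp only [removeNth_succ_cons, e1]
      refine (DFunLike.congr_fun (mvfderiv_fun_mul ((hf x).mdifferentiableAt (by simp))
        (hm (i.removeNth ξ))) _).trans ?_
      simp
      ring
    have hbr (t : Cₛ^∞⟮𝓘(ℝ, E); F, V⟯) : A.bracket (funSMul f hf s) t x =
        f x • A.bracket s t x - mvfderiv 𝓘(ℝ, E) f x (A.anchor x (t x)) • s x := by
      have h1 : A.bracket (funSMul f hf s) t x = - A.bracket t (funSMul f hf s) x := by
        rw [A.bracket_swap]; rfl
      have h2 : A.bracket s t x = - A.bracket t s x := by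
        rw [A.bracket_swap]; rfl
      rw [h1, h2, A.leibniz]
      module
    have T2 : ∀ j : Fin (n + 1),
        η.1 x (Matrix.vecCons (A.bracket (funSMul f hf s) (ξ j) x)
          (fun l => j.removeNth ξ l x)) =
        f x * η.1 x (Matrix.vecCons (A.bracket s (ξ j) x) (fun l => j.removeNth ξ l x)) -
        mvfderiv 𝓘(ℝ, E) f x (A.anchor x (ξ j x)) *
          η.1 x (fun l => (Fin.cons s (j.removeNth ξ) : Fin (n + 1) → _) l x) := by
      intro j
      have h (v : V x) : η.1 x (Matrix.vecCons v (fun l => j.removeNth ξ l x)) =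
          AlternatingMap.curryLeft (η.1 x) v (fun l => j.removeNth ξ l x) := rfl
      rw [h, hbr, map_sub, map_smul, map_smul]
      simp only [AlternatingMap.sub_apply, AlternatingMap.smul_apply, smul_eq_mul]
      rw [← h, ← h]
      congr 3
      funext l
      refine Fin.cases ?_ (fun l => ?_) l <;> rfl
    have T3 : ∀ (b : V x) (i j : Fin (n + 1)), i ≠ 0 → i ≤ j →
        η.1 x (Matrix.vecCons b (fun l => j.removeNth (i.castSucc.removeNth
          (Fin.cons (funSMul f hf s) ξ : Fin (n + 2) → _)) l x)) =
        f x * η.1 x (Matrix.vecCons b (fun l => j.removeNth (i.castSucc.removeNth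
          (Fin.cons s ξ : Fin (n + 2) → _)) l x)) := by
      intro b i j hi hij
      cases n with
      | zero => exact absurd (Fin.fin_one_eq_zero i) hi
      | succ n =>
        obtain ⟨m, rfl⟩ := Fin.exists_succ_eq.2 hi
        obtain ⟨p, rfl⟩ := Fin.exists_succ_eq.2 (show j ≠ 0 by
          rintro rfl
          exact hi (Fin.le_zero_iff.1 hij))
        simp only [← Fin.succ_castSucc, removeNth_succ_cons]
        refine map_smul_entry _ _ _ (Fin.succ 0) _ fun l => ?_
        refine Fin.cases ?_ (fun l => Fin.cases ?_ (fun l => ?_) l) l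
        · simp
        · simp [hfs]
        · simp [Fin.succ_inj, -Fin.succ_zero_eq_one, -Fin.succ_zero_eq_one']
    have hA : A.anchor x (funSMul f hf s x) = f x • A.anchor x (s x) := map_smul _ _ _
    have S2 : A.koszulBracket η.1 (Fin.cons (funSMul f hf s) ξ) x =
        f x * A.koszulBracket η.1 (Fin.cons s ξ) x +
        ∑ j : Fin (n + 1), (-1 : ℝ) ^ (j : ℕ) * (mvfderiv 𝓘(ℝ, E) f x (A.anchor x (ξ j x)) *
          η.1 x (fun l => (Fin.cons s (j.removeNth ξ) : Fin (n + 1) → _) l x)) := by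
      simp only [koszulBracket]
      rw [Fin.sum_univ_succ, Fin.sum_univ_succ (n := n)]
      have hI : Finset.Ici (0 : Fin (n + 1)) = Finset.univ := by ext; simp
      simp only [hI, Fin.castSucc_zero, Fin.cons_zero, Fin.cons_succ, Fin.removeNth_zero,
        Fin.tail_cons, T2, Fin.val_zero, zero_add]
      have hrest : ∀ i : Fin n, ∑ j ≥ i.succ, (-1 : ℝ) ^ (i.succ + j : ℕ) *
          η.1 x (Matrix.vecCons (A.bracket
            ((Fin.cons (funSMul f hf s) ξ : Fin (n + 2) → _) i.succ.castSucc) (ξ j) x)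
            (fun l => j.removeNth (i.succ.castSucc.removeNth
              (Fin.cons (funSMul f hf s) ξ : Fin (n + 2) → _)) l x)) =
          f x * ∑ j ≥ i.succ, (-1 : ℝ) ^ (i.succ + j : ℕ) *
          η.1 x (Matrix.vecCons (A.bracket
            ((Fin.cons s ξ : Fin (n + 2) → _) i.succ.castSucc) (ξ j) x)
            (fun l => j.removeNth (i.succ.castSucc.removeNth
              (Fin.cons s ξ : Fin (n + 2) → _)) l x)) := by
        intro i
        rw [Finset.mul_sum]
        refine Finset.sum_congr rfl fun j hj => ?_
        rw [T3 _ _ _ (Fin.succ_ne_zero i) (Finset.mem_Ici.1 hj)]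
        simp only [← Fin.succ_castSucc, Fin.cons_succ]
        ring
      rw [Finset.sum_congr rfl fun i _ => hrest i, ← Finset.mul_sum]
      simp only [mul_sub, Finset.sum_sub_distrib, mul_left_comm _ (f x), ← Finset.mul_sum]
      ring
    simp only [koszul]
    rw [S2, Fin.sum_univ_succ, Fin.sum_univ_succ (n := n + 1)]
    simp only [Fin.cons_zero, Fin.cons_succ, hA, T1, map_smul, smul_eq_mul, Fin.val_zero, pow_zero,
      Fin.removeNth_zero, Fin.tail_cons, one_mul, mul_add, Finset.sum_add_distrib, Fin.val_succ,
      pow_succ, mul_one, neg_mul, mul_neg, Finset.sum_neg_distrib, mul_left_comm _ (f x),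
      ← Finset.mul_sum]
    ring

theorem koszul_add {k : ℕ} (η θ : SmoothForm E F V k)
    (ξ : Fin (k + 1) → Cₛ^∞⟮𝓘(ℝ, E); F, V⟯) (x : M) :
    A.koszul (η + θ).1 ξ x = A.koszul η.1 ξ x + A.koszul θ.1 ξ x := by
  have h1 (i : Fin (k + 1)) : mvfderiv 𝓘(ℝ, E) (fun y => (η + θ).1 y
      (fun l => i.removeNth ξ l y)) x (A.anchor x (ξ i x)) =
      mvfderiv 𝓘(ℝ, E) (fun y => η.1 y (fun l => i.removeNth ξ l y)) x (A.anchor x (ξ i x)) +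
      mvfderiv 𝓘(ℝ, E) (fun y => θ.1 y (fun l => i.removeNth ξ l y)) x (A.anchor x (ξ i x)) :=
    DFunLike.congr_fun (mvfderiv_fun_add ((η.2 (i.removeNth ξ) x).mdifferentiableAt (by simp))
      ((θ.2 (i.removeNth ξ) x).mdifferentiableAt (by simp))) _
  have h2 : A.koszulBracket (η + θ).1 ξ x =
      A.koszulBracket η.1 ξ x + A.koszulBracket θ.1 ξ x := by
    cases k with
    | zero => simp [koszulBracket]
    | succ n =>
      have h3 (u : Fin (n + 1) → V x) : (η + θ).1 x u = η.1 x u + θ.1 x u := rfl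
      simp only [koszulBracket, h3, mul_add, Finset.sum_add_distrib]
      ring
  simp only [koszul, h1, h2, mul_add, Finset.sum_add_distrib]
  ring

theorem koszul_smul {k : ℕ} (r : ℝ) (η : SmoothForm E F V k)
    (ξ : Fin (k + 1) → Cₛ^∞⟮𝓘(ℝ, E); F, V⟯) (x : M) :
    A.koszul (r • η).1 ξ x = r * A.koszul η.1 ξ x := by
  have h1 (i : Fin (k + 1)) : mvfderiv 𝓘(ℝ, E) (fun y => (r • η).1 y
      (fun l => i.removeNth ξ l y)) x (A.anchor x (ξ i x)) =
      r * mvfderiv 𝓘(ℝ, E) (fun y => η.1 y (fun l => i.removeNth ξ l y)) x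
        (A.anchor x (ξ i x)) := by
    refine (DFunLike.congr_fun (mvfderiv_fun_mul (mdifferentiableAt_const (c := r))
      ((η.2 (i.removeNth ξ) x).mdifferentiableAt (by simp))) _).trans ?_
    rw [mvfderiv_const]
    simp
  have h2 : A.koszulBracket (r • η).1 ξ x = r * A.koszulBracket η.1 ξ x := by
    cases k with
    | zero => simp [koszulBracket]
    | succ n =>
      have h3 (u : Fin (n + 1) → V x) : (r • η).1 x u = r * η.1 x u := rfl
      simp only [koszulBracket, h3, mul_left_comm _ r, ← Finset.mul_sum]
      ring
  simp only [koszul, h1, h2, mul_left_comm _ r, ← Finset.mul_sum]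
  ring

variable [FiniteDimensional ℝ E] [T2Space M] [FiniteDimensional ℝ F]

theorem koszul_eq_zero {k : ℕ} (η : SmoothForm E F V k)
    (ξ : Fin (k + 1) → Cₛ^∞⟮𝓘(ℝ, E); F, V⟯) (x : M) (i : Fin (k + 1)) (h : ξ i x = 0) :
    A.koszul η.1 ξ x = 0 := by
  have first (s : Cₛ^∞⟮𝓘(ℝ, E); F, V⟯) (hs : s x = 0)
      (ζ : Fin k → Cₛ^∞⟮𝓘(ℝ, E); F, V⟯) : A.koszul η.1 (Fin.cons s ζ) x = 0 := by
    obtain ⟨ψ, hψ, e, hψx, he⟩ := exists_cutoff_frame (E := E) (F := F) (V := V) x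
    obtain ⟨c, hc, hce, hc0⟩ := he s
    have hg : ContMDiff 𝓘(ℝ, E) 𝓘(ℝ, ℝ) ∞ (fun y => 1 - ψ y * ψ y) :=
      contMDiff_const.sub (hψ.mul hψ)
    have hs' : s = funSMul _ hg s + ∑ i, funSMul _ (hc i) (e i) := by
      ext y
      have : (∑ i, funSMul _ (hc i) (e i)) y = ∑ i, c i y • e i y :=
        map_sum (evalSection E F V y) _ _
      rw [ContMDiffSection.coe_add, Pi.add_apply, this, ← hce]
      change _ = (1 - ψ y * ψ y) • s y + _
      module
    let L : Cₛ^∞⟮𝓘(ℝ, E); F, V⟯ →ₗ[ℝ] ℝ :=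
      { toFun := fun a => AlternatingMap.curryLeft (A.koszulAlt η x) a ζ
        map_add' := fun a b => by rw [map_add]; rfl
        map_smul' := fun r a => by rw [map_smul]; rfl }
    have hK (a) : A.koszul η.1 (Fin.cons a ζ) x = L a := (A.koszulAlt_apply η _ x).symm
    rw [hs', hK, map_add, map_sum, ← hK, koszul_funSMul]
    simp only [← hK, koszul_funSMul, hc0 hs, hψx]
    simp
  by_cases hi : i = 0
  · subst hi
    rw [← Fin.cons_self_tail ξ]
    exact first _ h _
  · rw [← A.koszulAlt_apply, ← neg_eq_zero, ← AlternatingMap.map_swap _ ξ (Ne.symm hi),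
      A.koszulAlt_apply, ← Fin.cons_self_tail (ξ ∘ Equiv.swap 0 i)]
    exact first _ (by simpa using h) _

/-- The value of the Koszul formula at `x` depends only on the values of the sections at `x`. -/
theorem koszul_congr {k : ℕ} (η : SmoothForm E F V k)
    (ξ ξ' : Fin (k + 1) → Cₛ^∞⟮𝓘(ℝ, E); F, V⟯) (x : M) (h : ∀ i, ξ i x = ξ' i x) :
    A.koszul η.1 ξ x = A.koszul η.1 ξ' x := by
  classical
  suffices ∀ S : Finset (Fin (k + 1)),
      A.koszulAlt η x (S.piecewise ξ' ξ) = A.koszulAlt η x ξ by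
    have := this Finset.univ
    rwa [Finset.piecewise_univ, A.koszulAlt_apply, A.koszulAlt_apply, eq_comm] at this
  intro S
  induction S using Finset.induction_on with
  | empty => rw [Finset.piecewise_empty]
  | insert i S hi ih =>
    have h1 : ξ' i = S.piecewise ξ' ξ i + (ξ' i - ξ i) := by
      rw [Finset.piecewise_eq_of_notMem _ _ _ hi]
      abel
    rw [Finset.piecewise_insert, h1, AlternatingMap.map_update_add, Function.update_eq_self, ih,
      A.koszulAlt_apply (ξ := Function.update _ _ _), A.koszul_eq_zero η _ x i, add_zero]
    rw [Function.update_self]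
    change ξ' i x - ξ i x = 0
    rw [h i, sub_self]

/-- The differential `d_A η` at `x`, as an alternating form on the fibre `V x`: its value on
vectors is the value at `x` of the Koszul formula on smooth sections through these vectors. -/
def dFibre {k : ℕ} (η : SmoothForm E F V k) (x : M) : (V x) [⋀^Fin (k + 1)]→ₗ[ℝ] ℝ where
  toFun := fun v => A.koszul η.1 (fun i => extendSection E F V x (v i)) x
  map_update_add' := by
    intro _ v i a b
    have h := ((A.koszulAlt η x).compLinearMap (extendSection E F V x)).map_update_add v i a b
    rw [← A.koszulAlt_apply, ← A.koszulAlt_apply, ← A.koszulAlt_apply]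
    exact h
  map_update_smul' := by
    intro _ v i r a
    have h := ((A.koszulAlt η x).compLinearMap (extendSection E F V x)).map_update_smul v i r a
    rw [← A.koszulAlt_apply, ← A.koszulAlt_apply]
    exact h
  map_eq_zero_of_eq' := by
    intro v i j h hij
    rw [← A.koszulAlt_apply]
    exact ((A.koszulAlt η x).compLinearMap (extendSection E F V x)).map_eq_zero_of_eq v h hij

theorem dFibre_apply {k : ℕ} (η : SmoothForm E F V k)
    (ξ : Fin (k + 1) → Cₛ^∞⟮𝓘(ℝ, E); F, V⟯) (x : M) :
    A.dFibre η x (fun i => ξ i x) = A.koszul η.1 ξ x :=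
  A.koszul_congr η _ _ x fun i => extendSection_apply x (ξ i x)

/-- The Lie algebroid differential `d_A : Γ(Λᵏ V*) → Γ(Λᵏ⁺¹ V*)`. -/
def d (k : ℕ) : SmoothForm E F V k →ₗ[ℝ] SmoothForm E F V (k + 1) where
  toFun := fun η => ⟨A.dFibre η, fun s => by
    simpa only [A.dFibre_apply] using A.smooth_koszul η s⟩
  map_add' := fun η θ => by
    exact Subtype.ext (funext fun x => AlternatingMap.ext fun v => A.koszul_add η θ _ x)
  map_smul' := fun r η => by
    exact Subtype.ext (funext fun x => AlternatingMap.ext fun v => A.koszul_smul r η _ x)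

/-- The differential is given by the Koszul formula on all smooth sections. -/
theorem d_apply {k : ℕ} (η : SmoothForm E F V k)
    (ξ : Fin (k + 1) → Cₛ^∞⟮𝓘(ℝ, E); F, V⟯) (x : M) :
    (A.d k η).1 x (fun i => ξ i x) = A.koszul η.1 ξ x :=
  A.dFibre_apply η ξ x

end LieAlgebroid

/-! ### Horizontal forms and cohomology -/

namespace LieAlgebroid

/-- A family of alternating forms on the fibres is horizontal for the fibrewise linear maps `ρ` if
at every point its contraction with any vector of `ker ρ` vanishes. -/
def IsHorizontalFor {B : Type*} {W T : B → Type*} [∀ x, AddCommGroup (W x)]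
    [∀ x, Module ℝ (W x)] [∀ x, AddCommGroup (T x)] [∀ x, Module ℝ (T x)]
    (ρ : ∀ x, W x →ₗ[ℝ] T x) {k : ℕ} (η : ∀ x, (W x) [⋀^Fin k]→ₗ[ℝ] ℝ) : Prop :=
  ∀ (x : B) (a : Fin k → W x) (i : Fin k), ρ x (a i) = 0 → η x a = 0

variable {E : Type*} [NormedAddCommGroup E] [NormedSpace ℝ E] [FiniteDimensional ℝ E]
  {M : Type*} [TopologicalSpace M] [ChartedSpace E M] [IsManifold 𝓘(ℝ, E) ∞ M] [T2Space M]
  {F : Type*} [NormedAddCommGroup F] [NormedSpace ℝ F] [FiniteDimensional ℝ F]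
  {V : M → Type*} [TopologicalSpace (TotalSpace F V)]
  [∀ x, AddCommGroup (V x)] [∀ x, Module ℝ (V x)] [∀ x, TopologicalSpace (V x)]
  [FiberBundle F V] [VectorBundle ℝ F V] [ContMDiffVectorBundle ∞ F V 𝓘(ℝ, E)]
  (A : LieAlgebroid E F V)

/-- The sections of `(Λᵏ V*)^hor`: the `k`-forms that are `ρ`-horizontal at every point. -/
def horizontalForms (k : ℕ) : Submodule ℝ (SmoothForm E F V k) where
  carrier := {η | IsHorizontalFor A.anchor η.1}
  add_mem' := fun {η θ} hη hθ x a i h => by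
    change η.1 x a + θ.1 x a = 0
    rw [hη x a i h, hθ x a i h, add_zero]
  zero_mem' := fun _ _ _ _ => rfl
  smul_mem' := fun r η hη x a i h => by
    change r * η.1 x a = 0
    rw [hη x a i h, mul_zero]

/-- The horizontal complex `Γ(Λᵏ V*)^hor`: the `k`-forms `η` such that both `η` and `d_A η` are
`ρ`-horizontal at every point. -/
def horizontalComplex (k : ℕ) : Submodule ℝ (SmoothForm E F V k) :=
  A.horizontalForms k ⊓ (A.horizontalForms (k + 1)).comap (A.d k)

/-- The degree `k` cocycles of the subcomplex `C` of the complex of forms. -/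
def cocycles (C : ∀ k, Submodule ℝ (SmoothForm E F V k)) (k : ℕ) :
    Submodule ℝ (SmoothForm E F V k) :=
  C k ⊓ LinearMap.ker (A.d k)

/-- The degree `k` coboundaries of the subcomplex `C` of the complex of forms. -/
def coboundaries (C : ∀ k, Submodule ℝ (SmoothForm E F V k)) :
    ∀ k, Submodule ℝ (SmoothForm E F V k)
  | 0 => ⊥
  | k + 1 => (C k).map (A.d k)

/-- The cohomology of the subcomplex `C` in degree `k`: cocycles modulo coboundaries. -/
abbrev cohomology (C : ∀ k, Submodule ℝ (SmoothForm E F V k)) (k : ℕ) : Type _ :=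
  ↥(A.cocycles C k) ⧸ (A.coboundaries C k).submoduleOf (A.cocycles C k)

/-- The cohomology class of a cocycle. -/
def cohomologyClass (C : ∀ k, Submodule ℝ (SmoothForm E F V k)) (k : ℕ) :
    ↥(A.cocycles C k) →ₗ[ℝ] A.cohomology C k :=
  ((A.coboundaries C k).submoduleOf (A.cocycles C k)).mkQ

end LieAlgebroid

/-! ### The tangent Lie algebroid and the de Rham complex -/

section Tangent

variable (E : Type*) [NormedAddCommGroup E] [NormedSpace ℝ E] [FiniteDimensional ℝ E]
  (M : Type*) [TopologicalSpace M] [ChartedSpace E M] [IsManifold 𝓘(ℝ, E) ∞ M]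

theorem minSmoothness_le_infty (n : ℕ∞) : minSmoothness ℝ n ≤ ∞ := by
  rw [minSmoothness_of_isRCLikeNormedField]
  exact WithTop.coe_le_coe.2 le_top

instance isManifold_minSmoothness_two : IsManifold 𝓘(ℝ, E) (minSmoothness ℝ 2) M :=
  IsManifold.of_le (minSmoothness_le_infty 2)

instance isManifold_minSmoothness_three : IsManifold 𝓘(ℝ, E) (minSmoothness ℝ 3) M :=
  IsManifold.of_le (minSmoothness_le_infty 3)

/-- The tangent bundle with the identity as anchor and the usual bracket of vector fields. -/
def tangentLieAlgebroid :
    LieAlgebroid E E (fun x : M => TangentSpace 𝓘(ℝ, E) x) where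
  anchor := fun _ => LinearMap.id
  contMDiff_anchor := contMDiff_id
  bracket := LinearMap.mk₂ ℝ
    (fun X Y => ⟨VectorField.mlieBracket 𝓘(ℝ, E) X Y, by
      have : IsManifold 𝓘(ℝ, E) (((⊤ : ℕ∞) : WithTop ℕ∞) + 1) M :=
        inferInstanceAs (IsManifold 𝓘(ℝ, E) ∞ M)
      exact ContDiff.mlieBracket_vectorField (m := ⊤) (n := ⊤) X.contMDiff Y.contMDiff (by simp)⟩)
    (fun X X' Y => by
      ext x
      exact VectorField.mlieBracket_add_left X.mdifferentiableAt X'.mdifferentiableAt)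
    (fun c X Y => by
      ext x
      exact VectorField.mlieBracket_const_smul_left X.mdifferentiableAt)
    (fun X Y Y' => by
      ext x
      exact VectorField.mlieBracket_add_right Y.mdifferentiableAt Y'.mdifferentiableAt)
    (fun c X Y => by
      ext x
      exact VectorField.mlieBracket_const_smul_right Y.mdifferentiableAt)
  bracket_self := fun X => by
    ext x
    exact congrFun VectorField.mlieBracket_self x
  jacobi := fun X Y Z => by
    ext x
    exact VectorField.leibniz_identity_mlieBracket_apply
      ((X.contMDiff x).of_le (minSmoothness_le_infty 2))
      ((Y.contMDiff x).of_le (minSmoothness_le_infty 2))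
      ((Z.contMDiff x).of_le (minSmoothness_le_infty 2))
  leibniz := fun f hf X Y x => by
    refine (VectorField.mlieBracket_smul_right ((hf x).mdifferentiableAt (by simp))
      Y.mdifferentiableAt).trans ?_
    rw [add_comm]
    rfl

/-- The space `Ωᵏ(M)` of smooth differential forms. -/
abbrev DiffForm (k : ℕ) : Type _ :=
  SmoothForm E E (fun x : M => TangentSpace 𝓘(ℝ, E) x) k

variable [T2Space M]

/-- The de Rham differential. -/
abbrev deRhamD (k : ℕ) : DiffForm E M k →ₗ[ℝ] DiffForm E M (k + 1) :=
  (tangentLieAlgebroid E M).d k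

/-- The closed differential forms. -/
abbrev closedForms (k : ℕ) :
    Submodule ℝ (SmoothForm E E (fun x : M => TangentSpace 𝓘(ℝ, E) x) k) :=
  (tangentLieAlgebroid E M).cocycles (fun _ => ⊤) k

/-- De Rham cohomology. -/
abbrev deRhamCohomology (k : ℕ) : Type _ :=
  (tangentLieAlgebroid E M).cohomology (fun _ => ⊤) k

/-- The de Rham cohomology class of a closed form. -/
abbrev deRhamClass (k : ℕ) : ↥(closedForms E M k) →ₗ[ℝ] deRhamCohomology E M k :=
  (tangentLieAlgebroid E M).cohomologyClass (fun _ => ⊤) k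

end Tangent

/-! ### Leaves -/

section Leaves

instance instAddCommGroupPullback {B B' : Type*} (f : B' → B) (V : B → Type*) [∀ x, AddCommGroup (V x)] (x : B') :
    AddCommGroup ((f *ᵖ V) x) :=
  inferInstanceAs (AddCommGroup (V (f x)))

variable {E : Type*} [NormedAddCommGroup E] [NormedSpace ℝ E] 
  {M : Type u} [TopologicalSpace M] [ChartedSpace E M] [IsManifold 𝓘(ℝ, E) ∞ M]
  {F : Type*} [NormedAddCommGroup F] [NormedSpace ℝ F]
  {V : M → Type*} [TopologicalSpace (TotalSpace F V)]
  [∀ x, AddCommGroup (V x)] [∀ x, Module ℝ (V x)] [∀ x, TopologicalSpace (V x)]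
  [FiberBundle F V] [VectorBundle ℝ F V] [ContMDiffVectorBundle ∞ F V 𝓘(ℝ, E)]

/-- A connected integral manifold of `A`: a connected smooth manifold `L` with an injective
immersion `ι : L → M` such that `dι(T_x L) = ρ(A_{ι x})` for all `x`. (As `ι` is injective, `L` is
Hausdorff; if `M` is second countable, then so is `L`, since it is connected and carries the
pullback of a Riemannian metric.) -/
structure IntegralManifold (A : LieAlgebroid E F V) where
  carrier : Type u
  dim : ℕ
  [topologicalSpace : TopologicalSpace carrier]
  [chartedSpace : ChartedSpace (EuclideanSpace ℝ (Fin dim)) carrier]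
  [isManifold : IsManifold 𝓘(ℝ, EuclideanSpace ℝ (Fin dim)) ∞ carrier]
  [connectedSpace : ConnectedSpace carrier]
  ι : C^∞⟮𝓘(ℝ, EuclideanSpace ℝ (Fin dim)), carrier; 𝓘(ℝ, E), M⟯
  injective : Function.Injective ι
  immersion : ∀ x, Function.Injective
    (mfderiv 𝓘(ℝ, EuclideanSpace ℝ (Fin dim)) 𝓘(ℝ, E) ι x)
  range_mfderiv : ∀ x, LinearMap.range
    (mfderiv 𝓘(ℝ, EuclideanSpace ℝ (Fin dim)) 𝓘(ℝ, E) ι x).toLinearMap =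
      LinearMap.range (A.anchor (ι x))

/-- A leaf of `A`: a maximal connected integral manifold, i.e. one that contains every connected
integral manifold which meets it. -/
structure Leaf (A : LieAlgebroid E F V) extends IntegralManifold A where
  maximal : ∀ N : IntegralManifold A, (Set.range N.ι ∩ Set.range ι).Nonempty →
    Set.range N.ι ⊆ Set.range ι

namespace IntegralManifold

attribute [instance] topologicalSpace chartedSpace isManifold connectedSpace

variable {A : LieAlgebroid E F V} (L : IntegralManifold A)

instance instT2Space [T2Space M] : T2Space L.carrier :=
  T2Space.of_injective_continuous L.injective L.ι.contMDiff.continuous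

/-- The model space of an integral manifold. -/
abbrev Model : Type := EuclideanSpace ℝ (Fin L.dim)

/-- The anchor of the restriction `A|_L → L` of `A` to `L`: the map `A_{ι x} → T_x L` whose
composition with `dι` is the anchor of `A`. -/
def anchor (x : L.carrier) : V (L.ι x) →ₗ[ℝ] TangentSpace 𝓘(ℝ, L.Model) x :=
  (LinearEquiv.ofInjective (mfderiv 𝓘(ℝ, L.Model) 𝓘(ℝ, E) L.ι x).toLinearMap
    (L.immersion x)).symm.toLinearMap ∘ₗ
    (A.anchor (L.ι x)).codRestrict _
      (fun a => by rw [L.range_mfderiv]; exact LinearMap.mem_range_self _ a)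

theorem mfderiv_anchor (x : L.carrier) (a : V (L.ι x)) :
    mfderiv 𝓘(ℝ, L.Model) 𝓘(ℝ, E) L.ι x (L.anchor x a) = A.anchor (L.ι x) a :=
  congrArg Subtype.val ((LinearEquiv.ofInjective
    (mfderiv 𝓘(ℝ, L.Model) 𝓘(ℝ, E) L.ι x).toLinearMap (L.immersion x)).apply_symm_apply _)

/-- The restriction `η|_L` of a form `η`, a family of forms on the fibres of the pullback bundle
`A|_L = ι^* A`. -/
def restrict {k : ℕ} (η : SmoothForm E F V k) (x : L.carrier) :
    ((L.ι : L.carrier → M) *ᵖ V) x [⋀^Fin k]→ₗ[ℝ] ℝ :=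
  η.1 (L.ι x)

/-- The differential form `β` on `L` is the form `η_L` induced by `η`: its pullback along the anchor
`A|_L → TL` is `η|_L`. -/
def IsInduced {k : ℕ} (η : SmoothForm E F V k) (β : DiffForm L.Model L.carrier k) : Prop :=
  ∀ (x : L.carrier) (a : Fin k → V (L.ι x)),
    β.1 x (fun i => L.anchor x (a i)) = L.restrict η x a

end IntegralManifold

end Leaves

end

/-! The restricted anchor `L.anchor` maps `A_{ι x}` onto `T_x L`, and since `dι` is injective its
kernel is that of `ρ`. A horizontal form is therefore constant on the fibres of `L.anchor` and
descends to exactly one alternating form on each `T_x L`. Every section `s` of `A` induces a smooth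
vector field `L.anchorSection s` on `L`, and such fields form local frames of `TL`; the descended
form evaluated on them is the smooth function `η(s₁, …, s_k) ∘ ι`, so it is smooth
(`exists_isInduced`).

The Jacobi identity and the Leibniz rule make the anchor a bracket homomorphism (`anchor_bracket`),
hence so is `s ↦ L.anchorSection s` (`anchorSection_bracket`). The Koszul formulas for `d_A η` and
`d η_L` then agree term by term (`IsInduced.koszul_eq`, `IsInduced.d`). If `η = d_A ζ` with `ζ` in
the horizontal complex, then `ζ` induces a form on `L` whose differential is `η_L`.

The harder point is that the leaves see enough of `M`. By continuity it is enough that their union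
is dense, so the singular foliation theorem through every point is not needed. In an open set the
rank of `ρ` attains a maximum `r` at some `p`. Near `p` the image of the anchor is spanned by `r`
fields wherever its rank is `r`, and it is involutive, so Frobenius gives an integral manifold
through `p` (`exists_plaque`). Here Frobenius is the solvability of a total differential equation
`Df = Λ ∘ f` (`exists_hasFDerivAt_of_symmetric`), where `Λ` is a frame normalised so that its
brackets vanish (`exists_normalForm`).

To extend such a plaque to a maximal leaf, all points lying on `r`-dimensional plaques are collected
in `PlaqueSpace A r`, with the plaques as charts. Two plaques through a common point differ by a
smooth reparametrisation, because in normal form both solve the same equation (`exists_transition`);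
so these charts form a smooth atlas. The connected components are leaves: a connected integral
manifold lifts continuously to the plaque space and hence stays in one component. -/

noncomputable section

/-! ### Total differential equations `Df = Λ ∘ f`: uniqueness, regularity, existence -/

section TotalDifferentialEquations

open Metric Set
open scoped NNReal

variable {E : Type*} [NormedAddCommGroup E] [NormedSpace ℝ E]
  {G : Type*} [NormedAddCommGroup G] [NormedSpace ℝ G]

theorem ContinuousAt.eventually_norm_lt_add_one {X H : Type*} [TopologicalSpace X]
    [NormedAddCommGroup H] {f : X → H} {x : X} (hf : ContinuousAt f x) :
    ∀ᶠ y in 𝓝 x, ‖f y‖ < ‖f x‖ + 1 :=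
  hf.norm.eventually_lt continuousAt_const (by simp)

/-- The Picard–Lindelöf theorem, with the information that the solution stays in the ball. -/
theorem IsPicardLindelof.exists_solution_mem_closedBall [CompleteSpace E]
    {f : ℝ → E → E} {tmin tmax : ℝ} {t₀ : Icc tmin tmax} {x₀ x : E} {a r L K : ℝ≥0}
    (hf : IsPicardLindelof f t₀ x₀ a r L K) (hx : x ∈ closedBall x₀ r) :
    ∃ α : ℝ → E, α t₀ = x ∧ ∀ t ∈ Icc tmin tmax, α t ∈ closedBall x₀ a ∧
      HasDerivWithinAt α (f t (α t)) (Icc tmin tmax) t := by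
  obtain ⟨α, hα⟩ := ODE.FunSpace.exists_isFixedPt_next hf hx
  refine ⟨α.compProj, by rw [ODE.FunSpace.compProj_val, ← hα, ODE.FunSpace.next_apply₀],
    fun t ht => ⟨α.compProj_mem_closedBall hf.mul_max_le, ?_⟩⟩
  apply ODE.hasDerivWithinAt_picard_Icc t₀.2 hf.continuousOn_uncurry
    α.continuous_compProj.continuousOn (fun _ ht' ↦ α.compProj_mem_closedBall hf.mul_max_le)
    x ht |>.congr_of_mem _ ht
  intro t' ht'
  nth_rw 1 [← hα]
  rw [ODE.FunSpace.compProj_of_mem ht', ODE.FunSpace.next_apply]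

/-- Solutions of a total differential equation `Df = Λ ∘ f` are determined by one value. -/
theorem eventuallyEq_of_hasFDerivAt_comp {Λ : E → G →L[ℝ] E} {f g : G → E} {y₀ : G}
    (hΛ : ContDiffAt ℝ 1 Λ (f y₀)) (hf : ∀ᶠ y in 𝓝 y₀, HasFDerivAt f (Λ (f y)) y)
    (hg : ∀ᶠ y in 𝓝 y₀, HasFDerivAt g (Λ (g y)) y) (h : f y₀ = g y₀) : f =ᶠ[𝓝 y₀] g := by
  obtain ⟨K, s, hs, hK⟩ := hΛ.exists_lipschitzOnWith
  have hfs : ∀ᶠ y in 𝓝 y₀, f y ∈ s := hf.self_of_nhds.continuousAt.eventually_mem hs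
  have hgs : ∀ᶠ y in 𝓝 y₀, g y ∈ s := hg.self_of_nhds.continuousAt.eventually_mem (h ▸ hs)
  obtain ⟨ε, hε, hball⟩ := eventually_nhds_iff_ball.1 (hf.and (hg.and (hfs.and hgs)))
  refine eventually_nhds_iff_ball.2 ⟨ε, hε, fun y hy => ?_⟩
  -- Along the segment from `y₀` to `y` both maps solve the ODE `q' = Λ q (y - y₀)` with the same
  -- initial value.
  let c : ℝ → G := fun t => y₀ + t • (y - y₀)
  have hc : ∀ t ∈ Icc (0 : ℝ) 1, c t ∈ ball y₀ ε := by
    intro t ht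
    rw [mem_ball, dist_eq_norm] at hy ⊢
    simp only [c, add_sub_cancel_left, norm_smul, Real.norm_eq_abs, abs_of_nonneg ht.1]
    nlinarith [norm_nonneg (y - y₀), ht.2]
  have hcd : ∀ t, HasDerivAt c (y - y₀) t := fun t => by
    have := ((hasDerivAt_id t).smul_const (y - y₀)).const_add y₀
    rwa [one_smul] at this
  have hfc : ∀ t ∈ Icc (0 : ℝ) 1, HasDerivAt (f ∘ c) (Λ (f (c t)) (y - y₀)) t := fun t ht =>
    (hball _ (hc t ht)).1.comp_hasDerivAt t (hcd t)
  have hgc : ∀ t ∈ Icc (0 : ℝ) 1, HasDerivAt (g ∘ c) (Λ (g (c t)) (y - y₀)) t := fun t ht =>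
    (hball _ (hc t ht)).2.1.comp_hasDerivAt t (hcd t)
  have key := ODE_solution_unique_of_mem_Icc_right (v := fun _ q => Λ q (y - y₀))
    (s := fun _ => s) (K := K * ‖y - y₀‖₊) (f := f ∘ c) (g := g ∘ c) (a := 0) (b := 1)
    (fun t _ => LipschitzOnWith.of_dist_le_mul fun q hq q' hq' => by
      rw [dist_eq_norm, ← sub_apply]
      refine (ContinuousLinearMap.le_opNorm _ _).trans ?_
      have := hK.dist_le_mul q hq q' hq'
      rw [dist_eq_norm] at this
      push_cast
      nlinarith [norm_nonneg (y - y₀)])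
    (fun t ht => (hfc t ht).continuousAt.continuousWithinAt)
    (fun t ht => (hfc t (Ico_subset_Icc_self ht)).hasDerivWithinAt)
    (fun t ht => (hball _ (hc t (Ico_subset_Icc_self ht))).2.2.1)
    (fun t ht => (hgc t ht).continuousAt.continuousWithinAt)
    (fun t ht => (hgc t (Ico_subset_Icc_self ht)).hasDerivWithinAt)
    (fun t ht => (hball _ (hc t (Ico_subset_Icc_self ht))).2.2.2)
    (by simpa [c] using h) (right_mem_Icc.2 zero_le_one)
  simpa [c] using key

/-- Solutions of a total differential equation with smooth right-hand side are smooth. -/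
theorem contDiffOn_of_hasFDerivAt_comp {Λ : E → G →L[ℝ] E} {f : G → E} {s : Set G}
    (hs : IsOpen s) (hΛ : ∀ y ∈ s, ContDiffAt ℝ ∞ Λ (f y))
    (hf : ∀ y ∈ s, HasFDerivAt f (Λ (f y)) y) : ContDiffOn ℝ ∞ f s := by
  refine contDiffOn_infty.2 fun n => ?_
  -- Bootstrapping: if `f` is `Cⁿ`, then so is its derivative `Λ ∘ f`, and `f` is `Cⁿ⁺¹`.
  induction n with
  | zero => exact contDiffOn_zero.2 fun y hy => (hf y hy).continuousAt.continuousWithinAt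
  | succ n ih =>
    refine (contDiffOn_succ_iff_fderiv_of_isOpen hs).2
      ⟨fun y hy => (hf y hy).differentiableAt.differentiableWithinAt, 
      fun h => (WithTop.natCast_ne_top n h).elim, ?_⟩
    have : ContDiffOn ℝ n (fun y => Λ (f y)) s := fun y hy =>
      ((hΛ y hy).of_le (by exact_mod_cast le_top)).comp_contDiffWithinAt y (ih y hy)
    exact this.congr fun y hy => (hf y hy).fderiv

/-- A first-order Taylor estimate for a map whose derivative is Lipschitz. -/
theorem norm_sub_sub_fderiv_le {H : Type*} [NormedAddCommGroup H] [NormedSpace ℝ H]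
    {Λ : E → H} {s : Set E} (hs : Convex ℝ s) {K : ℝ≥0}
    (hd : ∀ q ∈ s, DifferentiableAt ℝ Λ q) (hK : LipschitzOnWith K (fderiv ℝ Λ) s)
    {q v : E} (hq : q ∈ s) (hv : v ∈ s) :
    ‖Λ v - Λ q - fderiv ℝ Λ q (v - q)‖ ≤ K * ‖v - q‖ * ‖v - q‖ := by
  have hseg : segment ℝ q v ⊆ s := hs.segment_subset hq hv
  -- The mean value inequality is applied on the segment only: there `fderiv ℝ Λ` differs from its
  -- value at `q` by at most `K * ‖v - q‖`.
  refine (convex_segment q v).norm_image_sub_le_of_norm_hasFDerivWithin_le'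
    (f' := fderiv ℝ Λ) (fun z hz => (hd z (hseg hz)).hasFDerivAt.hasFDerivWithinAt)
    (fun z hz => ?_) (left_mem_segment _ _ _) (right_mem_segment _ _ _)
  rw [← dist_eq_norm]
  refine (hK.dist_le_mul z (hseg hz) q hq).trans ?_
  gcongr
  rw [dist_eq_norm]
  obtain ⟨t, ht, rfl⟩ := (segment_eq_image' ℝ q v) ▸ hz
  simp only [add_sub_cancel_left, norm_smul, Real.norm_eq_abs, abs_of_nonneg ht.1]
  nlinarith [norm_nonneg (v - q), ht.2]

set_option synthInstance.maxHeartbeats 200000 in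
/-- The Frobenius theorem for total differential equations: `Df = Λ ∘ f` is solvable if
`DΛ(q)(Λ(q) w) h` is symmetric in `w` and `h`. -/
theorem exists_hasFDerivAt_of_symmetric [CompleteSpace E] {Λ : E → G →L[ℝ] E} {q₀ : E}
    (hΛ : ∀ᶠ q in 𝓝 q₀, ContDiffAt ℝ ∞ Λ q)
    (hsymm : ∀ᶠ q in 𝓝 q₀, ∀ w h, fderiv ℝ Λ q (Λ q w) h = fderiv ℝ Λ q (Λ q h) w)
    {U : Set E} (hU : U ∈ 𝓝 q₀) :
    ∃ (f : G → E) (δ : ℝ), 0 < δ ∧ f 0 = q₀ ∧ ContDiffOn ℝ ∞ f (ball 0 δ) ∧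
      ∀ w ∈ ball (0 : G) δ, f w ∈ U ∧ HasFDerivAt f (Λ (f w)) w := by
  obtain ⟨K, s, hs, hK⟩ := (hΛ.self_of_nhds.of_le (m := 1) (by simp)).exists_lipschitzOnWith
  have hbd : ∀ᶠ q in 𝓝 q₀, ‖Λ q‖ < ‖Λ q₀‖ + 1 :=
    hΛ.self_of_nhds.continuousAt.eventually_norm_lt_add_one
  have hΛ' : ContDiffAt ℝ 1 (fderiv ℝ Λ) q₀ :=
    hΛ.self_of_nhds.fderiv_right (m := 1) (WithTop.coe_le_coe.2 le_top)
  obtain ⟨K', s', hs', hK'⟩ := hΛ'.exists_lipschitzOnWith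
  have hbd' : ∀ᶠ q in 𝓝 q₀, ‖fderiv ℝ Λ q‖ < ‖fderiv ℝ Λ q₀‖ + 1 :=
    hΛ'.continuousAt.eventually_norm_lt_add_one
  obtain ⟨R, hR, hball⟩ := nhds_basis_closedBall.eventually_iff.1
    (hΛ.and (hsymm.and (hbd.and (Filter.Eventually.and hs (Filter.Eventually.and hs'
      (Filter.Eventually.and hU hbd'))))))
  set C : ℝ≥0 := ⟨‖Λ q₀‖ + 1, by positivity⟩ with hC
  have hC0 : (0 : ℝ) < C := by change 0 < ‖Λ q₀‖ + 1; positivity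
  have hΛC : ∀ q ∈ closedBall q₀ R, ‖Λ q‖ ≤ C := fun q hq => (hball hq).2.2.1.le
  -- Solutions are confined to half the radius, so that they may still be displaced by `t • Λ (α w
  -- t) h`, of norm at most `R / 2`, inside the ball where all estimates hold.
  let a : ℝ≥0 := ⟨R / 2, by positivity⟩
  have ha : (a : ℝ) = R / 2 := rfl
  have haR : closedBall q₀ a ⊆ closedBall q₀ R := closedBall_subset_closedBall (by linarith)
  have hLip : ∀ w : G, LipschitzOnWith (K * ‖w‖₊) (fun q => Λ q w) (closedBall q₀ R) := fun w =>
    LipschitzOnWith.of_dist_le_mul fun q hq q' hq' => by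
      rw [dist_eq_norm, ← sub_apply]
      refine (ContinuousLinearMap.le_opNorm _ _).trans ?_
      have := hK.dist_le_mul q (hball hq).2.2.2.1 q' (hball hq').2.2.2.1
      rw [dist_eq_norm] at this
      push_cast
      nlinarith [norm_nonneg w]
  -- The equation is solved along the rays `t ↦ t • w`, and `f w` will be the value at time `1`. The
  -- speed is at most `C * ‖w‖ < R / 2`, so the solution exists up to that time.
  have hex : ∀ w ∈ ball (0 : G) (R / (2 * C)), ∃ α : ℝ → E, α 0 = q₀ ∧ ∀ t ∈ Icc (0 : ℝ) 1,
      α t ∈ closedBall q₀ a ∧ HasDerivWithinAt α (Λ (α t) w) (Icc 0 1) t := by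
    intro w hw
    rw [mem_ball_zero_iff, lt_div_iff₀ (by positivity)] at hw
    have hPL : IsPicardLindelof (fun _ q => Λ q w) (⟨0, left_mem_Icc.2 zero_le_one⟩ : Icc (0 : ℝ) 1)
        q₀ a 0 (C * ‖w‖₊) (K * ‖w‖₊) :=
      { lipschitzOnWith := fun _ _ => (hLip w).mono haR
        continuousOn := fun _ _ => continuousOn_const
        norm_le := fun _ _ q hq => by
          push_cast
          exact (Λ q).le_of_opNorm_le (hΛC q (haR hq)) w
        mul_max_le := by
          push_cast
          rw [ha]
          norm_num
          linarith }
    exact hPL.exists_solution_mem_closedBall (by simp)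
  choose! α hα0 hα using hex
  have hRC : 0 < R / (2 * C) := by positivity
  -- If `f` exists, then `α (w + h) t = f (t • w + t • h)` is close to `α w t + t • Λ (α w t) h`.
  -- Symmetry makes this curve solve the equation of `α (w + h)` up to `O(‖h‖²)`; Grönwall at `t =
  -- 1` then gives the derivative.
  have hderiv : ∀ w ∈ ball (0 : G) (R / (2 * C)), HasFDerivAt (fun w => α w 1) (Λ (α w 1)) w := by
    intro w hw
    have hev : ∀ᶠ h in 𝓝 (0 : G), w + h ∈ ball (0 : G) (R / (2 * C)) ∧ ‖h‖ < R / (2 * C) ∧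
        ‖h‖ < 1 := by
      refine Filter.Eventually.and ?_ (Filter.Eventually.and ?_ ?_)
      · exact (continuous_const.add continuous_id).continuousAt.eventually_mem
          (by simpa using isOpen_ball.mem_nhds hw)
      · exact continuous_norm.continuousAt.eventually_lt continuousAt_const (by simpa using hRC)
      · exact continuous_norm.continuousAt.eventually_lt continuousAt_const (by simp)
    rw [hasFDerivAt_iff_isLittleO_nhds_zero]
    set D : ℝ := ‖fderiv ℝ Λ q₀‖ + 1 with hD
    set K₁ : ℝ≥0 := K * (‖w‖₊ + 1) with hK1
    -- With equal initial values the Grönwall bound is linear in the defect `ε`; the formula for it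
    -- distinguishes `K₁ = 0`.
    obtain ⟨B, hB⟩ : ∃ B : ℝ, ∀ ε, gronwallBound 0 K₁ ε 1 = B * ε := by
      by_cases h0 : (K₁ : ℝ) = 0
      · exact ⟨1, fun ε => by rw [h0, gronwallBound_K0]; ring⟩
      · exact ⟨(K₁ : ℝ)⁻¹ * (Real.exp K₁ - 1), fun ε => by
          rw [gronwallBound_of_K_ne_0 h0]; simp; ring⟩
    -- The first summand bounds the term quadratic in `h`, the second the Taylor remainder of `Λ`
    -- applied to `w + h`, where `‖h‖ < 1`.
    set C₂ : ℝ := D * C + K' * C * C * (‖w‖ + 1) with hC2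
    refine (Asymptotics.IsBigO.of_bound (B * C₂) (g := fun h : G => ‖h‖ ^ 2) ?_).trans_isLittleO
      (Asymptotics.isLittleO_norm_pow_id one_lt_two)
    filter_upwards [hev] with h ⟨hwh, hhR, hh1⟩
    have hmem : ∀ t ∈ Icc (0 : ℝ) 1, α w t + t • Λ (α w t) h ∈ closedBall q₀ R ∧
        ‖t • Λ (α w t) h‖ ≤ C * ‖h‖ := by
      intro t ht
      have h1 : ‖t • Λ (α w t) h‖ ≤ C * ‖h‖ := by
        rw [norm_smul, Real.norm_eq_abs, abs_of_nonneg ht.1]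
        have := (Λ (α w t)).le_of_opNorm_le (hΛC _ (haR (hα w hw t ht).1)) h
        nlinarith [norm_nonneg (Λ (α w t) h), ht.2]
      refine ⟨?_, h1⟩
      have h2 := mem_closedBall_iff_norm.1 (hα w hw t ht).1
      rw [mem_closedBall_iff_norm, add_sub_right_comm]
      refine (norm_add_le _ _).trans ?_
      rw [lt_div_iff₀ (by positivity)] at hhR
      linarith
    have hv : ∀ t ∈ Icc (0 : ℝ) 1, HasDerivWithinAt (fun t => α w t + t • Λ (α w t) h)
        (Λ (α w t) w + (t • fderiv ℝ Λ (α w t) (Λ (α w t) w) h + Λ (α w t) h)) (Icc 0 1) t := by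
      intro t ht
      have h1 : HasFDerivAt Λ (fderiv ℝ Λ (α w t)) (α w t) :=
        ((hball (haR (hα w hw t ht).1)).1.differentiableAt (by simp)).hasFDerivAt
      have h2 := (h1.comp_hasDerivWithinAt t (hα w hw t ht).2).clm_apply
        (hasDerivWithinAt_const t _ h)
      rw [map_zero, add_zero] at h2
      have h3 := (hasDerivWithinAt_id t (Icc 0 1)).smul h2
      rw [one_smul] at h3
      exact (hα w hw t ht).2.add h3
    have hest : ∀ t ∈ Ico (0 : ℝ) 1,
        dist (Λ (α w t) w + (t • fderiv ℝ Λ (α w t) (Λ (α w t) w) h + Λ (α w t) h))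
          (Λ (α w t + t • Λ (α w t) h) (w + h)) ≤ C₂ * ‖h‖ ^ 2 := by
      intro t ht
      have ht' := Ico_subset_Icc_self ht
      have hq := haR (hα w hw t ht').1
      have hT := norm_sub_sub_fderiv_le (convex_closedBall q₀ R)
        (fun q hq => (hball hq).1.differentiableAt (by simp))
        (hK'.mono fun q hq => (hball hq).2.2.2.2.1) hq (hmem t ht').1
      rw [add_sub_cancel_left] at hT
      have hm := (hmem t ht').2
      have hT2 : ‖Λ (α w t + t • Λ (α w t) h) - Λ (α w t) -
          fderiv ℝ Λ (α w t) (t • Λ (α w t) h)‖ ≤ K' * (C * ‖h‖) * (C * ‖h‖) :=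
        hT.trans (by gcongr)
      -- The symmetry hypothesis cancels the only terms of first order in `h`; a Taylor remainder
      -- and a quadratic term are left.
      have e1 : Λ (α w t) w + (t • fderiv ℝ Λ (α w t) (Λ (α w t) w) h + Λ (α w t) h) -
          Λ (α w t + t • Λ (α w t) h) (w + h) =
          -((Λ (α w t + t • Λ (α w t) h) - Λ (α w t) -
          fderiv ℝ Λ (α w t) (t • Λ (α w t) h)) (w + h)) -
          fderiv ℝ Λ (α w t) (t • Λ (α w t) h) h := by
        rw [(hball hq).2.1 w h]
        simp only [sub_apply, map_add, map_smul, smul_apply]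
        module
      rw [dist_eq_norm, e1]
      have hwh1 : ‖w + h‖ ≤ ‖w‖ + 1 := (norm_add_le _ _).trans (by linarith)
      have b1 : ‖(Λ (α w t + t • Λ (α w t) h) - Λ (α w t) -
          fderiv ℝ Λ (α w t) (t • Λ (α w t) h)) (w + h)‖ ≤
          K' * (C * ‖h‖) * (C * ‖h‖) * (‖w‖ + 1) :=
        (ContinuousLinearMap.le_of_opNorm_le _ hT2 _).trans (by gcongr)
      have b2 : ‖fderiv ℝ Λ (α w t) (t • Λ (α w t) h) h‖ ≤ D * (C * ‖h‖) * ‖h‖ := by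
        refine ContinuousLinearMap.le_of_opNorm_le _ ?_ _
        refine (ContinuousLinearMap.le_of_opNorm_le _ (hball hq).2.2.2.2.2.2.le _).trans ?_
        gcongr
      refine (norm_sub_le _ _).trans ?_
      rw [norm_neg]
      refine (add_le_add b1 b2).trans (le_of_eq ?_)
      rw [hC2]
      ring
    have hmono : ∀ {f : ℝ → E} {f' : E} {t : ℝ}, t ∈ Ico (0 : ℝ) 1 →
        HasDerivWithinAt f f' (Icc 0 1) t → HasDerivWithinAt f f' (Ici t) t := fun ht hf =>
      hf.mono_of_mem_nhdsWithin (Icc_mem_nhdsGE_of_mem ht)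
    have hK1' : LipschitzOnWith K₁ (fun q => Λ q (w + h)) (closedBall q₀ R) :=
      (hLip (w + h)).weaken (by
        rw [hK1]
        gcongr
        refine (nnnorm_add_le _ _).trans ?_
        gcongr
        exact_mod_cast hh1.le)
    have key := dist_le_of_approx_trajectories_ODE_of_mem (a := 0) (b := 1)
      (v := fun _ q => Λ q (w + h)) (s := fun _ => closedBall q₀ R) (K := K₁)
      (f := fun t => α w t + t • Λ (α w t) h) (g := α (w + h)) (εg := 0) (δ := 0)
      (fun _ _ => hK1') (fun t ht => (hv t ht).continuousWithinAt)
      (fun t ht => hmono ht (hv t (Ico_subset_Icc_self ht))) hest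
      (fun t ht => (hmem t (Ico_subset_Icc_self ht)).1)
      (fun t ht => (hα _ hwh t ht).2.continuousWithinAt)
      (fun t ht => hmono ht (hα _ hwh t (Ico_subset_Icc_self ht)).2) (fun t _ => by simp)
      (fun t ht => haR (hα _ hwh t (Ico_subset_Icc_self ht)).1)
      (by simp [hα0 w hw, hα0 _ hwh]) 1 (right_mem_Icc.2 zero_le_one)
    rw [sub_zero, hB, add_zero, one_smul, dist_comm, dist_eq_norm] at key
    rw [← sub_sub] at key
    simpa [mul_assoc] using key
  have hU1 : ∀ w ∈ ball (0 : G) (R / (2 * C)), α w 1 ∈ closedBall q₀ R := fun w hw =>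
    haR (hα w hw 1 (right_mem_Icc.2 zero_le_one)).1
  refine ⟨fun w => α w 1, R / (2 * C), hRC, ?_, contDiffOn_of_hasFDerivAt_comp isOpen_ball
    (fun w hw => (hball (hU1 w hw)).1) hderiv,
    fun w hw => ⟨(hball (hU1 w hw)).2.2.2.2.2.1, hderiv w hw⟩⟩
  have h0 := mem_ball_self (x := (0 : G)) hRC
  rw [← hα0 0 h0]
  -- For `w = 0` the right-hand side of the ray equation vanishes, so the solution stays at `q₀`.
  refine constant_of_has_deriv_right_zero (fun t ht => (hα 0 h0 t ht).2.continuousWithinAt)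
    (fun t ht => ?_) 1 (right_mem_Icc.2 zero_le_one)
  have := (hα 0 h0 t (Ico_subset_Icc_self ht)).2
  rw [map_zero] at this
  exact this.mono_of_mem_nhdsWithin (Icc_mem_nhdsGE_of_mem ht)

end TotalDifferentialEquations

/-! ### Normal form of an involutive distribution -/

section NormalForm

variable {E : Type*} [NormedAddCommGroup E] [NormedSpace ℝ E] {r : ℕ}

/-- The linear map with prescribed values on the standard basis. -/
def linearCombinationCLM (X : Fin r → E) : EuclideanSpace ℝ (Fin r) →L[ℝ] E :=
  ∑ j, (EuclideanSpace.proj j : EuclideanSpace ℝ (Fin r) →L[ℝ] ℝ).smulRight (X j)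

theorem linearCombinationCLM_apply (X : Fin r → E) (b : EuclideanSpace ℝ (Fin r)) :
    linearCombinationCLM X b = ∑ j, b j • X j := by
  simp [linearCombinationCLM, sum_apply]

theorem linearCombinationCLM_injective {X : Fin r → E} (hX : LinearIndependent ℝ X) :
    Function.Injective (linearCombinationCLM X) := by
  refine (injective_iff_map_eq_zero _).2 fun b hb => ?_
  rw [linearCombinationCLM_apply] at hb
  ext j
  exact Fintype.linearIndependent_iff.1 hX _ hb j

theorem ContDiffAt.linearCombinationCLM {X : Fin r → E → E} {q : E}
    (hX : ∀ j, ContDiffAt ℝ ∞ (X j) q) :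
    ContDiffAt ℝ ∞ (fun q => linearCombinationCLM fun j => X j q) q := by
  unfold _root_.linearCombinationCLM
  exact ContDiffAt.sum fun j _ => contDiffAt_const.smulRight (hX j)

/-- An injective linear map from a finite-dimensional space has a continuous left inverse. -/
theorem ContinuousLinearMap.exists_comp_eq_id_of_injective [FiniteDimensional ℝ E] {G : Type*} [NormedAddCommGroup G]
    [NormedSpace ℝ G] {T : G →L[ℝ] E} (hT : Function.Injective T) :
    ∃ pr : E →L[ℝ] G, pr ∘L T = ContinuousLinearMap.id ℝ G := by
  obtain ⟨g, hg⟩ := LinearMap.exists_leftInverse_of_injective T.toLinearMap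
    (LinearMap.ker_eq_bot.2 hT)
  exact ⟨g.toContinuousLinearMap, by ext x; exact LinearMap.congr_fun hg x⟩

set_option synthInstance.maxHeartbeats 200000 in
/-- A distribution `D` that contains smooth fields `X₁, …, X_r`, linearly independent at `q₀`,
contains near `q₀` the graph-like field of linear maps `Λ`, normalised by a projection `pr`. If `D`
has rank `r` and contains the brackets of the `X_j`, then the equation `Df = Λ ∘ f` is
integrable. -/
theorem exists_normalForm [FiniteDimensional ℝ E] {D : E → Submodule ℝ E} {X : Fin r → E → E} {q₀ : E}
    (hX : ∀ᶠ q in 𝓝 q₀, ∀ j, ContDiffAt ℝ ∞ (X j) q ∧ X j q ∈ D q)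
    (hli : LinearIndependent ℝ fun j => X j q₀) :
    ∃ (pr : E →L[ℝ] EuclideanSpace ℝ (Fin r)) (Λ : E → EuclideanSpace ℝ (Fin r) →L[ℝ] E),
      (∀ᶠ q in 𝓝 q₀, ContDiffAt ℝ ∞ Λ q ∧ (∀ w, pr (Λ q w) = w) ∧ ∀ w, Λ q w ∈ D q) ∧
      ((∀ᶠ q in 𝓝 q₀, Module.finrank ℝ (D q) ≤ r) →
        (∀ᶠ q in 𝓝 q₀, ∀ i j, fderiv ℝ (X j) q (X i q) - fderiv ℝ (X i) q (X j q) ∈ D q) →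
        ∀ᶠ q in 𝓝 q₀, ∀ w h, fderiv ℝ Λ q (Λ q w) h = fderiv ℝ Λ q (Λ q h) w) := by
  let G := EuclideanSpace ℝ (Fin r)
  let S : E → G →L[ℝ] E := fun q => linearCombinationCLM fun j => X j q
  have hSb : ∀ q b, S q b = ∑ j, b j • X j q := fun q b => linearCombinationCLM_apply _ _
  obtain ⟨pr, hpr⟩ := ContinuousLinearMap.exists_comp_eq_id_of_injective
    (linearCombinationCLM_injective hli)
  have hS : ∀ᶠ q in 𝓝 q₀, ContDiffAt ℝ ∞ S q :=
    hX.mono fun q hq => ContDiffAt.linearCombinationCLM fun j => (hq j).1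
  have hunit : ∀ᶠ q in 𝓝 q₀, IsUnit (pr ∘L S q) := by
    have hc : ContinuousAt (fun q => pr ∘L S q) q₀ :=
      continuousAt_const.clm_comp hS.self_of_nhds.continuousAt
    refine hc.eventually_mem (Units.isOpen.mem_nhds ?_)
    change IsUnit (pr ∘L S q₀)
    rw [hpr]
    exact isUnit_one
  -- Correcting the frame `S` by the inverse of `pr ∘L S` achieves `pr ∘ Λ = id`. The value of
  -- `Ring.inverse` matters only near `q₀`, where `pr ∘L S q` is a unit.
  let κ : E → G →L[ℝ] G := fun q => Ring.inverse (pr ∘L S q)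
  let Λ : E → G →L[ℝ] E := fun q => S q ∘L κ q
  have hκ : ∀ᶠ q in 𝓝 q₀, ContDiffAt ℝ ∞ κ q := by
    filter_upwards [hS, hunit] with q hq hu
    obtain ⟨u, hu⟩ := hu
    have h1 : ContDiffAt ℝ ∞ Ring.inverse (pr ∘L S q) := hu ▸ contDiffAt_ringInverse ℝ u
    exact h1.comp q (contDiffAt_const.clm_comp hq)
  have hΛ : ∀ᶠ q in 𝓝 q₀, ContDiffAt ℝ ∞ Λ q := by
    filter_upwards [hS, hκ] with q h1 h2 using h1.clm_comp h2
  have hprΛ : ∀ᶠ q in 𝓝 q₀, ∀ w, pr (Λ q w) = w := by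
    filter_upwards [hunit] with q hu w
    exact DFunLike.congr_fun (Ring.mul_inverse_cancel _ hu) w
  have hSD : ∀ᶠ q in 𝓝 q₀, ∀ b, S q b ∈ D q := by
    filter_upwards [hX] with q hq b
    rw [hSb]
    exact Submodule.sum_mem _ fun j _ => Submodule.smul_mem _ _ (hq j).2
  refine ⟨pr, Λ, ?_, fun hrank hinv => ?_⟩
  · filter_upwards [hΛ, hprΛ, hSD] with q h1 h2 h3 using ⟨h1, h2, fun w => h3 _⟩
  filter_upwards [hX, hS, hκ, hΛ, hprΛ.eventually_nhds, hSD, hrank, hinv]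
    with q hXq hSq hκq hΛq hprq hSDq hr hi w h
  have hle : LinearMap.range (Λ q).toLinearMap ≤ D q := by
    rintro _ ⟨w, rfl⟩
    exact hSDq _
  have hinj : Function.Injective (Λ q) := fun a b hab => by
    rw [← hprq.self_of_nhds a, hab, hprq.self_of_nhds b]
  -- The rank bound enters here: `Λ q` is injective, so its image already has dimension `r`.
  have hrange : LinearMap.range (Λ q).toLinearMap = D q :=
    Submodule.eq_of_le_of_finrank_le hle (hr.trans (by
      rw [LinearMap.finrank_range_of_inj hinj]; exact finrank_euclideanSpace_fin.ge))
  have hdS : ∀ v b, fderiv ℝ S q v b = ∑ j, b j • fderiv ℝ (X j) q v := by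
    intro v b
    have h1 : HasFDerivAt (fun q => S q b) ((ContinuousLinearMap.apply ℝ E b) ∘L fderiv ℝ S q) q :=
      (ContinuousLinearMap.apply ℝ E b).hasFDerivAt.comp q
        (hSq.differentiableAt (by simp)).hasFDerivAt
    have h2 : HasFDerivAt (fun q => S q b) (∑ j, b j • fderiv ℝ (X j) q) q := by
      simp only [hSb]
      exact HasFDerivAt.fun_sum fun j _ =>
        (((hXq j).1.differentiableAt (by simp)).hasFDerivAt).const_smul (b j)
    have := DFunLike.congr_fun (h1.unique h2) v
    simpa [sum_apply] using this
  have hdΛ : ∀ v b, fderiv ℝ Λ q v b = fderiv ℝ S q v (κ q b) + S q (fderiv ℝ κ q v b) := by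
    intro v b
    have h1 := (hSq.differentiableAt (by simp)).hasFDerivAt.clm_comp
      (hκq.differentiableAt (by simp)).hasFDerivAt
    have h2 : fderiv ℝ Λ q = _ := h1.fderiv
    rw [h2]
    simp [add_comm]
  -- Differentiate the constant function `q ↦ pr (Λ q b) = b`.
  have hprd : ∀ v b, pr (fderiv ℝ Λ q v b) = 0 := by
    intro v b
    have h1 : HasFDerivAt (fun q => pr (Λ q b))
        ((pr ∘L ContinuousLinearMap.apply ℝ E b) ∘L fderiv ℝ Λ q) q :=
      (pr ∘L ContinuousLinearMap.apply ℝ E b).hasFDerivAt.comp q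
        (hΛq.differentiableAt (by simp)).hasFDerivAt
    have h2 : HasFDerivAt (fun q => pr (Λ q b)) (0 : E →L[ℝ] G) q :=
      (hasFDerivAt_const b q).congr_of_eventuallyEq (hprq.mono fun y hy => hy b)
    exact DFunLike.congr_fun (h1.unique h2) v
  -- This is the bracket of the fields `Λ w` and `Λ h`. It is a combination of the brackets of the
  -- `X_j`, plus terms from differentiating the coefficients `κ`, which lie in the image of `S q`.
  have hmem : fderiv ℝ Λ q (Λ q w) h - fderiv ℝ Λ q (Λ q h) w ∈ D q := by
    have e : fderiv ℝ Λ q (Λ q w) h - fderiv ℝ Λ q (Λ q h) w =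
        ∑ i, ∑ j, (κ q w i * κ q h j) •
          (fderiv ℝ (X j) q (X i q) - fderiv ℝ (X i) q (X j q)) +
        S q (fderiv ℝ κ q (Λ q w) h - fderiv ℝ κ q (Λ q h) w) := by
      have hΛS : ∀ w, Λ q w = ∑ i, κ q w i • X i q := fun w => hSb _ _
      have e1 : ∀ a b : G, fderiv ℝ S q (Λ q a) (κ q b) =
          ∑ i, ∑ j, (κ q a i * κ q b j) • fderiv ℝ (X j) q (X i q) := by
        intro a b
        rw [hdS, Finset.sum_comm]
        refine Finset.sum_congr rfl fun j _ => ?_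
        rw [hΛS, map_sum, Finset.smul_sum]
        refine Finset.sum_congr rfl fun i _ => ?_
        rw [map_smul, smul_smul, mul_comm]
      have e2 : ∑ i, ∑ j, (κ q h i * κ q w j) • fderiv ℝ (X j) q (X i q) =
          ∑ i, ∑ j, (κ q w i * κ q h j) • fderiv ℝ (X i) q (X j q) := by
        rw [Finset.sum_comm]
        simp only [mul_comm]
      rw [hdΛ, hdΛ, e1, e1, e2]
      simp only [smul_sub, Finset.sum_sub_distrib, map_sub]
      abel
    rw [e]
    exact Submodule.add_mem _ (Submodule.sum_mem _ fun i _ => Submodule.sum_mem _ fun j _ =>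
      Submodule.smul_mem _ _ (hi i j)) (hSDq _)
  rw [← hrange] at hmem
  obtain ⟨b, hb⟩ := hmem
  have hb' : Λ q b = fderiv ℝ Λ q (Λ q w) h - fderiv ℝ Λ q (Λ q h) w := hb
  -- The bracket lies in the image of `Λ q`, on which `pr` is injective, and `pr` kills it.
  have hb0 : b = 0 := by
    rw [← hprq.self_of_nhds b, hb', map_sub, hprd, hprd, sub_zero]
  rw [hb0, map_zero] at hb'
  exact (sub_eq_zero.1 hb'.symm)

end NormalForm

/-! ### Vector fields in charts and globally defined test functions -/

section Cutoff

variable {E : Type*} [NormedAddCommGroup E] [NormedSpace ℝ E]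
  {M : Type*} [TopologicalSpace M] [ChartedSpace E M]

theorem mvfderiv_clm_comp {H : Type*} [NormedAddCommGroup H] [NormedSpace ℝ H]
    {H' : Type*} [NormedAddCommGroup H'] [NormedSpace ℝ H'] {g : M → H} {x : M}
    (ℓ : H →L[ℝ] H') (hg : MDifferentiableAt 𝓘(ℝ, E) 𝓘(ℝ, H) g x) :
    mvfderiv 𝓘(ℝ, E) (fun y => ℓ (g y)) x = ℓ ∘L mvfderiv 𝓘(ℝ, E) g x := by
  have h := mfderiv_comp x (ℓ.differentiableAt.mdifferentiableAt) hg
  rw [mfderiv_eq_fderiv, ℓ.fderiv] at h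
  exact h

theorem Filter.EventuallyEq.mvfderiv_eq {H : Type*} [NormedAddCommGroup H] [NormedSpace ℝ H]
    {f g : M → H} {x : M} (h : f =ᶠ[𝓝 x] g) :
    mvfderiv 𝓘(ℝ, E) f x = mvfderiv 𝓘(ℝ, E) g x := by
  have := h.mfderiv_eq (I := 𝓘(ℝ, E)) (I' := 𝓘(ℝ, H))
  exact this

variable [IsManifold 𝓘(ℝ, E) ∞ M]

/-- Over the source of the chart at `p`, the trivialisation of the tangent bundle at `p` is the
derivative of that chart. -/
theorem contMDiffAt_section_tangent_iff {Y : ∀ x : M, TangentSpace 𝓘(ℝ, E) x} {p x : M}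
    (hx : x ∈ (chartAt E p).source) :
    ContMDiffAt 𝓘(ℝ, E) 𝓘(ℝ, E).tangent ∞
      (fun y => (⟨y, Y y⟩ : TangentBundle 𝓘(ℝ, E) M)) x ↔
    ContMDiffAt 𝓘(ℝ, E) 𝓘(ℝ, E) ∞
      (fun y => mvfderiv 𝓘(ℝ, E) (extChartAt 𝓘(ℝ, E) p) y (Y y)) x := by
  refine (Bundle.Trivialization.contMDiffAt_section_iff
    (trivializationAt E (TangentSpace 𝓘(ℝ, E)) p) (by simpa using hx)).trans ?_
  refine Filter.EventuallyEq.contMDiffAt_iff ?_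
  filter_upwards [(chartAt E p).open_source.mem_nhds hx] with y hy
  have h := DFunLike.congr_fun
    (TangentBundle.continuousLinearMapAt_trivializationAt (I := 𝓘(ℝ, E)) hy) (Y y)
  rw [Bundle.Trivialization.continuousLinearMapAt_apply,
    Bundle.Trivialization.coe_linearMapAt_of_mem _ (by simpa using hy)] at h
  exact h

theorem mvfderiv_extChartAt_injective {p x : M} (hx : x ∈ (chartAt E p).source) :
    Function.Injective (mvfderiv 𝓘(ℝ, E) (extChartAt 𝓘(ℝ, E) p) x) :=
  (isInvertible_mfderiv_extChartAt (I := 𝓘(ℝ, E)) (by simpa using hx)).injective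

variable [FiniteDimensional ℝ E]

/-- Locally defined smooth functions agree near a point with globally defined ones. -/
theorem exists_contMDiff_eventuallyEq [T2Space M] {H : Type*} [NormedAddCommGroup H]
    [NormedSpace ℝ H] {g : M → H} {u : Set M} {x : M} (hu : IsOpen u) (hx : x ∈ u)
    (hg : ContMDiffOn 𝓘(ℝ, E) 𝓘(ℝ, H) ∞ g u) :
    ∃ f : M → H, ContMDiff 𝓘(ℝ, E) 𝓘(ℝ, H) ∞ f ∧ f =ᶠ[𝓝 x] g := by
  obtain ⟨ψ, hψ, -⟩ := ((SmoothBumpFunction.nhds_basis_support (I := 𝓘(ℝ, E))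
    (hu.mem_nhds hx)).mem_iff.1 (hu.mem_nhds hx))
  refine ⟨fun y => ψ y • g y, contMDiff_of_tsupport fun y hy => ?_, ?_⟩
  · have hy' : y ∈ u := hψ (tsupport_smul_subset_left _ _ hy)
    exact (ψ.contMDiff y).smul ((hg y hy').contMDiffAt (hu.mem_nhds hy'))
  · filter_upwards [ψ.eventuallyEq_one] with y hy
    rw [hy]
    exact one_smul _ _

/-- Smooth functions separate tangent vectors. -/
theorem eq_zero_of_forall_mvfderiv_eq_zero [T2Space M] {x : M} {v : TangentSpace 𝓘(ℝ, E) x}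
    (h : ∀ f : M → ℝ, ContMDiff 𝓘(ℝ, E) 𝓘(ℝ, ℝ) ∞ f → mvfderiv 𝓘(ℝ, E) f x v = 0) : v = 0 := by
  obtain ⟨f, hf, hfx⟩ := exists_contMDiff_eventuallyEq (chartAt E x).open_source
    (mem_chart_source E x) (contMDiffOn_extChartAt (I := 𝓘(ℝ, E)) (n := ∞) (x := x))
  have hinj := mvfderiv_extChartAt_injective (mem_chart_source E x)
  refine hinj ?_
  rw [map_zero, ← hfx.mvfderiv_eq]
  by_contra hne
  obtain ⟨ℓ, hℓ⟩ := SeparatingDual.exists_ne_zero (R := ℝ) hne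
  refine hℓ ?_
  have := h (fun y => ℓ (f y)) (ℓ.contMDiff.comp hf)
  rwa [mvfderiv_clm_comp ℓ ((hf x).mdifferentiableAt (by simp))] at this

end Cutoff

/-! ### The anchor preserves brackets -/

namespace LieAlgebroid

variable {E : Type*} [NormedAddCommGroup E] [NormedSpace ℝ E]
  {M : Type*} [TopologicalSpace M] [ChartedSpace E M] [IsManifold 𝓘(ℝ, E) ∞ M]
  {F : Type*} [NormedAddCommGroup F] [NormedSpace ℝ F]
  {V : M → Type*} [TopologicalSpace (TotalSpace F V)]
  [∀ x, AddCommGroup (V x)] [∀ x, Module ℝ (V x)] [∀ x, TopologicalSpace (V x)]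
  [FiberBundle F V] [VectorBundle ℝ F V] [ContMDiffVectorBundle ∞ F V 𝓘(ℝ, E)]
  (A : LieAlgebroid E F V)

/-- The vector field on the model space that represents the anchor of `s` in the chart at `p`. -/
def coordField (p : M) (s : Cₛ^∞⟮𝓘(ℝ, E); F, V⟯) (q : E) : E :=
  mvfderiv 𝓘(ℝ, E) (extChartAt 𝓘(ℝ, E) p) ((extChartAt 𝓘(ℝ, E) p).symm q)
    (A.anchor ((extChartAt 𝓘(ℝ, E) p).symm q) (s ((extChartAt 𝓘(ℝ, E) p).symm q)))

theorem coordField_extChartAt {p x : M} (hx : x ∈ (chartAt E p).source)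
    (s : Cₛ^∞⟮𝓘(ℝ, E); F, V⟯) : A.coordField p s (extChartAt 𝓘(ℝ, E) p x) =
      mvfderiv 𝓘(ℝ, E) (extChartAt 𝓘(ℝ, E) p) x (A.anchor x (s x)) := by
  unfold coordField
  rw [(extChartAt 𝓘(ℝ, E) p).left_inv (by simpa using hx)]

theorem contDiffAt_coordField {p : M} (s : Cₛ^∞⟮𝓘(ℝ, E); F, V⟯) {q : E}
    (hq : q ∈ (extChartAt 𝓘(ℝ, E) p).target) : ContDiffAt ℝ ∞ (A.coordField p s) q := by
  have hx : (extChartAt 𝓘(ℝ, E) p).symm q ∈ (chartAt E p).source := by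
    simpa using (extChartAt 𝓘(ℝ, E) p).map_target hq
  have h1 := (contMDiffAt_section_tangent_iff hx).1 (A.smooth_anchor_apply s _)
  have h2 : ContMDiffAt 𝓘(ℝ, E) 𝓘(ℝ, E) ∞ (extChartAt 𝓘(ℝ, E) p).symm q :=
    (contMDiffOn_extChartAt_symm p q hq).contMDiffAt
      ((isOpen_extChartAt_target p).mem_nhds hq)
  exact (h1.comp q h2).contDiffAt

variable [FiniteDimensional ℝ E] [T2Space M] [FiniteDimensional ℝ F]

/-- The anchor is a homomorphism of Lie algebras from sections to derivations. -/
theorem anchor_bracket (s t : Cₛ^∞⟮𝓘(ℝ, E); F, V⟯) {f : M → ℝ}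
    (hf : ContMDiff 𝓘(ℝ, E) 𝓘(ℝ, ℝ) ∞ f) (x : M) :
    mvfderiv 𝓘(ℝ, E) f x (A.anchor x (A.bracket s t x)) =
      mvfderiv 𝓘(ℝ, E) (fun y => mvfderiv 𝓘(ℝ, E) f y (A.anchor y (t y))) x (A.anchor x (s x)) -
      mvfderiv 𝓘(ℝ, E) (fun y => mvfderiv 𝓘(ℝ, E) f y (A.anchor y (s y))) x
        (A.anchor x (t x)) := by
  -- The argument compares coefficients of a section that does not vanish at `x`; if the fibre is
  -- zero, both sides are zero.
  by_cases hV : ∀ v : V x, v = 0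
  · rw [hV (A.bracket s t x), hV (s x), hV (t x)]
    simp
  push Not at hV
  obtain ⟨v, hv⟩ := hV
  obtain ⟨u, hu⟩ := evalSection_surjective (E := E) (F := F) x v
  have hux : u x = v := hu
  have key : ∀ a : Cₛ^∞⟮𝓘(ℝ, E); F, V⟯, A.bracket a (funSMul f hf u) =
      funSMul f hf (A.bracket a u) + funSMul _ (A.smooth_derivative a hf) u := by
    intro a
    ext y
    exact A.leibniz f hf a u y
  -- Expand the Jacobi identity for `s`, `t`, `f u` by Leibniz. The terms with `f` undifferentiated
  -- cancel by the Jacobi identity for `u`, the mixed first-order terms cancel in pairs, and the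
  -- claim remains as a coefficient of `u x = v`.
  have hj := A.jacobi s t (funSMul f hf u)
  have hj' := A.jacobi s t u
  rw [key t, key s, map_add, map_add] at hj
  have h1 := congrArg (fun a : Cₛ^∞⟮𝓘(ℝ, E); F, V⟯ => a x) hj
  have h2 := congrArg (fun a : Cₛ^∞⟮𝓘(ℝ, E); F, V⟯ => a x) hj'
  simp only [ContMDiffSection.coe_add, Pi.add_apply, A.leibniz] at h1 h2
  have h3 : ∀ (g : M → ℝ) (hg : ContMDiff 𝓘(ℝ, E) 𝓘(ℝ, ℝ) ∞ g) (a : Cₛ^∞⟮𝓘(ℝ, E); F, V⟯),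
    funSMul g hg a x = g x • a x := fun _ _ _ => rfl
  rw [h2, hux] at h1
  have h4 : (mvfderiv 𝓘(ℝ, E) f x (A.anchor x (A.bracket s t x)) -
      (mvfderiv 𝓘(ℝ, E) (fun y => mvfderiv 𝓘(ℝ, E) f y (A.anchor y (t y))) x (A.anchor x (s x)) -
      mvfderiv 𝓘(ℝ, E) (fun y => mvfderiv 𝓘(ℝ, E) f y (A.anchor y (s y))) x
        (A.anchor x (t x)))) • v = 0 := by
    rw [sub_smul, sub_smul]
    linear_combination (norm := module) -h1
  exact sub_eq_zero.1 ((smul_eq_zero.1 h4).resolve_right hv)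

/-- Apply `anchor_bracket` to `ℓ ∘ f`, where `ℓ` is a functional on `E` and `f` is a global smooth
map equal to the chart near the point; functionals separate the vectors of `E`. This is the source
of involutivity. -/
theorem coordField_bracket {p : M} (s t : Cₛ^∞⟮𝓘(ℝ, E); F, V⟯) {q : E}
    (hq : q ∈ (extChartAt 𝓘(ℝ, E) p).target) :
    A.coordField p (A.bracket s t) q = fderiv ℝ (A.coordField p t) q (A.coordField p s q) -
      fderiv ℝ (A.coordField p s) q (A.coordField p t q) := by
  obtain ⟨x, hx, rfl⟩ : ∃ x ∈ (chartAt E p).source, extChartAt 𝓘(ℝ, E) p x = q :=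
    ⟨_, by simpa using (extChartAt 𝓘(ℝ, E) p).map_target hq, (extChartAt 𝓘(ℝ, E) p).right_inv hq⟩
  obtain ⟨f, hf, hfx⟩ := exists_contMDiff_eventuallyEq (chartAt E p).open_source hx
    (contMDiffOn_extChartAt (I := 𝓘(ℝ, E)) (n := ∞) (x := p))
  refine (SeparatingDual.eq_iff_forall_dual_eq (R := ℝ)).2 fun ℓ => ?_
  have hφ : ∀ y ∈ (chartAt E p).source,
      MDifferentiableAt 𝓘(ℝ, E) 𝓘(ℝ, E) (extChartAt 𝓘(ℝ, E) p) y := fun y hy =>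
    mdifferentiableAt_extChartAt hy
  have hd : ∀ᶠ y in 𝓝 x, ∀ a : Cₛ^∞⟮𝓘(ℝ, E); F, V⟯,
      mvfderiv 𝓘(ℝ, E) (fun y => ℓ (f y)) y (A.anchor y (a y)) =
        ℓ (A.coordField p a (extChartAt 𝓘(ℝ, E) p y)) := by
    filter_upwards [hfx.eventuallyEq_nhds, (chartAt E p).open_source.mem_nhds hx] with y hy hys a
    rw [mvfderiv_clm_comp ℓ ((hf y).mdifferentiableAt (by simp)), hy.mvfderiv_eq,
      A.coordField_extChartAt hys]
    rfl
  have h2 : ∀ a b : Cₛ^∞⟮𝓘(ℝ, E); F, V⟯, mvfderiv 𝓘(ℝ, E)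
      (fun y => mvfderiv 𝓘(ℝ, E) (fun y => ℓ (f y)) y (A.anchor y (a y))) x (A.anchor x (b x)) =
      ℓ (fderiv ℝ (A.coordField p a) (extChartAt 𝓘(ℝ, E) p x)
        (A.coordField p b (extChartAt 𝓘(ℝ, E) p x))) := by
    intro a b
    have e1 : (fun y => mvfderiv 𝓘(ℝ, E) (fun y => ℓ (f y)) y (A.anchor y (a y))) =ᶠ[𝓝 x]
        fun y => (ℓ ∘ A.coordField p a) (extChartAt 𝓘(ℝ, E) p y) := hd.mono fun y hy => hy a
    have e2 : DifferentiableAt ℝ (A.coordField p a) (extChartAt 𝓘(ℝ, E) p x) :=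
      (A.contDiffAt_coordField a hq).differentiableAt (by simp)
    have e3 := mvfderiv_comp_apply (g := ℓ ∘ A.coordField p a) x
      (ℓ.differentiableAt.comp _ e2).mdifferentiableAt (hφ x hx) (A.anchor x (b x))
    rw [e1.mvfderiv_eq, A.coordField_extChartAt hx b]
    refine e3.trans ?_
    have e4 : mvfderiv 𝓘(ℝ, E) (ℓ ∘ A.coordField p a) (extChartAt 𝓘(ℝ, E) p x) =
        ℓ ∘L fderiv ℝ (A.coordField p a) (extChartAt 𝓘(ℝ, E) p x) := by
      refine (mvfderiv_clm_comp ℓ e2.mdifferentiableAt).trans ?_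
      congr 1
      exact mfderiv_eq_fderiv
    rw [e4]
    rfl
  have h := A.anchor_bracket s t (ℓ.contMDiff.comp hf) x
  change mvfderiv 𝓘(ℝ, E) (fun y => ℓ (f y)) x _ = mvfderiv 𝓘(ℝ, E) (fun y =>
    mvfderiv 𝓘(ℝ, E) (fun y => ℓ (f y)) y _) x _ - mvfderiv 𝓘(ℝ, E) (fun y =>
    mvfderiv 𝓘(ℝ, E) (fun y => ℓ (f y)) y _) x _ at h
  rw [hd.self_of_nhds, h2, h2] at h
  rw [h, map_sub]

end LieAlgebroid

/-! ### Alternating forms: dependence on images, smoothness on frames -/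

section Alternating

theorem AlternatingMap.apply_sum_smul {W ι : Type*} [AddCommGroup W] [Module ℝ W] [Fintype ι]
    {k : ℕ} (θ : W [⋀^Fin k]→ₗ[ℝ] ℝ) (c : Fin k → ι → ℝ) (e : ι → W) :
    θ (fun i => ∑ j, c i j • e j) =
      ∑ J : Fin k → ι, (∏ i, c i (J i)) * θ (fun i => e (J i)) := by
  classical
  have h := θ.toMultilinearMap.map_sum (fun i j => c i j • e j)
  refine h.trans (Finset.sum_congr rfl fun J _ => ?_)
  exact θ.toMultilinearMap.map_smul_univ (fun i => c i (J i)) (fun i => e (J i))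

/-- A form that vanishes on the kernel of `p` depends only on the images under `p`. -/
theorem AlternatingMap.eq_of_forall_map_eq {W T : Type*} [AddCommGroup W] [Module ℝ W]
    [AddCommGroup T] [Module ℝ T] {k : ℕ} (θ : W [⋀^Fin k]→ₗ[ℝ] ℝ) (p : W →ₗ[ℝ] T)
    (hθ : ∀ (a : Fin k → W) i, p (a i) = 0 → θ a = 0) {a b : Fin k → W}
    (h : ∀ i, p (a i) = p (b i)) : θ a = θ b := by
  classical
  suffices ∀ S : Finset (Fin k), θ (S.piecewise b a) = θ a by
    have := this Finset.univ
    rwa [Finset.piecewise_univ, eq_comm] at this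
  intro S
  induction S using Finset.induction_on with
  | empty => rw [Finset.piecewise_empty]
  | insert i S hi ih =>
    have h1 : b i = S.piecewise b a i + (b i - a i) := by
      rw [Finset.piecewise_eq_of_notMem _ _ _ hi]
      abel
    have h2 : θ (Function.update (S.piecewise b a) i (b i - a i)) = 0 :=
      hθ _ i (by rw [Function.update_self, map_sub, h i, sub_self])
    rw [Finset.piecewise_insert, h1, AlternatingMap.map_update_add, Function.update_eq_self, ih,
      h2, add_zero]

variable {E : Type*} [NormedAddCommGroup E] [NormedSpace ℝ E]
  {N : Type*} [TopologicalSpace N] [ChartedSpace E N]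

/-- Forms evaluated on smooth combinations of sections on which they are smooth. -/
theorem contMDiffAt_alternatingMap_of_frame {W : N → Type*} [∀ x, AddCommGroup (W x)]
    [∀ x, Module ℝ (W x)] {ι : Type*} [Fintype ι] {k : ℕ} {θ : ∀ x, (W x) [⋀^Fin k]→ₗ[ℝ] ℝ}
    {s : Fin k → ∀ x, W x} {e : ι → ∀ x, W x} {c : Fin k → ι → N → ℝ} {x₀ : N}
    (hc : ∀ i j, ContMDiffAt 𝓘(ℝ, E) 𝓘(ℝ, ℝ) ∞ (c i j) x₀)
    (he : ∀ J : Fin k → ι, ContMDiffAt 𝓘(ℝ, E) 𝓘(ℝ, ℝ) ∞ (fun x => θ x fun i => e (J i) x) x₀)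
    (hs : ∀ i, ∀ᶠ x in 𝓝 x₀, s i x = ∑ j, c i j x • e j x) :
    ContMDiffAt 𝓘(ℝ, E) 𝓘(ℝ, ℝ) ∞ (fun x => θ x fun i => s i x) x₀ := by
  have h : (fun x => θ x fun i => s i x) =ᶠ[𝓝 x₀]
      fun x => ∑ J : Fin k → ι, (∏ i, c i (J i) x) * θ x (fun i => e (J i) x) := by
    filter_upwards [Filter.eventually_all.2 hs] with x hx
    simp only [hx]
    exact (θ x).apply_sum_smul (fun i j => c i j x) fun j => e j x
  refine ContMDiffAt.congr_of_eventuallyEq ?_ h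
  exact contMDiffAt_finsetSum fun J _ => (contMDiffAt_finsetProd fun i _ => hc i (J i)).mul (he J)

variable [FiniteDimensional ℝ E]

/-- The restriction of a smooth form along a smooth map is smooth on sections along that map. -/
theorem SmoothForm.contMDiffAt_comp {E' : Type*} [NormedAddCommGroup E'] [NormedSpace ℝ E']
    {L : Type*} [TopologicalSpace L] [ChartedSpace E' L] [T2Space N] [IsManifold 𝓘(ℝ, E) ∞ N]
    {F : Type*} [NormedAddCommGroup F] [NormedSpace ℝ F] [FiniteDimensional ℝ F]
    {V : N → Type*} [TopologicalSpace (TotalSpace F V)]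
    [∀ x, AddCommGroup (V x)] [∀ x, Module ℝ (V x)] [∀ x, TopologicalSpace (V x)]
    [FiberBundle F V] [VectorBundle ℝ F V] [ContMDiffVectorBundle ∞ F V 𝓘(ℝ, E)] {k : ℕ}
    (η : SmoothForm E F V k) {g : L → N} {s : Fin k → ∀ x, V (g x)} {x₀ : L}
    (hg : ContMDiffAt 𝓘(ℝ, E') 𝓘(ℝ, E) ∞ g x₀)
    (hs : ∀ i, ContMDiffAt 𝓘(ℝ, E') 𝓘(ℝ, F) ∞
      (fun x => (trivializationAt F V (g x₀) ⟨g x, s i x⟩).2) x₀) :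
    ContMDiffAt 𝓘(ℝ, E') 𝓘(ℝ, ℝ) ∞ (fun x => η.1 (g x) fun i => s i x) x₀ := by
  have : ContMDiffVectorBundle 1 F V 𝓘(ℝ, E) := ContMDiffVectorBundle.of_le (n := ∞) (by simp)
  let t := trivializationAt F V (g x₀)
  have hx : g x₀ ∈ t.baseSet := FiberBundle.mem_baseSet_trivializationAt F V (g x₀)
  obtain ⟨ψ, hψ, -⟩ := ((SmoothBumpFunction.nhds_basis_support (I := 𝓘(ℝ, E))
    (t.open_baseSet.mem_nhds hx)).mem_iff.1 (t.open_baseSet.mem_nhds hx))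
  let b := Module.Free.chooseBasis ℝ F
  -- Smoothness of `η` is only given on global sections, so the local frame is cut off; near `g x₀`
  -- nothing changes.
  let e : Module.Free.ChooseBasisIndex ℝ F → Cₛ^∞⟮𝓘(ℝ, E); F, V⟯ := fun i =>
    ⟨(ψ : N → ℝ) • t.localFrame b i, ψ.contMDiff.contMDiffOn.smul_section_of_tsupport
      t.open_baseSet hψ (t.contMDiffOn_localFrame_baseSet _ b i)⟩
  refine contMDiffAt_alternatingMap_of_frame (W := fun x => V (g x)) (θ := fun x => η.1 (g x))
    (e := fun j x => e j (g x)) (c := fun i j x => b.coord j (t ⟨g x, s i x⟩).2)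
    (fun i j => ?_) (fun J => ?_) (fun i => ?_)
  · exact ((b.coord j).toContinuousLinearMap.contMDiff _).comp x₀ (hs i)
  · exact (η.2 (fun i => e (J i)) _).comp x₀ hg
  · filter_upwards [hg.continuousAt.eventually_mem (t.open_baseSet.mem_nhds hx),
      hg.continuousAt.eventually ψ.eventuallyEq_one] with x hx1 hx2
    have h1 : ∀ j, e j (g x) = t.basisAt b hx1 j := fun j => by
      change ψ (g x) • t.localFrame b j (g x) = _
      rw [hx2, t.localFrame_apply_of_mem_baseSet b hx1]
      exact one_smul _ _
    simp only [h1]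
    conv_lhs => rw [← (t.basisAt b hx1).sum_repr (s i x)]
    refine Finset.sum_congr rfl fun j _ => ?_
    congr 1

end Alternating

/-! ### Smoothness of vector fields: coefficients in a frame, lifts along immersions -/

section VectorFields

set_option synthInstance.maxHeartbeats 200000 in
/-- A linear equation whose coefficients depend smoothly on a point and are injective at `x₀` has
smooth solutions. -/
theorem contMDiffAt_of_injective_clm {E : Type*} [NormedAddCommGroup E] [NormedSpace ℝ E]
    {N : Type*} [TopologicalSpace N] [ChartedSpace E N]
    {G H : Type*} [NormedAddCommGroup G] [NormedSpace ℝ G] [FiniteDimensional ℝ G]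
    [NormedAddCommGroup H] [NormedSpace ℝ H] [FiniteDimensional ℝ H]
    {B : N → G →L[ℝ] H} {y : N → G} {x₀ : N} (hB : ContMDiffAt 𝓘(ℝ, E) 𝓘(ℝ, G →L[ℝ] H) ∞ B x₀)
    (hinj : Function.Injective (B x₀))
    (hy : ContMDiffAt 𝓘(ℝ, E) 𝓘(ℝ, H) ∞ (fun x => B x (y x)) x₀) :
    ContMDiffAt 𝓘(ℝ, E) 𝓘(ℝ, G) ∞ y x₀ := by
  obtain ⟨pr, hpr⟩ := ContinuousLinearMap.exists_comp_eq_id_of_injective hinj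
  have h1 : ContMDiffAt 𝓘(ℝ, E) 𝓘(ℝ, G →L[ℝ] G) ∞ (fun x => pr ∘L B x) x₀ :=
    contMDiffAt_const.clm_comp hB
  have hunit : ∀ᶠ x in 𝓝 x₀, IsUnit (pr ∘L B x) := by
    refine h1.continuousAt.eventually_mem (Units.isOpen.mem_nhds ?_)
    change IsUnit (pr ∘L B x₀)
    rw [hpr]
    exact isUnit_one
  have h2 : ContMDiffAt 𝓘(ℝ, E) 𝓘(ℝ, G →L[ℝ] G) ∞ (fun x => Ring.inverse (pr ∘L B x)) x₀ := by
    obtain ⟨u, hu⟩ := hunit.self_of_nhds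
    have h3 : ContDiffAt ℝ ∞ Ring.inverse (pr ∘L B x₀) := hu ▸ contDiffAt_ringInverse ℝ u
    exact h3.contMDiffAt.comp x₀ h1
  have h4 : ContMDiffAt 𝓘(ℝ, E) 𝓘(ℝ, G) ∞ (fun x => pr (B x (y x))) x₀ :=
    contMDiffAt_const.clm_apply hy
  -- Near `x₀`, `y` is recovered from `B y` by the smooth left inverse `(pr ∘ B)⁻¹ ∘ pr` of `B`.
  refine (h2.clm_apply h4).congr_of_eventuallyEq ?_
  filter_upwards [hunit] with x hx
  exact (DFunLike.congr_fun (Ring.inverse_mul_cancel _ hx) (y x)).symm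

theorem ContMDiffAt.linearCombinationCLM {E : Type*} [NormedAddCommGroup E] [NormedSpace ℝ E]
    {N : Type*} [TopologicalSpace N] [ChartedSpace E N] {H : Type*} [NormedAddCommGroup H]
    [NormedSpace ℝ H] {r : ℕ} {X : Fin r → N → H} {x₀ : N}
    (hX : ∀ j, ContMDiffAt 𝓘(ℝ, E) 𝓘(ℝ, H) ∞ (X j) x₀) :
    ContMDiffAt 𝓘(ℝ, E) 𝓘(ℝ, EuclideanSpace ℝ (Fin r) →L[ℝ] H) ∞
      (fun x => linearCombinationCLM fun j => X j x) x₀ := by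
  unfold _root_.linearCombinationCLM
  refine contMDiffAt_finsetSum fun j _ => ?_
  exact ((ContinuousLinearMap.smulRightL ℝ (EuclideanSpace ℝ (Fin r)) H
    (EuclideanSpace.proj j)).contMDiff _).comp x₀ (hX j)

variable {E : Type*} [NormedAddCommGroup E] [NormedSpace ℝ E]
  {N : Type*} [TopologicalSpace N] [ChartedSpace E N] [IsManifold 𝓘(ℝ, E) ∞ N]

/-- The coefficients of a smooth vector field in a smooth frame are smooth. -/
theorem exists_contMDiffAt_coeff {r : ℕ} {Y : ∀ x : N, TangentSpace 𝓘(ℝ, E) x}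
    {Z : Fin r → ∀ x : N, TangentSpace 𝓘(ℝ, E) x} {x₀ : N} [FiniteDimensional ℝ E]
    (hY : ContMDiffAt 𝓘(ℝ, E) 𝓘(ℝ, E).tangent ∞
      (fun y => (⟨y, Y y⟩ : TangentBundle 𝓘(ℝ, E) N)) x₀)
    (hZ : ∀ j, ContMDiffAt 𝓘(ℝ, E) 𝓘(ℝ, E).tangent ∞
      (fun y => (⟨y, Z j y⟩ : TangentBundle 𝓘(ℝ, E) N)) x₀)
    (hli : LinearIndependent ℝ fun j => Z j x₀) (hr : Module.finrank ℝ E = r) :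
    ∃ c : Fin r → N → ℝ, (∀ j, ContMDiffAt 𝓘(ℝ, E) 𝓘(ℝ, ℝ) ∞ (c j) x₀) ∧
      ∀ᶠ x in 𝓝 x₀, Y x = ∑ j, c j x • Z j x := by
  let φ := extChartAt 𝓘(ℝ, E) x₀
  have hx₀ := mem_chart_source E x₀
  let B : N → EuclideanSpace ℝ (Fin r) →L[ℝ] E := fun x =>
    linearCombinationCLM fun j => mvfderiv 𝓘(ℝ, E) φ x (Z j x)
  have hBa : ∀ x b, B x b = mvfderiv 𝓘(ℝ, E) φ x (∑ j, b j • Z j x) := by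
    intro x b
    simp only [B, linearCombinationCLM_apply, map_sum, map_smul]
  have hB : ContMDiffAt 𝓘(ℝ, E) 𝓘(ℝ, EuclideanSpace ℝ (Fin r) →L[ℝ] E) ∞ B x₀ :=
    ContMDiffAt.linearCombinationCLM fun j => (contMDiffAt_section_tangent_iff hx₀).1 (hZ j)
  have hinj : Function.Injective (B x₀) := linearCombinationCLM_injective
    (hli.map' (mvfderiv 𝓘(ℝ, E) φ x₀).toLinearMap
      (LinearMap.ker_eq_bot.2 (mvfderiv_extChartAt_injective hx₀)))
  obtain ⟨pr, hpr⟩ := ContinuousLinearMap.exists_comp_eq_id_of_injective hinj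
  -- Since `dim E = r`, the surjection `pr` is bijective. Thus `(pr ∘ B)⁻¹ ∘ pr` is also a right
  -- inverse of `B` near `x₀`, and the coefficients `c` below solve the equation instead of only
  -- being determined by it.
  have hprinj : Function.Injective pr :=
    (LinearMap.injective_iff_surjective_of_finrank_eq_finrank (f := pr.toLinearMap)
      (hr.trans finrank_euclideanSpace_fin.symm)).2
      fun w => ⟨B x₀ w, DFunLike.congr_fun hpr w⟩
  have hunit : ∀ᶠ x in 𝓝 x₀, IsUnit (pr ∘L B x) := by
    have hcont : ContinuousAt (fun x => pr ∘L B x) x₀ :=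
      continuousAt_const.clm_comp hB.continuousAt
    refine hcont.eventually_mem (Units.isOpen.mem_nhds ?_)
    change IsUnit (pr ∘L B x₀)
    rw [hpr]
    exact isUnit_one
  let c : N → EuclideanSpace ℝ (Fin r) := fun x =>
    Ring.inverse (pr ∘L B x) (pr (mvfderiv 𝓘(ℝ, E) φ x (Y x)))
  have hBc : ∀ᶠ x in 𝓝 x₀, B x (c x) = mvfderiv 𝓘(ℝ, E) φ x (Y x) := by
    filter_upwards [hunit] with x hx
    exact hprinj (DFunLike.congr_fun (Ring.mul_inverse_cancel _ hx) _)
  have hc : ContMDiffAt 𝓘(ℝ, E) 𝓘(ℝ, EuclideanSpace ℝ (Fin r)) ∞ c x₀ :=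
    contMDiffAt_of_injective_clm hB hinj
      (((contMDiffAt_section_tangent_iff hx₀).1 hY).congr_of_eventuallyEq hBc)
  refine ⟨fun j x => c x j, fun j => ?_, ?_⟩
  · exact ((EuclideanSpace.proj j : EuclideanSpace ℝ (Fin r) →L[ℝ] ℝ).contMDiff _).comp x₀ hc
  · filter_upwards [hBc, (chartAt E x₀).open_source.mem_nhds hx₀] with x hx hxs
    rw [hBa] at hx
    exact (mvfderiv_extChartAt_injective hxs hx).symm

/-- A vector field that is mapped by an immersion to a smooth field is smooth. -/
theorem contMDiffAt_of_mfderiv_immersion [FiniteDimensional ℝ E] {E' : Type*}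
    [NormedAddCommGroup E']
    [NormedSpace ℝ E'] [FiniteDimensional ℝ E'] {L : Type*} [TopologicalSpace L]
    [ChartedSpace E' L] [IsManifold 𝓘(ℝ, E') ∞ L] {g : L → N} {x₀ : L}
    (hg : ContMDiff 𝓘(ℝ, E') 𝓘(ℝ, E) ∞ g)
    (hinj : Function.Injective (mfderiv 𝓘(ℝ, E') 𝓘(ℝ, E) g x₀))
    {Y : ∀ x : L, TangentSpace 𝓘(ℝ, E') x}
    (hY : ContMDiffAt 𝓘(ℝ, E') 𝓘(ℝ, E) ∞ (fun x => mvfderiv 𝓘(ℝ, E)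
      (extChartAt 𝓘(ℝ, E) (g x₀)) (g x) (mfderiv 𝓘(ℝ, E') 𝓘(ℝ, E) g x (Y x))) x₀) :
    ContMDiffAt 𝓘(ℝ, E') 𝓘(ℝ, E').tangent ∞
      (fun y => (⟨y, Y y⟩ : TangentBundle 𝓘(ℝ, E') L)) x₀ := by
  let φ := extChartAt 𝓘(ℝ, E) (g x₀)
  let ψ := extChartAt 𝓘(ℝ, E') x₀
  have hx₀ := mem_chart_source E' x₀
  have hgx₀ := mem_chart_source E (g x₀)
  -- In the charts `ψ`, `φ` the field `Y` solves a linear equation with coefficients `DΦ`, injective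
  -- at `x₀`, and smooth right-hand side.
  let Φ : E' → E := fun q => φ (g (ψ.symm q))
  have hΦ : ContDiffAt ℝ ∞ Φ (ψ x₀) := by
    have h2 : ContMDiffAt 𝓘(ℝ, E') 𝓘(ℝ, E') ∞ ψ.symm (ψ x₀) :=
      (contMDiffOn_extChartAt_symm x₀ _ (mem_extChartAt_target x₀)).contMDiffAt
        ((isOpen_extChartAt_target x₀).mem_nhds (mem_extChartAt_target x₀))
    have h3 : ψ.symm (ψ x₀) = x₀ := extChartAt_to_inv x₀
    have h4 : ContMDiffAt 𝓘(ℝ, E) 𝓘(ℝ, E) ∞ φ (g (ψ.symm (ψ x₀))) := by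
      rw [h3]
      exact contMDiffAt_extChartAt
    exact (ContMDiffAt.comp (g := fun y => φ (g y)) (f := ψ.symm) (ψ x₀) (h4.comp _ (hg _))
      h2).contDiffAt
  rw [contMDiffAt_section_tangent_iff hx₀]
  let B : L → E' →L[ℝ] E := fun x => fderiv ℝ Φ (ψ x)
  have hB : ContMDiffAt 𝓘(ℝ, E') 𝓘(ℝ, E' →L[ℝ] E) ∞ B x₀ :=
    (hΦ.fderiv_right (m := ∞) (by simp)).contMDiffAt.comp x₀ contMDiffAt_extChartAt
  have hΦd : ∀ᶠ x in 𝓝 x₀, DifferentiableAt ℝ Φ (ψ x) := by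
    have h1 : ContDiffAt ℝ 1 Φ (ψ x₀) := hΦ.of_le (by simp)
    exact (continuousAt_extChartAt (I := 𝓘(ℝ, E')) x₀).eventually
      ((h1.eventually (by simp)).mono fun y hy => hy.differentiableAt (by simp))
  have hchain : ∀ᶠ x in 𝓝 x₀, ∀ v : TangentSpace 𝓘(ℝ, E') x, B x (mvfderiv 𝓘(ℝ, E') ψ x v) =
      mvfderiv 𝓘(ℝ, E) φ (g x) (mfderiv 𝓘(ℝ, E') 𝓘(ℝ, E) g x v) := by
    filter_upwards [hΦd, (chartAt E' x₀).open_source.mem_nhds hx₀,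
      (hg x₀).continuousAt.eventually_mem ((chartAt E (g x₀)).open_source.mem_nhds hgx₀)]
      with x hd hxs hgs v
    have e1 : (Φ ∘ ψ) =ᶠ[𝓝 x] (φ ∘ g) := by
      filter_upwards [(chartAt E' x₀).open_source.mem_nhds hxs] with y hy
      simp only [Function.comp, Φ]
      rw [ψ.left_inv (by simpa [ψ] using hy)]
    have e2 := mfderiv_comp_apply (I := 𝓘(ℝ, E')) (g := Φ) x hd.mdifferentiableAt
      (mdifferentiableAt_extChartAt hxs) v
    have e3 := mfderiv_comp_apply (I := 𝓘(ℝ, E')) (g := φ) x (mdifferentiableAt_extChartAt hgs)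
      ((hg x).mdifferentiableAt (by simp)) v
    rw [mfderiv_eq_fderiv] at e2
    have e4 := DFunLike.congr_fun (e1.mfderiv_eq (I := 𝓘(ℝ, E')) (I' := 𝓘(ℝ, E))) v
    exact e2.symm.trans (e4.trans e3)
  refine contMDiffAt_of_injective_clm hB ?_ (hY.congr_of_eventuallyEq
    (hchain.mono fun x hx => hx (Y x)))
  have hsurj : Function.Surjective (mvfderiv 𝓘(ℝ, E') ψ x₀) :=
    (isInvertible_mfderiv_extChartAt (I := 𝓘(ℝ, E')) (mem_extChartAt_source x₀)).surjective
  intro a b hab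
  obtain ⟨a, rfl⟩ := hsurj a
  obtain ⟨b, rfl⟩ := hsurj b
  rw [hchain.self_of_nhds, hchain.self_of_nhds] at hab
  rw [hinj (mvfderiv_extChartAt_injective hgx₀ hab)]

end VectorFields

/-! ### Forms induced on integral manifolds and their differentials -/

section InducedForms

variable {E : Type*} [NormedAddCommGroup E] [NormedSpace ℝ E]
  {M : Type u} [TopologicalSpace M] [ChartedSpace E M] [IsManifold 𝓘(ℝ, E) ∞ M]
  {F : Type*} [NormedAddCommGroup F] [NormedSpace ℝ F]
  {V : M → Type*} [TopologicalSpace (TotalSpace F V)]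
  [∀ x, AddCommGroup (V x)] [∀ x, Module ℝ (V x)] [∀ x, TopologicalSpace (V x)]
  [FiberBundle F V] [VectorBundle ℝ F V] [ContMDiffVectorBundle ∞ F V 𝓘(ℝ, E)]
  {A : LieAlgebroid E F V}

namespace IntegralManifold

variable (L : IntegralManifold A)

theorem anchor_surjective (x : L.carrier) : Function.Surjective (L.anchor x) := by
  intro v
  have h : mfderiv 𝓘(ℝ, L.Model) 𝓘(ℝ, E) L.ι x v ∈ LinearMap.range (A.anchor (L.ι x)) := by
    rw [← L.range_mfderiv]
    exact LinearMap.mem_range_self _ v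
  obtain ⟨a, ha⟩ := h
  refine ⟨a, L.immersion x ?_⟩
  rw [L.mfderiv_anchor, ha]

/-- Injectivity of `dι` gives this; it is what makes horizontality for `A` and for `A|_L` the same
condition at points of `L`. -/
theorem anchor_eq_zero_iff (x : L.carrier) (a : V (L.ι x)) :
    L.anchor x a = 0 ↔ A.anchor (L.ι x) a = 0 := by
  rw [← L.mfderiv_anchor]
  exact ((injective_iff_map_eq_zero' _).1 (L.immersion x) _).symm

theorem isInduced_zero (k : ℕ) : L.IsInduced (A := A) (0 : SmoothForm E F V k) 0 :=
  fun _ _ => rfl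

theorem isHorizontalFor_restrict {k : ℕ} {η : SmoothForm E F V k} (hη : η ∈ A.horizontalForms k) :
    LieAlgebroid.IsHorizontalFor L.anchor (L.restrict η) := fun x a i h =>
  hη (L.ι x) a i ((L.anchor_eq_zero_iff x (a i)).1 h)

/-- Every tangent vector of `L` is in the image of `L.anchor`, so all values are prescribed. -/
theorem IsInduced.unique {L : IntegralManifold A} {k : ℕ} {η : SmoothForm E F V k}
    {β γ : DiffForm L.Model L.carrier k} (hβ : L.IsInduced η β) (hγ : L.IsInduced η γ) :
    β = γ := by
  refine Subtype.ext (funext fun x => AlternatingMap.ext fun v => ?_)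
  choose a ha using fun i => L.anchor_surjective x (v i)
  obtain rfl : (fun i => L.anchor x (a i)) = v := funext ha
  rw [hβ x a, hγ x a]

variable [FiniteDimensional ℝ E]

/-- The vector field on `L` induced by a section of the algebroid. -/
def anchorSection (s : Cₛ^∞⟮𝓘(ℝ, E); F, V⟯) :
    Cₛ^∞⟮𝓘(ℝ, L.Model); L.Model, (fun x : L.carrier => TangentSpace 𝓘(ℝ, L.Model) x)⟯ where
  toFun x := L.anchor x (s (L.ι x))
  contMDiff_toFun := fun x₀ => by
    refine contMDiffAt_of_mfderiv_immersion L.ι.contMDiff (L.immersion x₀) ?_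
    simp only [L.mfderiv_anchor]
    exact ((contMDiffAt_section_tangent_iff (mem_chart_source E (L.ι x₀))).1
      (A.smooth_anchor_apply s _)).comp x₀ (L.ι.contMDiff x₀)

theorem anchorSection_apply (s : Cₛ^∞⟮𝓘(ℝ, E); F, V⟯) (x : L.carrier) :
    L.anchorSection s x = L.anchor x (s (L.ι x)) := rfl

theorem IsInduced.apply_anchorSection {L : IntegralManifold A} {k : ℕ} {η : SmoothForm E F V k}
    {β : DiffForm L.Model L.carrier k} (h : L.IsInduced η β)
    (ξ : Fin k → Cₛ^∞⟮𝓘(ℝ, E); F, V⟯) (x : L.carrier) :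
    β.1 x (fun i => L.anchorSection (ξ i) x) = η.1 (L.ι x) (fun i => ξ i (L.ι x)) :=
  h x _

theorem mvfderiv_anchorSection (s : Cₛ^∞⟮𝓘(ℝ, E); F, V⟯) {f : M → ℝ}
    (hf : ContMDiff 𝓘(ℝ, E) 𝓘(ℝ, ℝ) ∞ f) (x : L.carrier) :
    mvfderiv 𝓘(ℝ, L.Model) (fun y => f (L.ι y)) x (L.anchorSection s x) =
      mvfderiv 𝓘(ℝ, E) f (L.ι x) (A.anchor (L.ι x) (s (L.ι x))) := by
  rw [← L.mfderiv_anchor]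
  exact mvfderiv_comp_apply (I := 𝓘(ℝ, E)) (I' := 𝓘(ℝ, L.Model)) (f := L.ι) x ((hf _).mdifferentiableAt (by simp))
    ((L.ι.contMDiff x).mdifferentiableAt (by simp)) _

variable [T2Space M] [FiniteDimensional ℝ F]

/-- The vector fields induced by sections are related to their anchors, so that taking them
preserves brackets. -/
theorem anchorSection_bracket (s t : Cₛ^∞⟮𝓘(ℝ, E); F, V⟯) :
    L.anchorSection (A.bracket s t) =
      (tangentLieAlgebroid L.Model L.carrier).bracket (L.anchorSection s) (L.anchorSection t) := by
  ext x
  -- It suffices to compare images under `dι`, tested against functions `f` on `M`. Both brackets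
  -- act on `f ∘ ι` as the commutator of the same derivations.
  refine sub_eq_zero.1 (L.immersion x ?_)
  rw [map_zero]
  refine eq_zero_of_forall_mvfderiv_eq_zero fun f hf => ?_
  have hfι : ContMDiff 𝓘(ℝ, L.Model) 𝓘(ℝ, ℝ) ∞ (fun y => f (L.ι y)) := hf.comp L.ι.contMDiff
  have e0 : ∀ v : TangentSpace 𝓘(ℝ, L.Model) x, mvfderiv 𝓘(ℝ, E) f (L.ι x)
      (mfderiv 𝓘(ℝ, L.Model) 𝓘(ℝ, E) L.ι x v) =
      mvfderiv 𝓘(ℝ, L.Model) (fun y => f (L.ι y)) x v := fun v =>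
    (mvfderiv_comp_apply (I := 𝓘(ℝ, E)) (I' := 𝓘(ℝ, L.Model)) (f := L.ι) x ((hf _).mdifferentiableAt (by simp))
      ((L.ι.contMDiff x).mdifferentiableAt (by simp)) v).symm
  have e1 := (tangentLieAlgebroid L.Model L.carrier).anchor_bracket (L.anchorSection s)
    (L.anchorSection t) hfι x
  have e2 : ∀ a b : Cₛ^∞⟮𝓘(ℝ, E); F, V⟯,
      mvfderiv 𝓘(ℝ, L.Model) (fun y => mvfderiv 𝓘(ℝ, L.Model) (fun y => f (L.ι y)) y
        ((tangentLieAlgebroid L.Model L.carrier).anchor y (L.anchorSection a y))) x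
        ((tangentLieAlgebroid L.Model L.carrier).anchor x (L.anchorSection b x)) =
      mvfderiv 𝓘(ℝ, E) (fun y => mvfderiv 𝓘(ℝ, E) f y (A.anchor y (a y))) (L.ι x)
        (A.anchor (L.ι x) (b (L.ι x))) := by
    intro a b
    rw [← L.mvfderiv_anchorSection b (A.smooth_derivative a hf)]
    simp only [← L.mvfderiv_anchorSection a hf]
    rfl
  rw [map_sub, map_sub, e0, e0, L.mvfderiv_anchorSection _ hf, A.anchor_bracket s t hf, ← e2 t s,
    ← e2 s t, sub_eq_zero]
  exact e1.symm

theorem restrict_mem_smoothFormSubmodule {k : ℕ} (η : SmoothForm E F V k) :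
    L.restrict η ∈ smoothFormSubmodule L.Model F ((L.ι : L.carrier → M) *ᵖ V) k := by
  intro s x₀
  refine η.contMDiffAt_comp (L.ι.contMDiff x₀) fun i => ?_
  exact (contMDiffAt_section x₀).1 ((s i).contMDiff x₀)

/-- Horizontality lets `η` descend along the surjection `L.anchor x`. The pointwise linear lifts `σ
x` need not vary smoothly, since the value does not depend on the lift. -/
theorem exists_isInduced {k : ℕ} {η : SmoothForm E F V k} (hη : η ∈ A.horizontalForms k) :
    ∃ β : DiffForm L.Model L.carrier k, L.IsInduced η β := by
  choose σ hσ using fun x => (L.anchor x).exists_rightInverse_of_surjective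
    (LinearMap.range_eq_top.2 (L.anchor_surjective x))
  have hσ' : ∀ x v, L.anchor x (σ x v) = v := fun x v => LinearMap.congr_fun (hσ x) v
  let β : ∀ x : L.carrier, (TangentSpace 𝓘(ℝ, L.Model) x) [⋀^Fin k]→ₗ[ℝ] ℝ := fun x =>
    (η.1 (L.ι x)).compLinearMap (σ x)
  have hβ : ∀ x (a : Fin k → V (L.ι x)), β x (fun i => L.anchor x (a i)) = η.1 (L.ι x) a :=
    fun x a => AlternatingMap.eq_of_forall_map_eq _ (L.anchor x)
      (L.isHorizontalFor_restrict hη x) fun i => hσ' x _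
  refine ⟨⟨β, fun Y x₀ => ?_⟩, hβ⟩
  -- Lift a basis of `T_{x₀} L` to `A` and extend it to sections. The induced fields are a frame
  -- near `x₀`, and `β` takes smooth values on them.
  let b := (EuclideanSpace.basisFun (Fin L.dim) ℝ).toBasis
  choose v hv using fun j => L.anchor_surjective x₀ (b j)
  let e : Fin L.dim → Cₛ^∞⟮𝓘(ℝ, E); F, V⟯ := fun j => extendSection E F V (L.ι x₀) (v j)
  have he : ∀ j, L.anchorSection (e j) x₀ = b j := fun j => by
    rw [anchorSection_apply, extendSection_apply, hv]
  have hli : LinearIndependent ℝ fun j => L.anchorSection (e j) x₀ := by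
    simp only [he]
    exact b.linearIndependent
  choose c hc hY using fun i => exists_contMDiffAt_coeff ((Y i).contMDiff x₀)
    (fun j => (L.anchorSection (e j)).contMDiff x₀) hli finrank_euclideanSpace_fin
  refine contMDiffAt_alternatingMap_of_frame hc (fun J => ?_) hY
  simp only [anchorSection_apply, hβ]
  exact (η.2 (fun i => e (J i)) _).comp x₀ (L.ι.contMDiff x₀)

/-- Both sums match term by term: the values of `β` on induced fields are pullbacks of those of `η`,
the fields are `ι`-related to the anchors of the sections, and `anchorSection_bracket` handles the
brackets. -/
theorem IsInduced.koszul_eq {L : IntegralManifold A} {k : ℕ} {η : SmoothForm E F V k}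
    {β : DiffForm L.Model L.carrier k} (h : L.IsInduced η β)
    (ξ : Fin (k + 1) → Cₛ^∞⟮𝓘(ℝ, E); F, V⟯) (x : L.carrier) :
    (tangentLieAlgebroid L.Model L.carrier).koszul β.1 (fun i => L.anchorSection (ξ i)) x =
      A.koszul η.1 ξ (L.ι x) := by
  unfold LieAlgebroid.koszul
  congr 1
  · refine Finset.sum_congr rfl fun i _ => ?_
    congr 1
    rw [← L.mvfderiv_anchorSection (ξ i) (η.2 (i.removeNth ξ))]
    simp only [← h.apply_anchorSection]
    rfl
  · cases k with
    | zero => rfl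
    | succ n =>
      simp only [LieAlgebroid.koszulBracket]
      congr 1
      refine Finset.sum_congr rfl fun i _ => Finset.sum_congr rfl fun j _ => ?_
      congr 1
      rw [← L.anchorSection_bracket]
      have := h.apply_anchorSection (Matrix.vecCons (A.bracket (ξ i.castSucc) (ξ j.succ))
        (j.removeNth (i.castSucc.removeNth ξ))) x
      refine Eq.trans ?_ (this.trans ?_) <;> congr 1 <;> funext l <;>
        refine Fin.cases ?_ (fun l => ?_) l <;> rfl

/-- The form induced by `d_A η` is the de Rham differential of the form induced by `η`. -/
theorem IsInduced.d {L : IntegralManifold A} {k : ℕ} {η : SmoothForm E F V k}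
    {β : DiffForm L.Model L.carrier k} (h : L.IsInduced η β) :
    L.IsInduced (A.d k η) (deRhamD L.Model L.carrier k β) := by
  intro x a
  -- The differentials are tensorial, so the vectors `a i` may be extended to sections of `A`, and
  -- their images to the fields these induce.
  have h1 := (tangentLieAlgebroid L.Model L.carrier).d_apply β
    (fun i => L.anchorSection (extendSection E F V (L.ι x) (a i))) x
  rw [h.koszul_eq (fun i => extendSection E F V (L.ι x) (a i)), ← A.d_apply] at h1
  simp only [anchorSection_apply, extendSection_apply] at h1
  exact h1

/-- A form induced by a coboundary of the horizontal complex is exact. -/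
theorem IsInduced.exists_deRhamClass_eq_zero {L : IntegralManifold A} {k : ℕ}
    {η : ↥(A.cocycles A.horizontalComplex k)} {β : DiffForm L.Model L.carrier k}
    (h : L.IsInduced η.1 β) (hη : A.cohomologyClass A.horizontalComplex k η = 0) :
    ∃ hβ : β ∈ closedForms L.Model L.carrier k,
      deRhamClass L.Model L.carrier k ⟨β, hβ⟩ = 0 := by
  -- Both `dβ` and `0` are induced by `d_A η = 0`.
  have hclosed : deRhamD L.Model L.carrier k β = 0 := by
    have h1 := h.d
    rw [show A.d k η.1 = 0 from η.2.2] at h1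
    exact h1.unique (L.isInduced_zero _)
  refine ⟨⟨trivial, hclosed⟩, ?_⟩
  have hη' : η.1 ∈ A.coboundaries A.horizontalComplex k :=
    (Submodule.Quotient.mk_eq_zero ((A.coboundaries A.horizontalComplex k).submoduleOf
      (A.cocycles A.horizontalComplex k))).1 hη
  refine (Submodule.Quotient.mk_eq_zero _).2 ?_
  change β ∈ (tangentLieAlgebroid L.Model L.carrier).coboundaries (fun _ => ⊤) k
  cases k with
  | zero =>
    -- In degree `0` the coboundaries are `⊥`.
    have h0 : η.1 = 0 := hη'
    rw [h0] at h
    rw [h.unique (L.isInduced_zero _)]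
    exact Submodule.zero_mem _
  | succ k =>
    -- The primitive `ζ` is itself horizontal, so it induces a form `γ`, and `dγ` and `β` are both
    -- induced by `d_A ζ = η`.
    obtain ⟨ζ, hζ, hζη⟩ := hη'
    obtain ⟨γ, hγ⟩ := L.exists_isInduced hζ.1
    have h2 := hγ.d
    rw [hζη] at h2
    exact ⟨γ, trivial, h2.unique h⟩

end IntegralManifold

end InducedForms

/-! ### Plaques and the Frobenius theorem for the image of the anchor -/

section Plaques

variable {E : Type*} [NormedAddCommGroup E] [NormedSpace ℝ E]
  {M : Type*} [TopologicalSpace M] [ChartedSpace E M] [IsManifold 𝓘(ℝ, E) ∞ M]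
  {F : Type*} [NormedAddCommGroup F] [NormedSpace ℝ F]
  {V : M → Type*} [TopologicalSpace (TotalSpace F V)]
  [∀ x, AddCommGroup (V x)] [∀ x, Module ℝ (V x)] [∀ x, TopologicalSpace (V x)]
  [FiberBundle F V] [VectorBundle ℝ F V] [ContMDiffVectorBundle ∞ F V 𝓘(ℝ, E)]
  (A : LieAlgebroid E F V)

/-- An `r`-dimensional plaque of `A`: an integral manifold parametrised by an open set of
Euclidean space. -/
structure Plaque (r : ℕ) where
  toFun : EuclideanSpace ℝ (Fin r) → M
  source : Set (EuclideanSpace ℝ (Fin r))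
  isOpen_source : IsOpen source
  contMDiffOn : ContMDiffOn 𝓘(ℝ, EuclideanSpace ℝ (Fin r)) 𝓘(ℝ, E) ∞ toFun source
  injOn : Set.InjOn toFun source
  immersion : ∀ u ∈ source, Function.Injective
    (mfderiv 𝓘(ℝ, EuclideanSpace ℝ (Fin r)) 𝓘(ℝ, E) toFun u)
  range_mfderiv : ∀ u ∈ source, LinearMap.range
    (mfderiv 𝓘(ℝ, EuclideanSpace ℝ (Fin r)) 𝓘(ℝ, E) toFun u).toLinearMap =
      LinearMap.range (A.anchor (toFun u))

namespace LieAlgebroid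

/-- The image of the anchor, in the chart at `p`. -/
def coordDistribution (p : M) (q : E) : Submodule ℝ E :=
  (LinearMap.range (A.anchor ((extChartAt 𝓘(ℝ, E) p).symm q))).map
    (mvfderiv 𝓘(ℝ, E) (extChartAt 𝓘(ℝ, E) p) ((extChartAt 𝓘(ℝ, E) p).symm q)).toLinearMap

theorem coordField_mem_coordDistribution (p : M) (s : Cₛ^∞⟮𝓘(ℝ, E); F, V⟯) (q : E) :
    A.coordField p s q ∈ A.coordDistribution p q :=
  Submodule.mem_map_of_mem (LinearMap.mem_range_self _ _)

theorem mvfderiv_mem_coordDistribution_iff {p x : M} (hx : x ∈ (chartAt E p).source)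
    (v : TangentSpace 𝓘(ℝ, E) x) :
    mvfderiv 𝓘(ℝ, E) (extChartAt 𝓘(ℝ, E) p) x v ∈
      A.coordDistribution p (extChartAt 𝓘(ℝ, E) p x) ↔ v ∈ LinearMap.range (A.anchor x) := by
  unfold coordDistribution
  rw [(extChartAt 𝓘(ℝ, E) p).left_inv (by simpa using hx)]
  exact (mvfderiv_extChartAt_injective hx).mem_set_image

variable [FiniteDimensional ℝ E]

theorem finrank_coordDistribution_le (p : M) (q : E) :
    Module.finrank ℝ (A.coordDistribution p q) ≤
      Module.finrank ℝ (LinearMap.range (A.anchor ((extChartAt 𝓘(ℝ, E) p).symm q))) := by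
  have : FiniteDimensional ℝ (TangentSpace 𝓘(ℝ, E) ((extChartAt 𝓘(ℝ, E) p).symm q)) :=
    inferInstanceAs (FiniteDimensional ℝ E)
  exact Submodule.finrank_map_le _ _

variable [T2Space M] [FiniteDimensional ℝ F]

/-- Normal form of the image of the anchor near a point. -/
theorem exists_normalForm_anchor {p : M} {r : ℕ}
    (hr : Module.finrank ℝ (LinearMap.range (A.anchor p)) = r) :
    ∃ (pr : E →L[ℝ] EuclideanSpace ℝ (Fin r)) (Λ : E → EuclideanSpace ℝ (Fin r) →L[ℝ] E),
      (∀ᶠ q in 𝓝 (extChartAt 𝓘(ℝ, E) p p), ContDiffAt ℝ ∞ Λ q ∧ (∀ w, pr (Λ q w) = w) ∧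
        ∀ w, Λ q w ∈ A.coordDistribution p q) ∧
      ((∀ᶠ x in 𝓝 p, Module.finrank ℝ (LinearMap.range (A.anchor x)) ≤ r) →
        ∀ᶠ q in 𝓝 (extChartAt 𝓘(ℝ, E) p p), ∀ w h,
          fderiv ℝ Λ q (Λ q w) h = fderiv ℝ Λ q (Λ q h) w) := by
  have hfd : FiniteDimensional ℝ (TangentSpace 𝓘(ℝ, E) p) :=
    inferInstanceAs (FiniteDimensional ℝ E)
  -- A basis of `ρ(A_p)`, lifted to `A_p` and extended to global sections, gives the fields that
  -- span the distribution at `p`.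
  let b := Module.finBasisOfFinrankEq ℝ (LinearMap.range (A.anchor p)) hr
  choose v hv using fun j => (b j).2
  let e : Fin r → Cₛ^∞⟮𝓘(ℝ, E); F, V⟯ := fun j => extendSection E F V p (v j)
  have htarget : ∀ᶠ q in 𝓝 (extChartAt 𝓘(ℝ, E) p p), q ∈ (extChartAt 𝓘(ℝ, E) p).target :=
    (isOpen_extChartAt_target p).mem_nhds (mem_extChartAt_target p)
  have hX0 : ∀ j, A.coordField p (e j) (extChartAt 𝓘(ℝ, E) p p) =
      mvfderiv 𝓘(ℝ, E) (extChartAt 𝓘(ℝ, E) p) p (b j : TangentSpace 𝓘(ℝ, E) p) := by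
    intro j
    rw [A.coordField_extChartAt (mem_chart_source E p), extendSection_apply, hv]
  have hli : LinearIndependent ℝ fun j => A.coordField p (e j) (extChartAt 𝓘(ℝ, E) p p) := by
    simp only [hX0]
    have h1 : LinearIndependent ℝ fun j => (b j : TangentSpace 𝓘(ℝ, E) p) :=
      b.linearIndependent.map' (Submodule.subtype _) (Submodule.ker_subtype _)
    exact h1.map' (mvfderiv 𝓘(ℝ, E) (extChartAt 𝓘(ℝ, E) p) p).toLinearMap
      (LinearMap.ker_eq_bot.2 (mvfderiv_extChartAt_injective (mem_chart_source E p)))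
  obtain ⟨pr, Λ, h1, h2⟩ := exists_normalForm (D := A.coordDistribution p)
    (X := fun j => A.coordField p (e j)) (htarget.mono fun q hq j =>
      ⟨A.contDiffAt_coordField (e j) hq, A.coordField_mem_coordDistribution p (e j) q⟩) hli
  refine ⟨pr, Λ, h1, fun hrank => h2 ?_ ?_⟩
  · have hc : Filter.Tendsto (extChartAt 𝓘(ℝ, E) p).symm (𝓝 (extChartAt 𝓘(ℝ, E) p p)) (𝓝 p) := by
      have := continuousAt_extChartAt_symm (I := 𝓘(ℝ, E)) p
      rwa [ContinuousAt, extChartAt_to_inv] at this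
    filter_upwards [hc.eventually hrank] with q hq
    exact (A.finrank_coordDistribution_le p q).trans hq
  · filter_upwards [htarget] with q hq i j
    -- Involutivity: the bracket of two coordinate fields is the coordinate field of a section.
    rw [← A.coordField_bracket _ _ hq]
    exact A.coordField_mem_coordDistribution _ _ _

/-- The Frobenius theorem: there is a plaque through any point near which the rank of the anchor
is maximal. -/
theorem exists_plaque {p : M} {r : ℕ}
    (hr : Module.finrank ℝ (LinearMap.range (A.anchor p)) = r)
    (hmax : ∀ᶠ x in 𝓝 p, Module.finrank ℝ (LinearMap.range (A.anchor x)) ≤ r) :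
    ∃ P : Plaque A r, p ∈ P.toFun '' P.source := by
  obtain ⟨pr, Λ, h1, h2⟩ := A.exists_normalForm_anchor hr
  let φ := extChartAt 𝓘(ℝ, E) p
  have hc : Filter.Tendsto φ.symm (𝓝 (φ p)) (𝓝 p) := by
    have := continuousAt_extChartAt_symm (I := 𝓘(ℝ, E)) p
    rwa [ContinuousAt, extChartAt_to_inv] at this
  have htarget : ∀ᶠ q in 𝓝 (φ p), q ∈ φ.target :=
    (isOpen_extChartAt_target p).mem_nhds (mem_extChartAt_target p)
  -- The neighbourhood in which `f` stays also records the rank bound, needed at every point of the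
  -- plaque.
  obtain ⟨f, δ, hδ, hf0, hfs, hf⟩ := exists_hasFDerivAt_of_symmetric (h1.mono fun q hq => hq.1)
    (h2 hmax) (htarget.and (h1.and (hc.eventually hmax)))
  have hsrc : ∀ w ∈ Metric.ball (0 : EuclideanSpace ℝ (Fin r)) δ,
      φ.symm (f w) ∈ (chartAt E p).source := fun w hw => by
    simpa [φ] using φ.map_target (hf w hw).1.1
  -- `pr ∘ f - id` has derivative `pr ∘ Λ - id = 0` on the ball, so it is constant there and `f` is
  -- injective.
  have hinj : Set.InjOn f (Metric.ball 0 δ) := by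
    have hg : ∀ w ∈ Metric.ball (0 : EuclideanSpace ℝ (Fin r)) δ,
        HasFDerivWithinAt (fun w => pr (f w) - w)
          (0 : EuclideanSpace ℝ (Fin r) →L[ℝ] EuclideanSpace ℝ (Fin r)) (Metric.ball 0 δ) w := by
      intro w hw
      have h3 := (pr.hasFDerivAt.comp w (hf w hw).2).sub (hasFDerivAt_id w)
      have h4 : pr ∘L Λ (f w) - ContinuousLinearMap.id ℝ (EuclideanSpace ℝ (Fin r)) = 0 := by
        rw [sub_eq_zero]
        ext1 b
        exact (hf w hw).1.2.1.2.1 b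
      rw [h4] at h3
      exact h3.hasFDerivWithinAt
    intro a ha b hb hab
    have h5 := (convex_ball (0 : EuclideanSpace ℝ (Fin r)) δ).is_const_of_fderivWithin_eq_zero
      (𝕜 := ℝ) (fun w hw => (hg w hw).differentiableWithinAt)
      (fun w hw => (hg w hw).fderivWithin (Metric.isOpen_ball.uniqueDiffWithinAt hw)) ha hb
    simpa [hab] using h5
  have hcd : ContMDiffOn 𝓘(ℝ, EuclideanSpace ℝ (Fin r)) 𝓘(ℝ, E) ∞ (fun w => φ.symm (f w))
      (Metric.ball 0 δ) :=
    (contMDiffOn_extChartAt_symm p).comp hfs.contMDiffOn fun w hw => (hf w hw).1.1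
  have hd : ∀ w ∈ Metric.ball (0 : EuclideanSpace ℝ (Fin r)) δ, ∀ b,
      mvfderiv 𝓘(ℝ, E) φ (φ.symm (f w))
        (mfderiv 𝓘(ℝ, EuclideanSpace ℝ (Fin r)) 𝓘(ℝ, E) (fun w => φ.symm (f w)) w b) =
      Λ (f w) b := by
    intro w hw b
    have e3 := mfderiv_comp_apply (I := 𝓘(ℝ, EuclideanSpace ℝ (Fin r))) (g := φ) w
      (mdifferentiableAt_extChartAt (hsrc w hw))
      (((hcd w hw).contMDiffAt (Metric.isOpen_ball.mem_nhds hw)).mdifferentiableAt (by simp)) b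
    have e1 : (φ ∘ fun w => φ.symm (f w)) =ᶠ[𝓝 w] f := by
      filter_upwards [Metric.isOpen_ball.mem_nhds hw] with y hy
      exact φ.right_inv (hf y hy).1.1
    have e4 := DFunLike.congr_fun
      (e1.mfderiv_eq (I := 𝓘(ℝ, EuclideanSpace ℝ (Fin r))) (I' := 𝓘(ℝ, E))) b
    have e5 : mfderiv 𝓘(ℝ, EuclideanSpace ℝ (Fin r)) 𝓘(ℝ, E) f w = Λ (f w) := by
      rw [mfderiv_eq_fderiv]
      exact (hf w hw).2.fderiv
    rw [e5] at e4
    exact e3.symm.trans e4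
  have himm : ∀ w ∈ Metric.ball (0 : EuclideanSpace ℝ (Fin r)) δ, Function.Injective
      (mfderiv 𝓘(ℝ, EuclideanSpace ℝ (Fin r)) 𝓘(ℝ, E) (fun w => φ.symm (f w)) w) := by
    intro w hw a b hab
    have h3 := hd w hw a
    rw [hab, hd w hw b] at h3
    rw [← (hf w hw).1.2.1.2.1 a, ← h3, (hf w hw).1.2.1.2.1 b]
  refine ⟨⟨fun w => φ.symm (f w), Metric.ball 0 δ, Metric.isOpen_ball, hcd, ?_, himm, ?_⟩, 0,
    Metric.mem_ball_self hδ, ?_⟩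
  · intro a ha b hb hab
    exact hinj ha hb (φ.symm.injOn (hf a ha).1.1 (hf b hb).1.1 hab)
  · intro w hw
    have : FiniteDimensional ℝ (TangentSpace 𝓘(ℝ, E) (φ.symm (f w))) :=
      inferInstanceAs (FiniteDimensional ℝ E)
    -- The tangent image lies in the image of the anchor and has dimension `r`, which is the maximal
    -- rank nearby.
    refine Submodule.eq_of_le_of_finrank_le ?_ ?_
    · rintro _ ⟨b, rfl⟩
      rw [← A.mvfderiv_mem_coordDistribution_iff (hsrc w hw), φ.right_inv (hf w hw).1.1]
      have h3 := (hf w hw).1.2.1.2.2 b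
      rw [← hd w hw b] at h3
      exact h3
    · rw [LinearMap.finrank_range_of_inj (himm w hw)]
      exact (hf w hw).1.2.2.trans finrank_euclideanSpace_fin.ge
  · change φ.symm (f 0) = p
    rw [hf0]
    exact extChartAt_to_inv p

end LieAlgebroid

end Plaques

/-! ### Comparison of two plaques through a point -/

section PlaqueTransition

variable {E : Type*} [NormedAddCommGroup E] [NormedSpace ℝ E]
  {M : Type*} [TopologicalSpace M] [ChartedSpace E M] [IsManifold 𝓘(ℝ, E) ∞ M]
  {F : Type*} [NormedAddCommGroup F] [NormedSpace ℝ F]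
  {V : M → Type*} [TopologicalSpace (TotalSpace F V)]
  [∀ x, AddCommGroup (V x)] [∀ x, Module ℝ (V x)] [∀ x, TopologicalSpace (V x)]
  [FiberBundle F V] [VectorBundle ℝ F V] [ContMDiffVectorBundle ∞ F V 𝓘(ℝ, E)]
  {A : LieAlgebroid E F V} {r : ℕ}

namespace Plaque

theorem contMDiffAt (P : Plaque A r) {u : EuclideanSpace ℝ (Fin r)} (hu : u ∈ P.source) :
    ContMDiffAt 𝓘(ℝ, EuclideanSpace ℝ (Fin r)) 𝓘(ℝ, E) ∞ P.toFun u :=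
  (P.contMDiffOn u hu).contMDiffAt (P.isOpen_source.mem_nhds hu)

/-- The rank is constant along a plaque, even if it jumps at nearby points of `M`. Hence plaques can
be compared without a rank condition on a neighbourhood. -/
theorem finrank_range_anchor (P : Plaque A r) {u : EuclideanSpace ℝ (Fin r)} (hu : u ∈ P.source) :
    Module.finrank ℝ (LinearMap.range (A.anchor (P.toFun u))) = r := by
  rw [← P.range_mfderiv u hu, LinearMap.finrank_range_of_inj (P.immersion u hu)]
  exact finrank_euclideanSpace_fin

/-- In the chart at `p`, the derivative of a plaque is an injective map to the image of the
anchor. -/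
theorem coord_hasFDerivAt (P : Plaque A r) {p : M} {u : EuclideanSpace ℝ (Fin r)}
    (hu : u ∈ P.source) (hp : P.toFun u ∈ (chartAt E p).source) :
    ContDiffAt ℝ ∞ (fun u => extChartAt 𝓘(ℝ, E) p (P.toFun u)) u ∧
    Function.Injective (fderiv ℝ (fun u => extChartAt 𝓘(ℝ, E) p (P.toFun u)) u) ∧
    ∀ w, fderiv ℝ (fun u => extChartAt 𝓘(ℝ, E) p (P.toFun u)) u w ∈
      A.coordDistribution p (extChartAt 𝓘(ℝ, E) p (P.toFun u)) := by
  have hs := P.contMDiffAt hu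
  have e : ∀ w : EuclideanSpace ℝ (Fin r), mvfderiv 𝓘(ℝ, E) (extChartAt 𝓘(ℝ, E) p) (P.toFun u)
      (mfderiv 𝓘(ℝ, EuclideanSpace ℝ (Fin r)) 𝓘(ℝ, E) P.toFun u w) =
      fderiv ℝ (fun u => extChartAt 𝓘(ℝ, E) p (P.toFun u)) u w := by
    intro w
    have e3 := mfderiv_comp_apply (I := 𝓘(ℝ, EuclideanSpace ℝ (Fin r)))
      (g := extChartAt 𝓘(ℝ, E) p) u (mdifferentiableAt_extChartAt hp)
      (hs.mdifferentiableAt (by simp)) w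
    rw [← mfderiv_eq_fderiv]
    exact e3.symm
  refine ⟨((contMDiffAt_extChartAt' hp).comp u hs).contDiffAt, fun a b hab => ?_, fun w => ?_⟩
  · rw [← e, ← e] at hab
    exact P.immersion u hu (mvfderiv_extChartAt_injective hp hab)
  · rw [← e, A.mvfderiv_mem_coordDistribution_iff hp, ← P.range_mfderiv u hu]
    exact LinearMap.mem_range_self _ w

variable [FiniteDimensional ℝ E]

/-- A plaque through `p`, reparametrised by the projection `pr`, solves the total differential
equation given by the normal form of the anchor. -/
theorem exists_normalized (P : Plaque A r) {u₀ : EuclideanSpace ℝ (Fin r)} (hu₀ : u₀ ∈ P.source)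
    {p : M} (hp : P.toFun u₀ = p) {pr : E →L[ℝ] EuclideanSpace ℝ (Fin r)}
    {Λ : E → EuclideanSpace ℝ (Fin r) →L[ℝ] E}
    (hΛ : ∀ᶠ q in 𝓝 (extChartAt 𝓘(ℝ, E) p p), (∀ w, pr (Λ q w) = w) ∧
        ∀ w, Λ q w ∈ A.coordDistribution p q) :
    ∃ σ : EuclideanSpace ℝ (Fin r) → EuclideanSpace ℝ (Fin r),
      σ (pr (extChartAt 𝓘(ℝ, E) p p)) = u₀ ∧
      ContDiffAt ℝ ∞ σ (pr (extChartAt 𝓘(ℝ, E) p p)) ∧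
      (∀ᶠ y in 𝓝 (pr (extChartAt 𝓘(ℝ, E) p p)),
        HasFDerivAt (fun y => extChartAt 𝓘(ℝ, E) p (P.toFun (σ y)))
          (Λ (extChartAt 𝓘(ℝ, E) p (P.toFun (σ y)))) y) ∧
      ∀ᶠ u in 𝓝 u₀, σ (pr (extChartAt 𝓘(ℝ, E) p (P.toFun u))) = u := by
  subst hp
  set p := P.toFun u₀ with hpdef
  let φ := extChartAt 𝓘(ℝ, E) p
  let f : EuclideanSpace ℝ (Fin r) → E := fun u => φ (P.toFun u)
  have hf0 : f u₀ = φ p := rfl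
  have hsrc : ∀ᶠ u in 𝓝 u₀, u ∈ P.source ∧ P.toFun u ∈ (chartAt E p).source :=
    Filter.Eventually.and (P.isOpen_source.mem_nhds hu₀)
      ((P.contMDiffAt hu₀).continuousAt.eventually_mem
        ((chartAt E p).open_source.mem_nhds (mem_chart_source E p)))
  have hf : ∀ᶠ u in 𝓝 u₀, ContDiffAt ℝ ∞ f u ∧ Function.Injective (fderiv ℝ f u) ∧
      ∀ w, fderiv ℝ f u w ∈ A.coordDistribution p (f u) :=
    hsrc.mono fun u hu => P.coord_hasFDerivAt hu.1 hu.2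
  have hfc : ContinuousAt f u₀ := hf.self_of_nhds.1.continuousAt
  -- At points of the plaque the distribution has rank at most `r`, so the `r`-dimensional image of
  -- `Λ` fills it.
  have hrange : ∀ᶠ u in 𝓝 u₀, (∀ w, pr (Λ (f u) w) = w) ∧
      LinearMap.range (Λ (f u)).toLinearMap = A.coordDistribution p (f u) := by
    filter_upwards [hsrc, hfc.eventually hΛ] with u hu hq
    refine ⟨hq.1, Submodule.eq_of_le_of_finrank_le ?_ ?_⟩
    · rintro _ ⟨w, rfl⟩
      exact hq.2 w
    · have hinj : Function.Injective (Λ (f u)).toLinearMap := fun a b hab => by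
        have hab' : Λ (f u) a = Λ (f u) b := hab
        rw [← hq.1 a, hab', hq.1 b]
      rw [LinearMap.finrank_range_of_inj hinj]
      refine (A.finrank_coordDistribution_le p (f u)).trans ?_
      rw [φ.left_inv (by simpa [φ] using hu.2), P.finrank_range_anchor hu.1]
      exact finrank_euclideanSpace_fin.ge
  have hh : ContDiffAt ℝ ∞ (fun u => pr (f u)) u₀ := pr.contDiff.contDiffAt.comp u₀ hf.self_of_nhds.1
  have hdh : HasFDerivAt (fun u => pr (f u)) (pr ∘L fderiv ℝ f u₀) u₀ :=
    pr.hasFDerivAt.comp u₀ (hf.self_of_nhds.1.differentiableAt (by simp)).hasFDerivAt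
  -- `pr` is injective on the image of `Λ`, where the derivative of `f` takes its values. So `pr ∘
  -- f` is a local diffeomorphism, and `σ` is its local inverse.
  have hinj : Function.Injective (pr ∘L fderiv ℝ f u₀) := by
    intro a b hab
    have h1 := hf.self_of_nhds.2.2 a
    have h2 := hf.self_of_nhds.2.2 b
    rw [← hrange.self_of_nhds.2] at h1 h2
    obtain ⟨a', ha'⟩ := h1
    obtain ⟨b', hb'⟩ := h2
    have ha'' : Λ (f u₀) a' = fderiv ℝ f u₀ a := ha'
    have hb'' : Λ (f u₀) b' = fderiv ℝ f u₀ b := hb'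
    refine hf.self_of_nhds.2.1 ?_
    have hab' : pr (fderiv ℝ f u₀ a) = pr (fderiv ℝ f u₀ b) := hab
    rw [← ha'', ← hb'', hrange.self_of_nhds.1, hrange.self_of_nhds.1] at hab'
    rw [← ha'', ← hb'', hab']
  let e : EuclideanSpace ℝ (Fin r) ≃L[ℝ] EuclideanSpace ℝ (Fin r) :=
    (LinearEquiv.ofInjectiveEndo (pr ∘L fderiv ℝ f u₀).toLinearMap hinj).toContinuousLinearEquiv
  have hdh' : HasFDerivAt (fun u => pr (f u))
      (e : EuclideanSpace ℝ (Fin r) →L[ℝ] EuclideanSpace ℝ (Fin r)) u₀ := by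
    have he : (e : EuclideanSpace ℝ (Fin r) →L[ℝ] EuclideanSpace ℝ (Fin r)) =
        pr ∘L fderiv ℝ f u₀ := by
      ext1 w
      rfl
    rw [he]
    exact hdh
  have hstrict := hh.hasStrictFDerivAt' hdh' (by simp)
  let σ := hh.localInverse hdh' (by simp)
  have hσ0 : σ (pr (φ p)) = u₀ := hh.localInverse_apply_image hdh' (by simp)
  have hσ : ContDiffAt ℝ ∞ σ (pr (φ p)) := hh.to_localInverse hdh' (by simp)
  refine ⟨σ, hσ0, hσ, ?_, hstrict.eventually_left_inverse⟩
  have hσt : Filter.Tendsto σ (𝓝 (pr (φ p))) (𝓝 u₀) := hstrict.localInverse_tendsto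
  have hσd : ∀ᶠ y in 𝓝 (pr (φ p)), ContDiffAt ℝ 1 σ y :=
    (hσ.of_le (by simp) : ContDiffAt ℝ 1 σ (pr (φ p))).eventually (by simp)
  have hright : ∀ᶠ y in 𝓝 (pr (φ p)), pr (f (σ y)) = y := hstrict.eventually_right_inverse
  filter_upwards [hσd, hright.eventually_nhds, hσt.eventually hf, hσt.eventually hrange]
    with y hd hr hfy hry
  have hT := (hfy.1.differentiableAt (by simp)).hasFDerivAt.comp y
    (hd.differentiableAt (by simp)).hasFDerivAt
  -- The derivative of `f ∘ σ` has values in the image of `Λ` and is a section of `pr`; only `Λ` has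
  -- both properties.
  have hprT : ∀ w, pr ((fderiv ℝ f (σ y) ∘L fderiv ℝ σ y) w) = w := by
    have h1 : HasFDerivAt (fun y => pr (f (σ y)))
        (pr ∘L (fderiv ℝ f (σ y) ∘L fderiv ℝ σ y)) y := pr.hasFDerivAt.comp y hT
    have h2 : HasFDerivAt (fun y => pr (f (σ y)))
        (ContinuousLinearMap.id ℝ (EuclideanSpace ℝ (Fin r))) y :=
      (hasFDerivAt_id y).congr_of_eventuallyEq hr
    exact DFunLike.congr_fun (h1.unique h2)
  have hTΛ : fderiv ℝ f (σ y) ∘L fderiv ℝ σ y = Λ (f (σ y)) := by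
    ext1 w
    have h1 := hfy.2.2 (fderiv ℝ σ y w)
    rw [← hry.2] at h1
    obtain ⟨b, hb⟩ := h1
    have hb' : Λ (f (σ y)) b = (fderiv ℝ f (σ y) ∘L fderiv ℝ σ y) w := hb
    have h2 := hprT w
    rw [← hb', hry.1] at h2
    rw [← hb', h2]
  rw [hTΛ] at hT
  exact hT

variable [T2Space M] [FiniteDimensional ℝ F]

/-- Two plaques of the same dimension through a point differ by a smooth reparametrisation. -/
theorem exists_transition (P Q : Plaque A r) {u₀ v₀ : EuclideanSpace ℝ (Fin r)}
    (hu₀ : u₀ ∈ P.source) (hv₀ : v₀ ∈ Q.source) (h : P.toFun u₀ = Q.toFun v₀) :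
    ∃ τ : EuclideanSpace ℝ (Fin r) → EuclideanSpace ℝ (Fin r), τ v₀ = u₀ ∧
      ContDiffAt ℝ ∞ τ v₀ ∧ ∀ᶠ v in 𝓝 v₀, P.toFun (τ v) = Q.toFun v := by
  obtain ⟨p, hp⟩ : ∃ p, Q.toFun v₀ = p := ⟨_, rfl⟩
  rw [hp] at h
  let φ := extChartAt 𝓘(ℝ, E) p
  -- Only uniqueness of solutions is needed, so the integrability half of the normal form is
  -- dropped.
  obtain ⟨pr, Λ, hΛ, -⟩ := A.exists_normalForm_anchor (p := p) (r := r)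
    (by rw [← hp, Q.finrank_range_anchor hv₀])
  obtain ⟨σ, hσ0, hσ, hPσ, -⟩ := P.exists_normalized hu₀ h (hΛ.mono fun q hq => hq.2)
  obtain ⟨σ', hσ'0, -, hQσ, hinv⟩ := Q.exists_normalized hv₀ hp (hΛ.mono fun q hq => hq.2)
  have hsrc : ∀ᶠ v in 𝓝 v₀, Q.toFun v ∈ (chartAt E p).source :=
    (Q.contMDiffAt hv₀).continuousAt.eventually_mem
      ((chartAt E p).open_source.mem_nhds (hp ▸ mem_chart_source E _))
  have hQ : ContDiffAt ℝ ∞ (fun v => φ (Q.toFun v)) v₀ :=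
    (Q.coord_hasFDerivAt hv₀ hsrc.self_of_nhds).1
  have hh : ContDiffAt ℝ ∞ (fun v => pr (φ (Q.toFun v))) v₀ :=
    pr.contDiff.contDiffAt.comp v₀ hQ
  have hh0 : pr (φ (Q.toFun v₀)) = pr (φ p) := by rw [hp]
  have hτ0 : σ (pr (φ (Q.toFun v₀))) = u₀ := by rw [hh0, hσ0]
  have hτ : ContDiffAt ℝ ∞ (fun v => σ (pr (φ (Q.toFun v)))) v₀ := by
    refine ContDiffAt.comp (g := σ) v₀ ?_ hh
    rw [hh0]
    exact hσ
  -- Parametrised by `pr`, both plaques solve `Df = Λ ∘ f` with value `φ p` at `pr (φ p)`. Thus `τ`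
  -- sends `v` to the parameter of `P` whose `pr`-coordinate is that of `Q.toFun v`.
  have heq := eventuallyEq_of_hasFDerivAt_comp (by
      rw [hσ0, h]
      exact (hΛ.self_of_nhds.1.of_le (by simp) : ContDiffAt ℝ 1 Λ (φ p))) hPσ hQσ
    (by rw [hσ0, hσ'0, h, hp])
  refine ⟨fun v => σ (pr (φ (Q.toFun v))), hτ0, hτ, ?_⟩
  have hPc : ContinuousAt (fun v => P.toFun (σ (pr (φ (Q.toFun v))))) v₀ := by
    refine ContinuousAt.comp (g := P.toFun) ?_ hτ.continuousAt
    rw [hτ0]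
    exact (P.contMDiffAt hu₀).continuousAt
  have hsrc' : ∀ᶠ v in 𝓝 v₀, P.toFun (σ (pr (φ (Q.toFun v)))) ∈ (chartAt E p).source := by
    refine hPc.eventually_mem ((chartAt E p).open_source.mem_nhds ?_)
    rw [hτ0, h]
    exact mem_chart_source E p
  have htend : Filter.Tendsto (fun v => pr (φ (Q.toFun v))) (𝓝 v₀) (𝓝 (pr (φ p))) := by
    rw [← hh0]
    exact hh.continuousAt
  -- Equality holds in the chart; both points must lie in its source to deduce equality in `M`.
  filter_upwards [hsrc, hsrc', htend.eventually heq, hinv] with v h1 h2 h3 h4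
  refine φ.injOn (by simpa [φ] using h2) (by simpa [φ] using h1) ?_
  rw [h3, h4]

end Plaque

end PlaqueTransition

/-! ### The plaque space and its smooth structure -/

section PlaqueSpaces

variable {E : Type*} [NormedAddCommGroup E] [NormedSpace ℝ E]
  {M : Type u} [TopologicalSpace M] [ChartedSpace E M] [IsManifold 𝓘(ℝ, E) ∞ M]
  {F : Type*} [NormedAddCommGroup F] [NormedSpace ℝ F]
  {V : M → Type*} [TopologicalSpace (TotalSpace F V)]
  [∀ x, AddCommGroup (V x)] [∀ x, Module ℝ (V x)] [∀ x, TopologicalSpace (V x)]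
  [FiberBundle F V] [VectorBundle ℝ F V] [ContMDiffVectorBundle ∞ F V 𝓘(ℝ, E)]

/-- The set of points that lie on an `r`-dimensional plaque. It will be equipped with the leaf
topology, which is in general finer than the subspace topology. -/
@[ext]
structure PlaqueSpace (A : LieAlgebroid E F V) (r : ℕ) : Type u where
  val : M
  exists_mem_image : ∃ P : Plaque A r, val ∈ P.toFun '' P.source

variable {A : LieAlgebroid E F V} {r : ℕ}

/-- Consequently a point of `M` determines the `r` for which it can lie in a plaque space; this
matches dimensions in the maximality of leaves. -/
theorem PlaqueSpace.finrank_range_anchor (z : PlaqueSpace A r) :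
    Module.finrank ℝ (LinearMap.range (A.anchor z.val)) = r := by
  obtain ⟨P, u, hu, h⟩ := z.exists_mem_image
  rw [← h, P.finrank_range_anchor hu]

namespace Plaque

open Classical in
/-- The chart of the plaque space given by a plaque. -/
def chart (P : Plaque A r) (z₀ : PlaqueSpace A r) :
    PartialEquiv (PlaqueSpace A r) (EuclideanSpace ℝ (Fin r)) where
  toFun z := Function.invFunOn P.toFun P.source z.val
  -- `z₀` is only a default value off `P.source`.
  invFun u := if h : u ∈ P.source then ⟨P.toFun u, P, u, h, rfl⟩ else z₀
  source := {z | z.val ∈ P.toFun '' P.source}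
  target := P.source
  map_source' z hz := Function.invFunOn_mem hz
  map_target' u hu := by
    rw [dif_pos hu]
    exact ⟨u, hu, rfl⟩
  left_inv' z hz := by
    rw [dif_pos (Function.invFunOn_mem hz)]
    exact PlaqueSpace.ext (Function.invFunOn_eq hz)
  right_inv' u hu := by
    rw [dif_pos hu]
    exact P.injOn.leftInvOn_invFunOn hu

theorem chart_symm_val (P : Plaque A r) (z₀ : PlaqueSpace A r) {u : EuclideanSpace ℝ (Fin r)}
    (hu : u ∈ P.source) : ((P.chart z₀).symm u).val = P.toFun u :=
  congrArg PlaqueSpace.val (dif_pos hu)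

theorem toFun_chart (P : Plaque A r) (z₀ : PlaqueSpace A r) {z : PlaqueSpace A r}
    (hz : z ∈ (P.chart z₀).source) : P.toFun (P.chart z₀ z) = z.val :=
  Function.invFunOn_eq hz

variable [FiniteDimensional ℝ E] [T2Space M] [FiniteDimensional ℝ F]

/-- Plaques of equal dimension that share a point overlap in a whole neighbourhood of it, by
`Plaque.exists_transition`. This gives at once that chart overlaps are open and that chart changes
are continuous and smooth. -/
theorem exists_chart_transition (P Q : Plaque A r) (z₀ z₁ : PlaqueSpace A r)
    {u₀ : EuclideanSpace ℝ (Fin r)} (hu₀ : u₀ ∈ ((P.chart z₀).symm.trans (Q.chart z₁)).source) :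
    ∃ τ : EuclideanSpace ℝ (Fin r) → EuclideanSpace ℝ (Fin r), ContDiffAt ℝ ∞ τ u₀ ∧
      ∀ᶠ u in 𝓝 u₀, u ∈ ((P.chart z₀).symm.trans (Q.chart z₁)).source ∧
        (P.chart z₀).symm.trans (Q.chart z₁) u = τ u := by
  obtain ⟨hu : u₀ ∈ P.source, hQ⟩ := hu₀
  obtain ⟨v, hv, hvu⟩ : ((P.chart z₀).symm u₀).val ∈ Q.toFun '' Q.source := hQ
  rw [P.chart_symm_val z₀ hu] at hvu
  obtain ⟨τ, hτ0, hτ, hev⟩ := Q.exists_transition P hv hu hvu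
  refine ⟨τ, hτ, ?_⟩
  filter_upwards [hev, P.isOpen_source.mem_nhds hu,
    hτ.continuousAt.eventually_mem (Q.isOpen_source.mem_nhds (hτ0 ▸ hv))] with u h1 h2 h3
  have h4 : ((P.chart z₀).symm u).val = Q.toFun (τ u) := by rw [P.chart_symm_val z₀ h2, h1]
  refine ⟨⟨h2, ⟨τ u, h3, h4.symm⟩⟩, ?_⟩
  change Function.invFunOn Q.toFun Q.source ((P.chart z₀).symm u).val = τ u
  rw [h4]
  exact Q.injOn.leftInvOn_invFunOn h3

end Plaque

namespace PlaqueSpace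

variable [FiniteDimensional ℝ E] [T2Space M] [FiniteDimensional ℝ F]

variable (A r) in
/-- The atlas of the plaque space. -/
def core : ChartedSpaceCore (EuclideanSpace ℝ (Fin r)) (PlaqueSpace A r) where
  atlas := {e | ∃ (P : Plaque A r) (z : PlaqueSpace A r), e = P.chart z}
  chartAt z := z.exists_mem_image.choose.chart z
  mem_chart_source z := z.exists_mem_image.choose_spec
  chart_mem_atlas z := ⟨_, z, rfl⟩
  open_source := by
    rintro _ _ ⟨P, z, rfl⟩ ⟨Q, z', rfl⟩
    refine isOpen_iff_mem_nhds.2 fun u hu => ?_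
    obtain ⟨τ, -, h⟩ := P.exists_chart_transition Q z z' hu
    exact h.mono fun v hv => hv.1
  continuousOn_toFun := by
    rintro _ _ ⟨P, z, rfl⟩ ⟨Q, z', rfl⟩ u hu
    obtain ⟨τ, hτ, h⟩ := P.exists_chart_transition Q z z' hu
    exact (hτ.continuousAt.congr (h.mono fun v hv => hv.2.symm)).continuousWithinAt

instance : TopologicalSpace (PlaqueSpace A r) := (core A r).toTopologicalSpace

instance : ChartedSpace (EuclideanSpace ℝ (Fin r)) (PlaqueSpace A r) := (core A r).toChartedSpace

/-- The chart of a plaque as an open partial homeomorphism. -/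
def chartHomeomorph (P : Plaque A r) (z : PlaqueSpace A r) :
    OpenPartialHomeomorph (PlaqueSpace A r) (EuclideanSpace ℝ (Fin r)) :=
  (core A r).openPartialHomeomorph (P.chart z) ⟨P, z, rfl⟩

instance : IsManifold 𝓘(ℝ, EuclideanSpace ℝ (Fin r)) ∞ (PlaqueSpace A r) := by
  refine isManifold_of_contDiffOn _ _ _ ?_
  intro e e' he he'
  obtain ⟨_, ⟨_, rfl⟩, _, ⟨⟨P, z, rfl⟩, rfl⟩, rfl⟩ := he
  obtain ⟨_, ⟨_, rfl⟩, _, ⟨⟨Q, z', rfl⟩, rfl⟩, rfl⟩ := he'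
  rintro u ⟨hu, -⟩
  obtain ⟨τ, hτ, h⟩ := P.exists_chart_transition Q z z' hu
  exact (hτ.congr_of_eventuallyEq (h.mono fun v hv => hv.2)).contDiffWithinAt

/-- This puts the inclusion of the plaque space into `M` in the form required by
`Plaque.mfderiv_of_eventuallyEq`. -/
theorem eventually_eq_toFun_chartAt (z : PlaqueSpace A r) : ∃ P : Plaque A r,
    chartAt (EuclideanSpace ℝ (Fin r)) z z ∈ P.source ∧
      ∀ᶠ y in 𝓝 z, y.val = P.toFun (chartAt (EuclideanSpace ℝ (Fin r)) z y) := by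
  refine ⟨z.exists_mem_image.choose, (chartAt (EuclideanSpace ℝ (Fin r)) z).map_source (mem_chart_source _ z), ?_⟩
  filter_upwards [(chartAt (EuclideanSpace ℝ (Fin r)) z).open_source.mem_nhds
    (mem_chart_source _ z)] with y hy
  exact (z.exists_mem_image.choose.toFun_chart z hy).symm

end PlaqueSpace

/-- A map that is locally a plaque in charts is an immersion tangent to the anchor. -/
theorem Plaque.mfderiv_of_eventuallyEq {L : Type*} [TopologicalSpace L]
    [ChartedSpace (EuclideanSpace ℝ (Fin r)) L]
    [IsManifold 𝓘(ℝ, EuclideanSpace ℝ (Fin r)) ∞ L] {g : L → M} {x : L} (P : Plaque A r)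
    (hx : chartAt (EuclideanSpace ℝ (Fin r)) x x ∈ P.source)
    (hg : ∀ᶠ y in 𝓝 x, g y = P.toFun (chartAt (EuclideanSpace ℝ (Fin r)) x y)) :
    ContMDiffAt 𝓘(ℝ, EuclideanSpace ℝ (Fin r)) 𝓘(ℝ, E) ∞ g x ∧
    Function.Injective (mfderiv 𝓘(ℝ, EuclideanSpace ℝ (Fin r)) 𝓘(ℝ, E) g x) ∧
    LinearMap.range (mfderiv 𝓘(ℝ, EuclideanSpace ℝ (Fin r)) 𝓘(ℝ, E) g x).toLinearMap =
      LinearMap.range (A.anchor (g x)) := by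
  let φ := extChartAt 𝓘(ℝ, EuclideanSpace ℝ (Fin r)) x
  have hg' : g =ᶠ[𝓝 x] P.toFun ∘ φ := hg
  have hP := P.contMDiffAt hx
  have hφ : ContMDiffAt 𝓘(ℝ, EuclideanSpace ℝ (Fin r)) 𝓘(ℝ, EuclideanSpace ℝ (Fin r)) ∞ φ x :=
    contMDiffAt_extChartAt
  have hinv := isInvertible_mfderiv_extChartAt (I := 𝓘(ℝ, EuclideanSpace ℝ (Fin r)))
    (mem_extChartAt_source (I := 𝓘(ℝ, EuclideanSpace ℝ (Fin r))) x)
  have hd : ∀ v, mfderiv 𝓘(ℝ, EuclideanSpace ℝ (Fin r)) 𝓘(ℝ, E) g x v =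
      mfderiv 𝓘(ℝ, EuclideanSpace ℝ (Fin r)) 𝓘(ℝ, E) P.toFun (φ x)
        (mfderiv 𝓘(ℝ, EuclideanSpace ℝ (Fin r)) 𝓘(ℝ, EuclideanSpace ℝ (Fin r)) φ x v) := by
    intro v
    have h1 := DFunLike.congr_fun (hg'.mfderiv_eq (I := 𝓘(ℝ, EuclideanSpace ℝ (Fin r)))
      (I' := 𝓘(ℝ, E))) v
    exact h1.trans (mfderiv_comp_apply x (hP.mdifferentiableAt (by simp))
      (hφ.mdifferentiableAt (by simp)) v)
  refine ⟨(ContMDiffAt.comp x hP hφ).congr_of_eventuallyEq hg', fun a b hab => ?_, ?_⟩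
  · rw [hd, hd] at hab
    exact hinv.injective (P.immersion _ hx hab)
  · have hgx : g x = P.toFun (φ x) := hg.self_of_nhds
    rw [hgx]
    refine Eq.trans ?_ (P.range_mfderiv _ hx)
    ext w
    constructor
    · rintro ⟨v, rfl⟩
      exact ⟨_, (hd v).symm⟩
    · rintro ⟨v, rfl⟩
      obtain ⟨v', rfl⟩ := hinv.surjective v
      exact ⟨v', hd v'⟩

namespace IntegralManifold

/-- The inverse chart has invertible derivative, so composing with it preserves both injectivity and
the image of the derivative of `ι`. -/
theorem exists_mfderiv_comp_extChartAt_symm (N : IntegralManifold A) (y : N.carrier) {u : N.Model}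
    (hu : u ∈ (extChartAt 𝓘(ℝ, N.Model) y).target) :
    ∃ e : N.Model ≃L[ℝ] N.Model, ∀ v,
      mfderiv 𝓘(ℝ, N.Model) 𝓘(ℝ, E) (fun u => N.ι ((extChartAt 𝓘(ℝ, N.Model) y).symm u)) u v =
        mfderiv 𝓘(ℝ, N.Model) 𝓘(ℝ, E) N.ι ((extChartAt 𝓘(ℝ, N.Model) y).symm u) (e v) := by
  have h := isInvertible_mfderivWithin_extChartAt_symm (I := 𝓘(ℝ, N.Model)) hu
  rw [ModelWithCorners.range_eq_univ, mfderivWithin_univ] at h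
  obtain ⟨e, he⟩ := h
  refine ⟨e, fun v => ?_⟩
  have hs := (contMDiffOn_extChartAt_symm (I := 𝓘(ℝ, N.Model)) (n := ∞) y u hu).contMDiffAt
    ((isOpen_extChartAt_target y).mem_nhds hu)
  refine (mfderiv_comp_apply u ((N.ι.contMDiff _).mdifferentiableAt (by simp))
    (hs.mdifferentiableAt (by simp)) v).trans ?_
  rw [← he]
  rfl

/-- The plaque of an integral manifold given by the chart at a point. -/
def plaque (N : IntegralManifold A) (y : N.carrier) : Plaque A N.dim where
  toFun := fun u => N.ι ((extChartAt 𝓘(ℝ, N.Model) y).symm u)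
  source := (extChartAt 𝓘(ℝ, N.Model) y).target
  isOpen_source := isOpen_extChartAt_target y
  contMDiffOn := N.ι.contMDiff.comp_contMDiffOn (contMDiffOn_extChartAt_symm y)
  injOn := fun a ha b hb hab =>
    (extChartAt 𝓘(ℝ, N.Model) y).symm.injOn ha hb (N.injective hab)
  immersion := fun u hu a b hab => by
    obtain ⟨e, he⟩ := N.exists_mfderiv_comp_extChartAt_symm y hu
    rw [he, he] at hab
    exact e.injective (N.immersion _ hab)
  range_mfderiv := fun u hu => by
    obtain ⟨e, he⟩ := N.exists_mfderiv_comp_extChartAt_symm y hu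
    rw [← N.range_mfderiv]
    ext w
    constructor
    · rintro ⟨v, rfl⟩
      exact ⟨e v, (he v).symm⟩
    · rintro ⟨v, rfl⟩
      exact ⟨e.symm v, (he _).trans (congrArg (fun w : N.Model =>
        mfderiv 𝓘(ℝ, N.Model) 𝓘(ℝ, E) N.ι _ w) (e.apply_symm_apply v))⟩

end IntegralManifold

end PlaqueSpaces

/-! ### Components of the plaque space are leaves; density of the leaves -/

section LeafExistence

variable {E : Type*} [NormedAddCommGroup E] [NormedSpace ℝ E] [FiniteDimensional ℝ E]
  {M : Type u} [TopologicalSpace M] [ChartedSpace E M] [IsManifold 𝓘(ℝ, E) ∞ M] [T2Space M]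
  {F : Type*} [NormedAddCommGroup F] [NormedSpace ℝ F] [FiniteDimensional ℝ F]
  {V : M → Type*} [TopologicalSpace (TotalSpace F V)]
  [∀ x, AddCommGroup (V x)] [∀ x, Module ℝ (V x)] [∀ x, TopologicalSpace (V x)]
  [FiberBundle F V] [VectorBundle ℝ F V] [ContMDiffVectorBundle ∞ F V 𝓘(ℝ, E)]
  {A : LieAlgebroid E F V} {r : ℕ}

/-- An `r`-dimensional integral manifold maps continuously to the plaque space. -/
theorem IntegralManifold.exists_continuous_lift (N : IntegralManifold A) :
    ∃ g : N.carrier → PlaqueSpace A N.dim, Continuous g ∧ ∀ y, (g y).val = N.ι y := by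
  have hg (y : N.carrier) : ∃ P : Plaque A N.dim, N.ι y ∈ P.toFun '' P.source :=
    ⟨N.plaque y, extChartAt 𝓘(ℝ, N.Model) y y, mem_extChartAt_target y,
      congrArg N.ι (extChartAt_to_inv y)⟩
  let g (y : N.carrier) : PlaqueSpace A N.dim := ⟨N.ι y, hg y⟩
  refine ⟨g, continuous_iff_continuousAt.2 fun y => ?_, fun y => rfl⟩
  -- Near `y` the lift is the chart of `N` at `y` followed by the inverse of the plaque-space chart
  -- which that same chart defines.
  let e := PlaqueSpace.chartHomeomorph (N.plaque y) (g y)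
  have he : ContinuousAt e.symm (extChartAt 𝓘(ℝ, N.Model) y y) :=
    e.symm.continuousAt (mem_extChartAt_target y)
  refine (ContinuousAt.comp he (continuousAt_extChartAt y)).congr ?_
  filter_upwards [extChartAt_source_mem_nhds (I := 𝓘(ℝ, N.Model)) y] with x hx
  refine PlaqueSpace.ext (((N.plaque y).chart_symm_val (g y)
    ((extChartAt 𝓘(ℝ, N.Model) y).map_source hx)).trans ?_)
  exact congrArg N.ι ((extChartAt 𝓘(ℝ, N.Model) y).left_inv hx)

namespace PlaqueSpace

instance : LocallyConnectedSpace (PlaqueSpace A r) :=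
  ChartedSpace.locallyConnectedSpace (EuclideanSpace ℝ (Fin r)) _

/-- The connected component of a point of the plaque space, as an open set. -/
def component (z : PlaqueSpace A r) : TopologicalSpace.Opens (PlaqueSpace A r) :=
  ⟨connectedComponent z, isOpen_connectedComponent⟩

/-- The component is open and inherits its charts from the plaque space, so its inclusion is still
locally a plaque. -/
theorem mfderiv_component (z : PlaqueSpace A r) (x : z.component) :
    ContMDiffAt 𝓘(ℝ, EuclideanSpace ℝ (Fin r)) 𝓘(ℝ, E) ∞ (fun y : z.component => y.1.val) x ∧
    Function.Injective (mfderiv 𝓘(ℝ, EuclideanSpace ℝ (Fin r)) 𝓘(ℝ, E)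
      (fun y : z.component => y.1.val) x) ∧
    LinearMap.range (mfderiv 𝓘(ℝ, EuclideanSpace ℝ (Fin r)) 𝓘(ℝ, E)
      (fun y : z.component => y.1.val) x).toLinearMap = LinearMap.range (A.anchor x.1.val) := by
  obtain ⟨P, hP, h⟩ := eventually_eq_toFun_chartAt x.1
  exact P.mfderiv_of_eventuallyEq hP (continuous_subtype_val.continuousAt.eventually h)

/-- The connected component of a point of the plaque space is an integral manifold. -/
def integralManifold (z : PlaqueSpace A r) : IntegralManifold A where
  carrier := z.component
  dim := r
  connectedSpace := isConnected_iff_connectedSpace.1 isConnected_connectedComponent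
  ι := ⟨fun y => y.1.val, fun x => (z.mfderiv_component x).1⟩
  injective := fun _ _ h => Subtype.ext (PlaqueSpace.ext h)
  immersion := fun x => (z.mfderiv_component x).2.1
  range_mfderiv := fun x => (z.mfderiv_component x).2.2

/-- The leaf through a point of the plaque space. -/
def leaf (z : PlaqueSpace A r) : Leaf A where
  toIntegralManifold := z.integralManifold
  maximal := by
    rintro N ⟨_, ⟨y, rfl⟩, ⟨x, hx⟩⟩
    obtain ⟨g, hg, hgι⟩ := N.exists_continuous_lift
    have hx' : x.1.val = N.ι y := hx
    -- Both dimensions are the rank of the anchor at the common point.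
    obtain rfl : N.dim = r := by
      rw [← (g y).finrank_range_anchor, ← x.1.finrank_range_anchor, hgι, hx']
    -- The lift of `N` is a connected set meeting the component, hence contained in it.
    have hgy : g y ∈ connectedComponent z := by
      rw [show g y = x.1 from PlaqueSpace.ext ((hgι y).trans hx'.symm)]
      exact x.2
    rintro _ ⟨y', rfl⟩
    have h : g y' ∈ connectedComponent z := by
      rw [connectedComponent_eq hgy]
      exact (isPreconnected_range hg).subset_connectedComponent ⟨y, rfl⟩ ⟨y', rfl⟩
    exact ⟨⟨g y', h⟩, hgι y'⟩

end PlaqueSpace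

/-- The union of the leaves is dense. -/
theorem LieAlgebroid.exists_leaf_mem (A : LieAlgebroid E F V) {O : Set M} (hO : IsOpen O)
    (hne : O.Nonempty) : ∃ (L : Leaf A) (x : L.carrier), L.ι x ∈ O := by
  let rk (x : M) : ℕ := Module.finrank ℝ (LinearMap.range (A.anchor x))
  have hbdd : BddAbove (rk '' O) := by
    refine ⟨Module.finrank ℝ E, ?_⟩
    rintro _ ⟨x, -, rfl⟩
    have : FiniteDimensional ℝ (TangentSpace 𝓘(ℝ, E) x) := inferInstanceAs (FiniteDimensional ℝ E)
    exact Submodule.finrank_le (LinearMap.range (A.anchor x))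
  -- The rank is bounded by `dim E`, so it attains a maximum on `O`; as `O` is open, this bounds the
  -- rank near `p` by its value at `p`.
  obtain ⟨p, hp, hpr⟩ := Nat.sSup_mem (hne.image rk) hbdd
  obtain ⟨P, hP⟩ := A.exists_plaque (p := p) rfl (by
    filter_upwards [hO.mem_nhds hp] with x hx
    exact (le_csSup hbdd ⟨x, hx, rfl⟩).trans hpr.ge)
  let z : PlaqueSpace A (rk p) := ⟨p, P, hP⟩
  exact ⟨z.leaf, ⟨z, mem_connectedComponent⟩, hp⟩

/-- Forms that agree on all leaves agree. -/
theorem SmoothForm.eq_of_restrict_eq {k : ℕ} {η θ : SmoothForm E F V k}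
    (h : ∀ L : Leaf A, L.restrict η = L.restrict θ) : η = θ := by
  refine Subtype.ext (funext fun x => AlternatingMap.ext fun a => ?_)
  by_contra hne
  let s : Fin k → Cₛ^∞⟮𝓘(ℝ, E); F, V⟯ := fun i => extendSection E F V x (a i)
  have hs : (fun i => s i x) = a := funext fun i => extendSection_apply x (a i)
  -- If the forms differ on some vectors at `x`, they differ on extending sections in an open set,
  -- which must meet a leaf.
  have hO : IsOpen {y | η.1 y (fun i => s i y) ≠ θ.1 y (fun i => s i y)} :=
    isOpen_ne_fun (η.2 s).continuous (θ.2 s).continuous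
  obtain ⟨L, y, hy⟩ := A.exists_leaf_mem hO ⟨x, by
    change η.1 x (fun i => s i x) ≠ θ.1 x (fun i => s i x)
    rwa [hs]⟩
  exact hy (DFunLike.congr_fun (congrFun (h L) y) _)

end LeafExistence

end

theorem mainTheorem4
    {E : Type*} [NormedAddCommGroup E] [NormedSpace ℝ E] [FiniteDimensional ℝ E]
    {M : Type u} [TopologicalSpace M] [ChartedSpace E M] [IsManifold 𝓘(ℝ, E) ∞ M]
    [T2Space M] [SigmaCompactSpace M]
    {F : Type*} [NormedAddCommGroup F] [NormedSpace ℝ F] [FiniteDimensional ℝ F]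
    {V : M → Type*} [TopologicalSpace (TotalSpace F V)]
    [∀ x, AddCommGroup (V x)] [∀ x, Module ℝ (V x)] [∀ x, TopologicalSpace (V x)]
    [FiberBundle F V] [VectorBundle ℝ F V] [ContMDiffVectorBundle ∞ F V 𝓘(ℝ, E)]
    (A : LieAlgebroid E F V) (k : ℕ) :
    -- a pointwise horizontal form restricts to a horizontal form on `A|_L`, and it induces a
    -- unique differential form on every leaf `L`
    (∀ η ∈ A.horizontalForms k, ∀ L : Leaf A,
      L.restrict η ∈ smoothFormSubmodule L.Model F ((L.ι : L.carrier → M) *ᵖ V) k ∧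
      LieAlgebroid.IsHorizontalFor L.anchor (L.restrict η) ∧
      ∃! β : DiffForm L.Model L.carrier k, L.IsInduced η β) ∧
    -- it is determined by these forms
    (∀ η ∈ A.horizontalForms k, ∀ θ ∈ A.horizontalForms k,
      (∀ L : Leaf A, ∃ β : DiffForm L.Model L.carrier k, L.IsInduced η β ∧ L.IsInduced θ β) →
      η = θ) ∧
    -- on the horizontal complex, `(d_A η)_L = d η_L`
    (∀ η ∈ A.horizontalComplex k, ∀ (L : Leaf A) (β : DiffForm L.Model L.carrier k),
      L.IsInduced η β → L.IsInduced (A.d k η) (deRhamD L.Model L.carrier k β)) ∧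
    -- if `[η] = 0` in horizontal cohomology, then `[η_L] = 0` in de Rham cohomology
    (∀ η : ↥(A.cocycles A.horizontalComplex k),
      A.cohomologyClass A.horizontalComplex k η = 0 →
      ∀ (L : Leaf A) (β : DiffForm L.Model L.carrier k), L.IsInduced η.1 β →
        ∃ hβ : β ∈ closedForms L.Model L.carrier k,
          deRhamClass L.Model L.carrier k ⟨β, hβ⟩ = 0) := by
  refine ⟨fun η hη L => ⟨L.restrict_mem_smoothFormSubmodule η, L.isHorizontalFor_restrict hη, ?_⟩,
    fun η _ θ _ h => ?_, fun η hη L β hβ => hβ.d, fun η hη L β hβ => ?_⟩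
  · obtain ⟨β, hβ⟩ := L.exists_isInduced hη
    exact ⟨β, hβ, fun β' hβ' => hβ'.unique hβ⟩
  -- A common induced form `β` determines both restrictions, as its pullback along `L.anchor`.
  · refine SmoothForm.eq_of_restrict_eq (A := A) fun L => ?_
    obtain ⟨β, hη, hθ⟩ := h L
    exact funext fun x => AlternatingMap.ext fun a => (hη x a).symm.trans (hθ x a)
  · exact hβ.exists_deRhamClass_eq_zero hη
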